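/- **Theorem.** Let $G$ be a finite abelian group and $\mathbf k$ a commutative $\mathbb Q$-algebra. Then $\mathsf{Stab}(\hat\Delta^{\mathcal M}_G)(\mathbf k)=\mathsf{Stab}(\hat\Delta^{\mathrm{mod}}_\star)(\mathbf k)$ as subgroups of the group $(\mathcal G(\mathbf k\langle\langle X\rangle\rangle),\circledast)$. The objects are as follows; it is part of the claim that the coproducts $\hat\Delta^{\mathcal W}_G$ and $\hat\Delta^{\mathcal M}_G$ below exist and are unique. *Group.* $X=\{x_0\}\sqcup\{x_g : g\in G\}$ (with $x_1:=x_{1_G}$), $\mathbf k\langle\langle X\rangle\rangle$ is the algebra of noncommutative formal power series $v=\sum_w (v|w)w$, completed for the degree with all letters of degree $1$, and $\hat\Delta$ is the continuous algebra morphism $\mathbf k\langle\langle X\rangle\rangle\to\mathbf k\langle\langle X\rangle\rangle^{\hat\otimes 2}$ for which all letters are primitive. $\mathcal G(\mathbf k\langle\langle X\rangle\rangle)$ is the set of invertible $\Psi$ with $\hat\Delta(\Psi)=\Psi\otimes\Psi$. For $g\in G$, $t_g$ is the continuous algebra automorphism $x_0\mapsto x_0$, $x_h\mapsto x_{gh}$.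 For $\Psi\in\mathcal G(\mathbf k\langle\langle X\rangle\rangle)$, $\mathrm{aut}_\Psi$ is the continuous algebra automorphism $x_0\mapsto x_0$, $x_g\mapsto t_g(\Psi^{-1})\,x_g\,t_g(\Psi)$, $S_\Psi=\ell_\Psi\circ\mathrm{aut}_\Psi$ (where $\ell_a$ is left multiplication by $a$), and $\Psi\circledast\Phi=S_\Psi(\Phi)$. Finally $\Gamma_\Psi(x)=\exp\bigl(\sum_{n\ge2}\frac{(-1)^{n-1}}{n}(\Psi|x_0^{n-1}x_1)x^n\bigr)\in\mathbf k[[x]]^\times$. *Racinet's side.* $\mathbf k\langle\langle Y\rangle\rangle$ is the algebra of formal series in the free letters $y_{n,g}$ ($n\ge1$, $g\in G$; $\deg y_{n,g}=n$), identified with a subalgebra of $\mathbf k\langle\langle X\rangle\rangle$ by $y_{n,g}=x_0^{n-1}x_g$, and $\hat\Delta^{\mathrm{alg}}_\star$ is the continuous algebra morphism $\mathbf k\langle\langle Y\rangle\rangle\to\mathbf k\langle\langle Y\rangle\rangle^{\hat\otimes2}$ with $$y_{n,g}\mapsto y_{n,g}\otimes1+1\otimes y_{n,g}+\sum_{m=1}^{n-1}\sum_{h\in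 G}y_{m,h}\otimes y_{n-m,gh^{-1}}.$$ The projection $\pi_Y:\mathbf k\langle\langle X\rangle\rangle\to\mathbf k\langle\langle X\rangle\rangle/\mathbf k\langle\langle X\rangle\rangle x_0$ restricts to a bijection on $\mathbf k\langle\langle Y\rangle\rangle$, and $\hat\Delta^{\mathrm{mod}}_\star$ is the map from $\mathbf k\langle\langle X\rangle\rangle/\mathbf k\langle\langle X\rangle\rangle x_0$ to its completed tensor square with $\hat\Delta^{\mathrm{mod}}_\star\circ\pi_Y=\pi_Y^{\hat\otimes2}\circ\hat\Delta^{\mathrm{alg}}_\star$ on $\mathbf k\langle\langle Y\rangle\rangle$. Let $\mathbf q$ be the continuous linear automorphism of $\mathbf k\langle\langle X\rangle\rangle$ that maps $x_0^{n_1-1}x_{g_1}x_0^{n_2-1}x_{g_2}\cdots x_0^{n_r-1}x_{g_r}x_0^{n_{r+1}-1}$ to $x_0^{n_1-1}x_{g_1}x_0^{n_2-1}x_{g_2g_1^{-1}}\cdots x_0^{n_r-1}x_{g_rg_{r-1}^{-1}}x_0^{n_{r+1}-1}$, and $\bar{\mathbf q}$ the automorphism of $\mathbf k\langle\langle X\rangle\rangle/\mathbf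 k\langle\langle X\rangle\rangle x_0$ that it induces. $S^Y_\Psi$ is the automorphism of $\mathbf k\langle\langle X\rangle\rangle/\mathbf k\langle\langle X\rangle\rangle x_0$ with $S^Y_\Psi\circ\bar{\mathbf q}\circ\pi_Y=\bar{\mathbf q}\circ\pi_Y\circ S_\Psi$, ${}^\Gamma S^Y_\Psi=\ell_{\Gamma_\Psi^{-1}(x_1)}\circ S^Y_\Psi$, and $$\mathsf{Stab}(\hat\Delta^{\mathrm{mod}}_\star)(\mathbf k)=\{\Psi\in\mathcal G(\mathbf k\langle\langle X\rangle\rangle) : ({}^\Gamma S^Y_\Psi)^{\hat\otimes2}\circ\hat\Delta^{\mathrm{mod}}_\star=\hat\Delta^{\mathrm{mod}}_\star\circ{}^\Gamma S^Y_\Psi\}.$$ *Crossed product side.* $\hat{\mathcal V}_G$ is the degree completion of the $\mathbf k$-algebra generated by $e_0,e_1$ (degree $1$) and the $g\in G$ (degree $0$) with relations $g\times h=gh$, $1=1_G$, $g\times e_0=e_0\times g$. Put $\hat{\mathcal W}_G=\mathbf k\oplus\hat{\mathcal V}_Ge_1$, $\hat{\mathcal M}_G=\hat{\mathcal V}_G/\bigl(\hat{\mathcal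 V}_Ge_0+\sum_{g\ne1}\hat{\mathcal V}_G(g-1)\bigr)$, let $1_{\mathcal M}$ be the class of $1$ and $z_{n,g}=-e_0^{n-1}ge_1\in\hat{\mathcal W}_G$. There is a unique continuous algebra morphism $\hat\Delta^{\mathcal W}_G:\hat{\mathcal W}_G\to\hat{\mathcal W}_G^{\hat\otimes2}$ with $$z_{n,g}\mapsto z_{n,g}\otimes1+1\otimes z_{n,g}+\sum_{m=1}^{n-1}\sum_{h\in G}z_{m,h}\otimes z_{n-m,gh^{-1}},$$ and a unique continuous linear map $\hat\Delta^{\mathcal M}_G:\hat{\mathcal M}_G\to\hat{\mathcal M}_G^{\hat\otimes2}$ with $\hat\Delta^{\mathcal M}_G(w\cdot1_{\mathcal M})=\hat\Delta^{\mathcal W}_G(w)\cdot1_{\mathcal M}^{\otimes2}$ for $w\in\hat{\mathcal W}_G$. Let $\beta:\mathbf k\langle\langle X\rangle\rangle\to\hat{\mathcal V}_G$ be the continuous algebra morphism $x_0\mapsto e_0$, $x_g\mapsto-ge_1g^{-1}$. For $\Psi\in\mathcal G(\mathbf k\langle\langle X\rangle\rangle)$ let $\mathrm{aut}^{\mathcal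 V,(0)}_\Psi$ be the continuous algebra automorphism of $\hat{\mathcal V}_G$ with $e_0\mapsto e_0$, $g\mapsto g$, $e_1\mapsto\beta(\Psi^{-1})e_1\beta(\Psi)$, let $\mathrm{aut}^{\mathcal V,(10)}_\Psi=\ell_{\beta(\Psi)}\circ\mathrm{aut}^{\mathcal V,(0)}_\Psi$, let $\mathrm{aut}^{\mathcal M,(10)}_\Psi$ be the automorphism of $\hat{\mathcal M}_G$ that it induces, and ${}^\Gamma\mathrm{aut}^{\mathcal M,(10)}_\Psi=\ell_{\Gamma_\Psi^{-1}(-e_1)}\circ\mathrm{aut}^{\mathcal M,(10)}_\Psi$. Then $$\mathsf{Stab}(\hat\Delta^{\mathcal M}_G)(\mathbf k)=\{\Psi\in\mathcal G(\mathbf k\langle\langle X\rangle\rangle) : ({}^\Gamma\mathrm{aut}^{\mathcal M,(10)}_\Psi)^{\hat\otimes2}\circ\hat\Delta^{\mathcal M}_G=\hat\Delta^{\mathcal M}_G\circ{}^\Gamma\mathrm{aut}^{\mathcal M,(10)}_\Psi\}.$$ -/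

import Mathlib

open scoped TensorProduct

namespace DoubleShuffle

set_option linter.unusedSectionVars false

/-! ## Noncommutative formal power series -/

/-- A formal power series over `k` in noncommuting variables indexed by `α`:
a family of coefficients indexed by the words (lists) in `α`. -/
def Series (k α : Type*) : Type _ := List α → k

namespace Series

@[ext] theorem ext {k α : Type*} {f g : Series k α} (h : ∀ w, f w = g w) : f = g := funext h

variable {k α : Type*} [CommRing k]

instance : AddCommGroup (Series k α) := inferInstanceAs (AddCommGroup (List α → k))
instance : Module k (Series k α) := inferInstanceAs (Module k (List α → k))

@[simp] theorem add_apply (f g : Series k α) (w : List α) : (f + g) w = f w + g w := rfl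
@[simp] theorem sub_apply (f g : Series k α) (w : List α) : (f - g) w = f w - g w := rfl
@[simp] theorem zero_apply (w : List α) : (0 : Series k α) w = 0 := rfl
@[simp] theorem smul_apply (c : k) (f : Series k α) (w : List α) : (c • f) w = c * f w := rfl

theorem sum_apply {ι : Type*} (s : Finset ι) (f : ι → Series k α) (w : List α) :
    (∑ i ∈ s, f i) w = ∑ i ∈ s, f i w := Finset.sum_apply (M := fun _ : List α => k) w s f

/-- The Cauchy product: `(f g | w) = ∑_{w = u v} (f | u) (g | v)`. -/
instance : Mul (Series k α) where
  mul f g := fun w => ∑ i ∈ Finset.range (w.length + 1), f (w.take i) * g (w.drop i)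

theorem mul_apply (f g : Series k α) (w : List α) :
    (f * g) w = ∑ i ∈ Finset.range (w.length + 1), f (w.take i) * g (w.drop i) := rfl

instance : One (Series k α) where
  one := fun w => match w with
    | [] => 1
    | _ :: _ => 0

@[simp] theorem one_nil : (1 : Series k α) [] = 1 := rfl
@[simp] theorem one_cons (a : α) (w : List α) : (1 : Series k α) (a :: w) = 0 := rfl

@[simp] theorem mul_nil (f g : Series k α) : (f * g) [] = f [] * g [] := by simp [mul_apply]

/-- Left derivative of a series with respect to a letter. -/
def shift (a : α) (f : Series k α) : Series k α := fun w => f (a :: w)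

theorem mul_cons (f g : Series k α) (a : α) (w : List α) :
    (f * g) (a :: w) = f [] * g (a :: w) + (shift a f * g) w := by
  rw [mul_apply, List.length_cons, Finset.sum_range_succ', add_comm]
  simp [mul_apply, shift]

theorem shift_add (a : α) (f g : Series k α) : shift a (f + g) = shift a f + shift a g := rfl

theorem shift_mul (a : α) (f g : Series k α) :
    shift a (f * g) = f [] • shift a g + shift a f * g := by
  ext w
  simp [shift, mul_cons]

protected theorem add_mul' (f g h : Series k α) : (f + g) * h = f * h + g * h := by
  ext w
  simp [mul_apply, add_mul, Finset.sum_add_distrib]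

protected theorem mul_add' (f g h : Series k α) : f * (g + h) = f * g + f * h := by
  ext w
  simp [mul_apply, mul_add, Finset.sum_add_distrib]

protected theorem smul_mul' (c : k) (f g : Series k α) : (c • f) * g = c • (f * g) := by
  ext w
  simp [mul_apply, Finset.mul_sum, mul_assoc]

protected theorem mul_smul' (c : k) (f g : Series k α) : f * (c • g) = c • (f * g) := by
  ext w
  simp [mul_apply, Finset.mul_sum, mul_left_comm]

protected theorem zero_mul' (f : Series k α) : 0 * f = 0 := by
  ext w
  simp [mul_apply]

protected theorem mul_zero' (f : Series k α) : f * 0 = 0 := by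
  ext w
  simp [mul_apply]

protected theorem one_mul' (f : Series k α) : 1 * f = f := by
  ext w
  cases w with
  | nil => simp
  | cons a w =>
    rw [mul_cons]
    have : shift a (1 : Series k α) = 0 := rfl
    simp [this, Series.zero_mul']

protected theorem mul_one' (f : Series k α) : f * 1 = f := by
  ext w
  induction w generalizing f with
  | nil => simp
  | cons a w ih =>
    rw [mul_cons, ih]
    simp [shift]

protected theorem mul_assoc' (f g h : Series k α) : f * g * h = f * (g * h) := by
  ext w
  induction w generalizing f g h with
  | nil => simp [mul_assoc]
  | cons a w ih =>
    rw [mul_cons, mul_cons, mul_cons, shift_mul, Series.add_mul', add_apply, ih,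
      Series.smul_mul', smul_apply, mul_nil]
    ring

instance : Ring (Series k α) :=
  { (inferInstance : AddCommGroup (Series k α)) with
  left_distrib := Series.mul_add'
  right_distrib := Series.add_mul'
  zero_mul := Series.zero_mul'
  mul_zero := Series.mul_zero'
  mul_assoc := Series.mul_assoc'
  one_mul := Series.one_mul'
  mul_one := Series.mul_one' }

instance : Algebra k (Series k α) :=
  Algebra.ofModule Series.smul_mul' Series.mul_smul'

/-- The variable attached to a letter. -/
noncomputable def var (a : α) : Series k α := by
  classical exact fun w => if w = [a] then 1 else 0

end Series

/-! ## Filtered algebras, inverse limits -/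

/-- A ring with a decreasing multiplicative filtration by ideals starting at the whole ring
(here: the elements of degree `≥ n`); it defines the topology. -/
class FilteredRing (A : Type*) [Ring A] where
  fil : ℕ → Ideal A
  fil_zero : ∀ a, a ∈ fil 0
  fil_mul : ∀ {m n a b}, a ∈ fil m → b ∈ fil n → a * b ∈ fil (m + n)
  fil_anti : ∀ {m n a}, m ≤ n → a ∈ fil n → a ∈ fil m

/-- The `n`-th step of the filtration. -/
abbrev filR (A : Type*) [Ring A] [FilteredRing A] (n : ℕ) : Ideal A := FilteredRing.fil n

instance {A : Type*} [Ring A] [FilteredRing A] (n : ℕ) :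
    (filR A n).IsTwoSided :=
  ⟨fun b ha => by simpa using FilteredRing.fil_mul ha (FilteredRing.fil_zero b)⟩

/-- The class modulo the `n`-th step of the filtration of a filtered algebra. -/
noncomputable def modFil (k : Type*) [CommRing k] (A : Type*) [Ring A] [Algebra k A]
    [FilteredRing A] (n : ℕ) : A →ₐ[k] A ⧸ filR A n :=
  Ideal.Quotient.mkₐ k _

/-- Given compatible surjections `p n : T → Q n` with decreasing kernels, this is the inverse
limit of the `Q n`, i.e. the sequences which are compatible with the transition maps. -/
def limMod {k T : Type*} {Q : ℕ → Type*} [CommRing k] [AddCommGroup T] [Module k T]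
    [∀ n, AddCommGroup (Q n)] [∀ n, Module k (Q n)] (p : ∀ n, T →ₗ[k] Q n) :
    Submodule k (∀ n, Q n) where
  carrier := {t | ∀ n, ∃ x : T, ∀ m ≤ n, t m = p m x}
  zero_mem' n := ⟨0, fun m _ => by simp⟩
  add_mem' ha hb n := by
    obtain ⟨x, hx⟩ := ha n
    obtain ⟨y, hy⟩ := hb n
    exact ⟨x + y, fun m hm => by simp [hx m hm, hy m hm]⟩
  smul_mem' c a ha n := by
    obtain ⟨x, hx⟩ := ha n
    exact ⟨c • x, fun m hm => by simp [hx m hm]⟩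

/-- The inverse limit `limMod` for algebra morphisms, as an algebra. -/
def limAlg {k T : Type*} {Q : ℕ → Type*} [CommRing k] [Ring T] [Algebra k T]
    [∀ n, Ring (Q n)] [∀ n, Algebra k (Q n)] (p : ∀ n, T →ₐ[k] Q n) :
    Subalgebra k (∀ n, Q n) where
  carrier := {t | ∀ n, ∃ x : T, ∀ m ≤ n, t m = p m x}
  add_mem' ha hb n := by
    obtain ⟨x, hx⟩ := ha n
    obtain ⟨y, hy⟩ := hb n
    exact ⟨x + y, fun m hm => by simp [hx m hm, hy m hm]⟩
  mul_mem' ha hb n := by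
    obtain ⟨x, hx⟩ := ha n
    obtain ⟨y, hy⟩ := hb n
    exact ⟨x * y, fun m hm => by simp [hx m hm, hy m hm]⟩
  algebraMap_mem' c n := ⟨algebraMap k T c, fun m _ => by simp⟩

/-- The canonical morphism from `T` to the inverse limit. -/
def toLimAlg {k T : Type*} {Q : ℕ → Type*} [CommRing k] [Ring T] [Algebra k T]
    [∀ n, Ring (Q n)] [∀ n, Algebra k (Q n)] (p : ∀ n, T →ₐ[k] Q n) : T →ₐ[k] limAlg p :=
  (AlgHom.pi (fun n => p n)).codRestrict (limAlg p) fun x _ => ⟨x, fun _ _ => rfl⟩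

/-! ## Weighted alphabets and evaluation of series -/

/-- An alphabet whose letters have positive degrees, finitely many in each degree. -/
class Weighted (α : Type*) where
  wt : α → ℕ
  wt_pos : ∀ a, 0 < wt a
  finite_lt : ∀ n, {a | wt a < n}.Finite

/-- The degree of a word. -/
def wordWt {α : Type*} [Weighted α] (w : List α) : ℕ := (w.map Weighted.wt).sum

theorem wordWt_append {α : Type*} [Weighted α] (u v : List α) :
    wordWt (u ++ v) = wordWt u + wordWt v := by simp [wordWt]

@[simp] theorem wordWt_cons {α : Type*} [Weighted α] (a : α) (v : List α) :
    wordWt (a :: v) = Weighted.wt a + wordWt v := by simp [wordWt]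

@[simp] theorem wordWt_nil {α : Type*} [Weighted α] : wordWt ([] : List α) = 0 := rfl

theorem wordWt_finite {α : Type*} [Weighted α] (n : ℕ) : {w : List α | wordWt w < n}.Finite := by
  have hfin := Weighted.finite_lt (α := α) n
  have : Finite {a : α | Weighted.wt a < n} := hfin
  refine ((List.finite_length_lt {a : α | Weighted.wt a < n} n).image
    (List.map Subtype.val)).subset ?_
  intro w hw
  have key : ∀ w : List α, wordWt w < n →
      w.length ≤ wordWt w ∧ ∃ u : List {a : α | Weighted.wt a < n}, u.map Subtype.val = w := by
    intro w
    induction w with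
    | nil => exact fun _ => ⟨le_rfl, [], rfl⟩
    | cons a w ih =>
      intro h
      rw [wordWt_cons] at h
      obtain ⟨h1, u, hu⟩ := ih (by omega)
      have := Weighted.wt_pos a
      refine ⟨by simp only [List.length_cons, wordWt_cons]; omega, ⟨a, ?_⟩ :: u, by rw [List.map_cons, hu]⟩
      show Weighted.wt a < n
      omega
  obtain ⟨h1, u, hu⟩ := key w hw
  refine ⟨u, ?_, hu⟩
  have : u.length = w.length := by rw [← hu, List.length_map]
  have hw' : wordWt w < n := hw
  show u.length < n
  omega

namespace Series

variable {k α : Type*} [CommRing k]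

/-- The filtration by the degree: `fil n` consists of the series without terms of
degree `< n`. -/
instance [Weighted α] : FilteredRing (Series k α) := by
  have hmul : ∀ {m n : ℕ} {f g : Series k α}, (∀ w, wordWt w < m → f w = 0) →
      (∀ w, wordWt w < n → g w = 0) → ∀ w, wordWt w < m + n → (f * g) w = 0 := by
    intro m n f g hf hg w hw
    rw [mul_apply]
    refine Finset.sum_eq_zero fun i _ => ?_
    have h : wordWt (w.take i) + wordWt (w.drop i) = wordWt w := by
      rw [← wordWt_append, List.take_append_drop]
    by_cases h1 : wordWt (w.take i) < m
    · rw [hf _ h1, zero_mul]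
    · rw [hg (w.drop i) (by omega), mul_zero]
  exact
  { fil := fun n =>
      { carrier := {f | ∀ w, wordWt w < n → f w = 0}
        zero_mem' := fun w _ => rfl
        add_mem' := fun {a b} ha hb w hw => by rw [add_apply, ha w hw, hb w hw, add_zero]
        smul_mem' := fun c f hf w hw => hmul (m := 0) (fun w h => by omega) hf w (by omega) }
    fil_zero := fun a w hw => by omega
    fil_mul := fun ha hb => hmul ha hb
    fil_anti := fun hmn ha w hw => ha w (by omega) }

theorem mem_fil [Weighted α] {n : ℕ} {f : Series k α} :
    f ∈ filR (Series k α) n ↔ ∀ w, wordWt w < n → f w = 0 := Iff.rfl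

/-- Evaluation `∑_w (f | w) w ↦ ∑_w (f | w) φ(w)` of series in an algebra, where all but finitely
many words in the elements `φ a` are zero. -/
noncomputable def evalHom {Q : Type*} [Ring Q] [Algebra k Q] (φ : α → Q)
    (h : {w : List α | (w.map φ).prod ≠ 0}.Finite) : Series k α →ₐ[k] Q :=
  AlgHom.ofLinearMap
    { toFun := fun f => ∑ w ∈ h.toFinset, f w • (w.map φ).prod
      map_add' := fun f g => by simp [add_smul, Finset.sum_add_distrib]
      map_smul' := fun c f => by simp [mul_smul, Finset.smul_sum] }
    (by
      show ∑ w ∈ h.toFinset, (1 : Series k α) w • (w.map φ).prod = 1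
      rw [Finset.sum_eq_single []]
      · simp
      · intro w _ hw
        cases w with
        | nil => exact absurd rfl hw
        | cons a w => simp
      · intro hn
        simp at hn
        simp [hn])
    (by
      intro f g
      show ∑ w ∈ h.toFinset, (f * g) w • (w.map φ).prod =
        (∑ w ∈ h.toFinset, f w • (w.map φ).prod) * ∑ w ∈ h.toFinset, g w • (w.map φ).prod
      rw [Finset.sum_mul_sum, ← Finset.sum_product']
      simp only [mul_apply, Finset.sum_smul]
      rw [Finset.sum_sigma']
      refine Finset.sum_of_injOn (fun x => (x.1.take x.2, x.1.drop x.2)) ?_ ?_ ?_ ?_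
      · rintro ⟨w, i⟩ hw ⟨v, j⟩ hv he
        simp only [Finset.coe_sigma, Set.mem_sigma_iff, Finset.mem_coe, Finset.mem_range] at hw hv
        simp only [Prod.mk.injEq] at he
        have h1 : w = v := by
          rw [← List.take_append_drop i w, ← List.take_append_drop j v, he.1, he.2]
        have h2 := congrArg List.length he.1
        simp only [List.length_take] at h2
        have h3 : i = j := by omega
        subst h1
        subst h3
        rfl
      · rintro ⟨w, i⟩ hw
        simp only [Finset.coe_sigma, Set.mem_sigma_iff, Finset.mem_coe, Set.Finite.mem_toFinset,
          Set.mem_ofPred_eq] at hw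
        have hp : ((w.take i).map φ).prod * ((w.drop i).map φ).prod ≠ 0 := by
          rw [← List.prod_append, ← List.map_append, List.take_append_drop]
          exact hw.1
        simp only [Finset.coe_product, Set.mem_prod, Finset.mem_coe, Set.Finite.mem_toFinset,
          Set.mem_ofPred_eq]
        exact ⟨left_ne_zero_of_mul hp, right_ne_zero_of_mul hp⟩
      · rintro ⟨a, b⟩ _ hn
        by_contra hne
        apply hn
        refine ⟨⟨a ++ b, a.length⟩, ?_, by simp⟩
        simp only [Finset.coe_sigma, Set.mem_sigma_iff, Finset.mem_coe, Set.Finite.mem_toFinset,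
          Set.mem_ofPred_eq, Finset.mem_range]
        refine ⟨fun h0 => hne ?_, by simp only [List.length_append]; omega⟩
        rw [List.map_append, List.prod_append] at h0
        simp [h0]
      · rintro ⟨w, i⟩ _
        simp only [smul_mul_smul_comm]
        rw [← List.prod_append, ← List.map_append, List.take_append_drop])

end Series


namespace Series

variable {k α : Type*} [CommRing k]

theorem evalHom_eq_sum {Q : Type*} [Ring Q] [Algebra k Q] (φ : α → Q)
    (h : {w : List α | (w.map φ).prod ≠ 0}.Finite) (f : Series k α) (s : Finset (List α))
    (hs : ∀ w, w ∉ s → (w.map φ).prod = 0) :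
    evalHom φ h f = ∑ w ∈ s, f w • (w.map φ).prod := by
  show ∑ w ∈ h.toFinset, f w • (w.map φ).prod = _
  refine Finset.sum_subset (fun w hw => ?_) fun w _ hw => ?_
  · by_contra hn
    exact (Set.Finite.mem_toFinset h).1 hw (hs w hn)
  · have : (w.map φ).prod = 0 := by
      by_contra hn
      exact hw ((Set.Finite.mem_toFinset h).2 hn)
    rw [this, smul_zero]

theorem finite_of_wordWt [Weighted α] {Q : Type*} [Ring Q] (φ : α → Q)
    (h : ∃ N, ∀ w : List α, N ≤ wordWt w → (w.map φ).prod = 0) :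
    {w : List α | (w.map φ).prod ≠ 0}.Finite := by
  obtain ⟨N, hN⟩ := h
  refine (wordWt_finite N).subset fun w hw => ?_
  by_contra hn
  exact hw (hN w (not_lt.1 hn))

section evalLim

variable {T : Type*} {Q : ℕ → Type*} [Ring T] [Algebra k T]
  [∀ n, Ring (Q n)] [∀ n, Algebra k (Q n)]

/-- Evaluation `∑_w (f | w) w ↦ ∑_w (f | w) φ(w)` of series in the inverse limit of the `Q n`,
where `φ a ∈ T` and for each `n` the words of large degree in the elements `φ a` vanish in `Q n`.
It is the continuous algebra morphism extending `φ`. -/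
noncomputable def evalLim [Weighted α] (p : ∀ n, T →ₐ[k] Q n) (φ : α → T)
    (h : ∀ n, ∃ N, ∀ w : List α, N ≤ wordWt w → (w.map fun a => p n (φ a)).prod = 0) :
    Series k α →ₐ[k] limAlg p :=
  (AlgHom.pi (fun n => evalHom (fun a => p n (φ a)) (finite_of_wordWt _ (h n)))).codRestrict
    (limAlg p) (by
      intro f n
      have h' := h
      choose N hN using h'
      refine ⟨∑ w ∈ (wordWt_finite ((Finset.range (n + 1)).sup N)).toFinset,
        f w • (w.map φ).prod, fun m hm => ?_⟩
      rw [map_sum]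
      show evalHom _ _ f = _
      rw [evalHom_eq_sum _ _ _ (wordWt_finite ((Finset.range (n + 1)).sup N)).toFinset]
      · refine Finset.sum_congr rfl fun w _ => ?_
        rw [map_smul, map_list_prod, List.map_map]
        rfl
      · intro w hw
        rw [Set.Finite.mem_toFinset] at hw
        have h1 : N m ≤ (Finset.range (n + 1)).sup N :=
          Finset.le_sup (f := N) (Finset.mem_range.2 (by omega))
        exact hN m w (h1.trans (not_lt.1 hw)))

end evalLim

/-- A product of elements of degree at least the weights has degree at least the total weight. -/
theorem prod_mem_fil [Weighted α] {A : Type*} [Ring A] [FilteredRing A] (φ : α → A)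
    (hφ : ∀ a, φ a ∈ filR A (Weighted.wt a)) (w : List α) :
    (w.map φ).prod ∈ filR A (wordWt w) := by
  induction w with
  | nil => exact FilteredRing.fil_zero _
  | cons a w ih =>
    rw [List.map_cons, List.prod_cons, wordWt_cons]
    exact FilteredRing.fil_mul (hφ a) ih

theorem modFil_eq_zero {A : Type*} [Ring A] [Algebra k A] [FilteredRing A] {n : ℕ} {a : A} :
    modFil k A n a = 0 ↔ a ∈ filR A n :=
  Ideal.Quotient.eq_zero_iff_mem

theorem modFil_prod_eq_zero [Weighted α] {A : Type*} [Ring A] [Algebra k A] [FilteredRing A]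
    (φ : α → A) (hφ : ∀ a, φ a ∈ filR A (Weighted.wt a)) (n : ℕ) (w : List α)
    (hw : n ≤ wordWt w) : (w.map fun a => modFil k A n (φ a)).prod = 0 := by
  have : (w.map fun a => modFil k A n (φ a)).prod = modFil k A n (w.map φ).prod := by
    rw [map_list_prod, List.map_map]
    rfl
  rw [this, modFil_eq_zero]
  exact FilteredRing.fil_anti hw (prod_mem_fil φ hφ w)

section substHom

variable {β : Type*} [Weighted α] [Weighted β] (φ : α → Series k β)

/-- The linear map `∑_w (f | w) w ↦ ∑_w (f | w) φ(w)`; only the words `w` of degree `≤ deg v`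
contribute to the coefficient of `v`. -/
noncomputable def substLin : Series k α →ₗ[k] Series k β where
  toFun f := fun v => ∑ w ∈ (wordWt_finite (α := α) (wordWt v + 1)).toFinset,
    f w * (w.map φ).prod v
  map_add' f g := by
    ext v
    exact (Finset.sum_congr rfl fun w _ => add_mul (f w) (g w) _).trans Finset.sum_add_distrib
  map_smul' c f := by
    ext v
    exact (Finset.sum_congr rfl fun w _ => mul_assoc c (f w) _).trans (Finset.mul_sum _ _ _).symm

theorem substLin_mem_fil {n : ℕ} {f : Series k α}
    (hf : f ∈ filR (Series k α) n) :
    substLin φ f ∈ filR (Series k β) n := by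
  intro v hv
  refine Finset.sum_eq_zero fun w hw => ?_
  rw [Set.Finite.mem_toFinset] at hw
  have hw' : wordWt w < wordWt v + 1 := hw
  rw [hf w (by omega), zero_mul]

theorem modFil_substLin
    (hφ : ∀ a, φ a ∈ filR (Series k β) (Weighted.wt a))
    (n : ℕ) (f : Series k α) :
    modFil k (Series k β) n (substLin φ f) =
      evalHom (fun a => modFil k (Series k β) n (φ a))
        (finite_of_wordWt _ ⟨n, modFil_prod_eq_zero φ hφ n⟩) f := by
  rw [evalHom_eq_sum _ _ _ (wordWt_finite (α := α) n).toFinset]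
  · have : ∑ w ∈ (wordWt_finite (α := α) n).toFinset,
        f w • (w.map fun a => modFil k (Series k β) n (φ a)).prod =
        modFil k (Series k β) n (∑ w ∈ (wordWt_finite (α := α) n).toFinset,
          f w • (w.map φ).prod) := by
      rw [map_sum]
      refine Finset.sum_congr rfl fun w _ => ?_
      rw [map_smul, map_list_prod, List.map_map]
      rfl
    rw [this, ← sub_eq_zero, ← map_sub, modFil_eq_zero]
    intro v hv
    rw [sub_apply, sum_apply, sub_eq_zero]
    refine Finset.sum_subset (fun w hw => ?_) fun w _ hw => ?_
    · rw [Set.Finite.mem_toFinset] at hw ⊢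
      have hw' : wordWt w < wordWt v + 1 := hw
      show wordWt w < n
      omega
    · rw [Set.Finite.mem_toFinset] at hw
      have hw' : ¬ wordWt w < wordWt v + 1 := hw
      rw [prod_mem_fil φ hφ w v (by omega), mul_zero]
  · intro w hw
    rw [Set.Finite.mem_toFinset] at hw
    exact modFil_prod_eq_zero φ hφ n w (not_lt.1 hw)

theorem eq_of_modFil {f g : Series k β}
    (h : ∀ n, modFil k (Series k β) n f = modFil k (Series k β) n g) : f = g := by
  ext v
  have := h (wordWt v + 1)
  rw [← sub_eq_zero, ← map_sub, modFil_eq_zero] at this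
  exact sub_eq_zero.1 (this v (by omega))

/-- The continuous algebra morphism `∑_w (f | w) w ↦ ∑_w (f | w) φ(w)` between algebras of
series. -/
noncomputable def substHom
    (hφ : ∀ a, φ a ∈ filR (Series k β) (Weighted.wt a)) :
    Series k α →ₐ[k] Series k β :=
  AlgHom.ofLinearMap (substLin φ)
    (eq_of_modFil fun n => by rw [modFil_substLin φ hφ, map_one, map_one])
    (fun f g => eq_of_modFil fun n => by
      rw [modFil_substLin φ hφ, map_mul, map_mul, modFil_substLin φ hφ, modFil_substLin φ hφ])

end substHom

end Series

/-! ## The alphabets -/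

/-- The alphabet `X = {x₀} ⊔ {x_g}`: `none` stands for `x₀` and `some g` for `x_g`. -/
abbrev XX (G : Type*) := Option G

/-- The alphabet `Y = {y_{n,g}}`, `n ≥ 1`. -/
abbrev YY (G : Type*) := ℕ+ × G

instance (G : Type*) [Finite G] : Weighted (XX G) where
  wt _ := 1
  wt_pos _ := one_pos
  finite_lt _ := Set.toFinite _

instance (G : Type*) [Finite G] : Weighted (YY G) where
  wt a := a.1
  wt_pos a := a.1.pos
  finite_lt n := by
    have h : {m : ℕ+ | (m : ℕ) < n}.Finite := by
      refine Set.Finite.of_finite_image (f := fun m : ℕ+ => (m : ℕ)) ?_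
        PNat.coe_injective.injOn
      exact (Set.finite_lt_nat n).subset (by rintro _ ⟨m, hm, rfl⟩; exact hm)
    exact (h.prod (Set.finite_univ (α := G))).subset fun a ha => ⟨ha, trivial⟩

/-- One variable of degree `1`. -/
instance : Weighted Unit where
  wt _ := 1
  wt_pos _ := one_pos
  finite_lt _ := Set.toFinite _

/-! ## Completed tensor squares -/

/-- A `k`-module with a filtration by submodules (defining the topology). -/
class FilteredModule (k M : Type*) [CommRing k] [AddCommGroup M] [Module k M] where
  fil : ℕ → Submodule k M

/-- The `n`-th step of the filtration. -/
abbrev filM (k M : Type*) [CommRing k] [AddCommGroup M] [Module k M] [FilteredModule k M]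
    (n : ℕ) : Submodule k M := FilteredModule.fil n

/-- The quotient of a filtered algebra by a left ideal, with the quotient filtration. -/
instance {k A : Type*} [CommRing k] [Ring A] [Algebra k A] [FilteredRing A] (L : Ideal A) :
    FilteredModule k (A ⧸ L) where
  fil n := Submodule.map (L.mkQ.restrictScalars k)
    ((filR A n).restrictScalars k)

section tensor

variable (k : Type*) [CommRing k]

/-- `A ⊗ A → A/Fⁿ ⊗ A/Fⁿ` for a filtered algebra `A`. -/
noncomputable def tensorModAlg (A : Type*) [Ring A] [Algebra k A] [FilteredRing A] (n : ℕ) :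
    A ⊗[k] A →ₐ[k] (A ⧸ filR A n) ⊗[k] (A ⧸ filR A n) :=
  Algebra.TensorProduct.map (modFil k A n) (modFil k A n)

/-- The completed tensor square `A ⊗̂ A = lim A/Fⁿ ⊗ A/Fⁿ` of a filtered algebra. -/
noncomputable abbrev CTensorAlg (A : Type*) [Ring A] [Algebra k A] [FilteredRing A] :=
  limAlg (T := A ⊗[k] A)
    (Q := fun n => (A ⧸ filR A n) ⊗[k] (A ⧸ filR A n))
    (tensorModAlg k A)

/-- `M ⊗ M → M/Fⁿ ⊗ M/Fⁿ` for a filtered module `M`. -/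
noncomputable def tensorModMod (M : Type*) [AddCommGroup M] [Module k M] [FilteredModule k M]
    (n : ℕ) : M ⊗[k] M →ₗ[k]
      (M ⧸ filM k M n) ⊗[k]
        (M ⧸ filM k M n) :=
  TensorProduct.map (Submodule.mkQ _) (Submodule.mkQ _)

/-- The completed tensor square `M ⊗̂ M = lim M/Fⁿ ⊗ M/Fⁿ` of a filtered module. -/
noncomputable abbrev CTensorMod (M : Type*) [AddCommGroup M] [Module k M] [FilteredModule k M] :=
  limMod (tensorModMod k M)

variable {k}

/-- The map between inverse limits induced by compatible maps at each level. -/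
def limMap {T T' : Type*} {Q Q' : ℕ → Type*} [AddCommGroup T] [Module k T]
    [AddCommGroup T'] [Module k T'] [∀ n, AddCommGroup (Q n)] [∀ n, Module k (Q n)]
    [∀ n, AddCommGroup (Q' n)] [∀ n, Module k (Q' n)] (p : ∀ n, T →ₗ[k] Q n)
    (p' : ∀ n, T' →ₗ[k] Q' n) (f : T →ₗ[k] T') (g : ∀ n, Q n →ₗ[k] Q' n)
    (h : ∀ n x, g n (p n x) = p' n (f x)) : limMod p →ₗ[k] limMod p' where
  toFun t := ⟨fun n => g n (t.1 n), fun n => by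
    obtain ⟨x, hx⟩ := t.2 n
    exact ⟨f x, fun m hm => (congrArg (g m) (hx m hm)).trans (h m x)⟩⟩
  map_add' s t := Subtype.ext (funext fun n => map_add (g n) _ _)
  map_smul' c t := Subtype.ext (funext fun n => map_smul (g n) c _)

/-- The completed tensor square `f ⊗̂ f` of a filtered map between filtered modules. -/
noncomputable def CTensorMod.map {M N : Type*} [AddCommGroup M] [Module k M]
    [FilteredModule k M] [AddCommGroup N] [Module k N] [FilteredModule k N] (f : M →ₗ[k] N)
    (hf : ∀ n, ∀ x ∈ filM k M n,
      f x ∈ filM k N n) : CTensorMod k M →ₗ[k] CTensorMod k N :=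
  limMap (tensorModMod k M) (tensorModMod k N) (TensorProduct.map f f)
    (fun n => TensorProduct.map (Submodule.mapQ _ _ f (hf n)) (Submodule.mapQ _ _ f (hf n)))
    (fun n x => by
      simp only [tensorModMod]
      rw [← LinearMap.comp_apply, ← LinearMap.comp_apply, ← TensorProduct.map_comp,
        ← TensorProduct.map_comp]
      rfl)

/-- The map `A/Fⁿ → M/Fⁿ` induced by a filtered linear map from an algebra to a module. -/
noncomputable def modMap {A M : Type*} [Ring A] [Algebra k A] [FilteredRing A]
    [AddCommGroup M] [Module k M] [FilteredModule k M] (f : A →ₗ[k] M)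
    (hf : ∀ n, ∀ x ∈ filR A n, f x ∈ filM k M n)
    (n : ℕ) : (A ⧸ filR A n) →ₗ[k]
      (M ⧸ filM k M n) :=
  (Submodule.mapQ ((filR A n).restrictScalars k) _ f (hf n)).comp
    (Submodule.Quotient.restrictScalarsEquiv k (filR A n)).symm.toLinearMap

/-- The map between inverse limits induced by compatible maps at each level, starting from an
inverse limit of algebras. -/
def limMapAlg {T T' : Type*} {Q Q' : ℕ → Type*} [Ring T] [Algebra k T]
    [AddCommGroup T'] [Module k T'] [∀ n, Ring (Q n)] [∀ n, Algebra k (Q n)]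
    [∀ n, AddCommGroup (Q' n)] [∀ n, Module k (Q' n)] (p : ∀ n, T →ₐ[k] Q n)
    (p' : ∀ n, T' →ₗ[k] Q' n) (f : T →ₗ[k] T') (g : ∀ n, Q n →ₗ[k] Q' n)
    (h : ∀ n x, g n (p n x) = p' n (f x)) : limAlg p →ₗ[k] limMod p' where
  toFun t := ⟨fun n => g n (t.1 n), fun n => by
    obtain ⟨x, hx⟩ := t.2 n
    exact ⟨f x, fun m hm => (congrArg (g m) (hx m hm)).trans (h m x)⟩⟩
  map_add' s t := Subtype.ext (funext fun n => map_add (g n) _ _)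
  map_smul' c t := Subtype.ext (funext fun n => map_smul (g n) c _)

/-- The completed tensor square `f ⊗̂ f` of a filtered map from an algebra to a module. -/
noncomputable def CTensorAlg.map {A M : Type*} [Ring A] [Algebra k A] [FilteredRing A]
    [AddCommGroup M] [Module k M] [FilteredModule k M] (f : A →ₗ[k] M)
    (hf : ∀ n, ∀ x ∈ filR A n, f x ∈ filM k M n) : CTensorAlg k A →ₗ[k] CTensorMod k M :=
  limMapAlg (T := A ⊗[k] A) (tensorModAlg k A) (tensorModMod k M) (TensorProduct.map f f)
    (fun n => TensorProduct.map (modMap f hf n) (modMap f hf n))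
    (fun n x => by
      show (TensorProduct.map (modMap f hf n) (modMap f hf n))
        ((TensorProduct.map (modFil k A n).toLinearMap (modFil k A n).toLinearMap) x) = _
      simp only [tensorModMod]
      rw [← LinearMap.comp_apply, ← LinearMap.comp_apply, ← TensorProduct.map_comp,
        ← TensorProduct.map_comp]
      rfl)

/-- The pure tensor `a ⊗ b` in the completed tensor square of an algebra. -/
noncomputable def CTensorAlg.tmul {A : Type*} [Ring A] [Algebra k A] [FilteredRing A]
    (a b : A) : CTensorAlg k A := toLimAlg (T := A ⊗[k] A) (tensorModAlg k A) (a ⊗ₜ[k] b)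

/-- `∑_{i + j = d} Fⁱ ⊗ Fʲ`. -/
def tensorFil (k A : Type*) [CommRing k] [Ring A] [Algebra k A] [FilteredRing A] (d : ℕ) :
    Submodule k (A ⊗[k] A) :=
  Submodule.span k {x | ∃ i j a b, i + j = d ∧ a ∈ filR A i ∧
    b ∈ filR A j ∧ a ⊗ₜ[k] b = x}

theorem tensorFil_mul {A : Type*} [Ring A] [Algebra k A] [FilteredRing A] {d e : ℕ}
    {x y : A ⊗[k] A} (hx : x ∈ tensorFil k A d) (hy : y ∈ tensorFil k A e) :
    x * y ∈ tensorFil k A (d + e) := by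
  have h := Submodule.mul_mem_mul hx hy
  rw [tensorFil, tensorFil, Submodule.span_mul_span] at h
  refine Submodule.span_mono ?_ h
  rintro _ ⟨_, ⟨i, j, a, b, hd, ha, hb, rfl⟩, _, ⟨i', j', a', b', he, ha', hb', rfl⟩, rfl⟩
  exact ⟨i + i', j + j', a * a', b * b', by omega, FilteredRing.fil_mul ha ha',
    FilteredRing.fil_mul hb hb', by simp⟩

theorem tensorFil_prod {α : Type*} [Weighted α] {A : Type*} [Ring A] [Algebra k A]
    [FilteredRing A] (φ : α → A ⊗[k] A) (hφ : ∀ a, φ a ∈ tensorFil k A (Weighted.wt a))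
    (w : List α) : (w.map φ).prod ∈ tensorFil k A (wordWt w) := by
  induction w with
  | nil => exact Submodule.subset_span ⟨0, 0, 1, 1, rfl, FilteredRing.fil_zero _,
      FilteredRing.fil_zero _, rfl⟩
  | cons a w ih =>
    rw [List.map_cons, List.prod_cons, wordWt_cons]
    exact tensorFil_mul (hφ a) ih

theorem tensorModAlg_eq_zero {A : Type*} [Ring A] [Algebra k A] [FilteredRing A] {n d : ℕ}
    (hd : 2 * n ≤ d) {x : A ⊗[k] A} (hx : x ∈ tensorFil k A d) : tensorModAlg k A n x = 0 := by
  refine Submodule.span_induction (p := fun x _ => tensorModAlg k A n x = 0) ?_ ?_ ?_ ?_ hx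
  · rintro _ ⟨i, j, a, b, hij, ha, hb, rfl⟩
    show (modFil k A n a) ⊗ₜ[k] (modFil k A n b) = 0
    by_cases h : n ≤ i
    · rw [Series.modFil_eq_zero.2 (FilteredRing.fil_anti h ha), TensorProduct.zero_tmul]
    · rw [Series.modFil_eq_zero.2 (FilteredRing.fil_anti (by omega : n ≤ j) hb),
        TensorProduct.tmul_zero]
  · exact map_zero _
  · intro x y _ _ h1 h2
    rw [map_add, h1, h2, add_zero]
  · intro c x _ h
    rw [map_smul, h, smul_zero]

/-- The continuous algebra morphism from the series in the alphabet `α` to the completed tensor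
square `A ⊗̂ A` taking the prescribed values on the letters. -/
noncomputable def coprodHom {α : Type*} [Weighted α] {A : Type*} [Ring A] [Algebra k A]
    [FilteredRing A] (φ : α → A ⊗[k] A) (hφ : ∀ a, φ a ∈ tensorFil k A (Weighted.wt a)) :
    Series k α →ₐ[k] CTensorAlg k A :=
  Series.evalLim (T := A ⊗[k] A) (tensorModAlg k A) φ fun n => ⟨2 * n, fun w hw => by
    have h : (w.map fun a => tensorModAlg k A n (φ a)).prod =
        tensorModAlg k A n (w.map φ).prod := by
      rw [map_list_prod, List.map_map]
      rfl
    rw [h]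
    exact tensorModAlg_eq_zero hw (tensorFil_prod φ hφ w)⟩

end tensor

/-! ## Quotients by left ideals -/

section quotMap

variable {k A B : Type*} [CommRing k] [Ring A] [Algebra k A] [Ring B] [Algebra k B]

/-- The map `A/L → B/L'` induced by a linear map `f` with `f(L) ⊆ L'`. -/
def quotMap (L : Ideal A) (L' : Ideal B) (f : A →ₗ[k] B) (h : ∀ x ∈ L, f x ∈ L') :
    (A ⧸ L) →ₗ[k] (B ⧸ L') :=
  (Submodule.Quotient.restrictScalarsEquiv k L').toLinearMap.comp
    ((Submodule.mapQ (L.restrictScalars k) (L'.restrictScalars k) f h).comp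
      (Submodule.Quotient.restrictScalarsEquiv k L).symm.toLinearMap)

@[simp] theorem quotMap_mk (L : Ideal A) (L' : Ideal B) (f : A →ₗ[k] B)
    (h : ∀ x ∈ L, f x ∈ L') (x : A) :
    quotMap L L' f h (Submodule.Quotient.mk x) = Submodule.Quotient.mk (f x) := rfl

variable [FilteredRing A] [FilteredRing B]

theorem mk_mem_fil (L : Ideal A) {n : ℕ} {x : A} (hx : x ∈ filR A n) :
    (Submodule.Quotient.mk x : A ⧸ L) ∈ filM k (A ⧸ L) n :=
  ⟨x, hx, rfl⟩

theorem quotMap_mem_fil (L : Ideal A) (L' : Ideal B) (f : A →ₗ[k] B)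
    (h : ∀ x ∈ L, f x ∈ L')
    (hf : ∀ n, ∀ x ∈ filR A n, f x ∈ filR B n) (n : ℕ)
    (x : A ⧸ L) (hx : x ∈ filM k (A ⧸ L) n) :
    quotMap L L' f h x ∈ filM k (B ⧸ L') n := by
  obtain ⟨y, hy, rfl⟩ := hx
  exact mk_mem_fil (k := k) L' (hf n y hy)

/-- Left multiplication `ℓ_a` on the quotient of `A` by a left ideal. -/
def lmul (k : Type*) {A : Type*} [CommRing k] [Ring A] [Algebra k A] (L : Ideal A) (a : A) :
    (A ⧸ L) →ₗ[k] (A ⧸ L) := Algebra.lsmul k k (A ⧸ L) a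

theorem lmul_mem_fil (L : Ideal A) (a : A) (n : ℕ) (x : A ⧸ L)
    (hx : x ∈ filM k (A ⧸ L) n) :
    lmul k L a x ∈ filM k (A ⧸ L) n := by
  obtain ⟨y, hy, rfl⟩ := hx
  exact mk_mem_fil (k := k) L (Ideal.mul_mem_left _ a hy)

end quotMap

/-! ## Racinet's formalism -/

namespace Series

theorem substHom_var {k α β : Type*} [CommRing k] [Weighted α] [Weighted β] (φ : α → Series k β)
    (hφ : ∀ a, φ a ∈ filR (Series k β) (Weighted.wt a)) (a : α) :
    substHom φ hφ (var a) = φ a := by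
  ext v
  show ∑ w ∈ (wordWt_finite (α := α) (wordWt v + 1)).toFinset,
    (var a : Series k α) w * (w.map φ).prod v = φ a v
  rw [Finset.sum_eq_single [a]]
  · simp [var]
  · intro w _ hw
    rw [show (var a : Series k α) w = 0 from if_neg hw, zero_mul]
  · intro hn
    rw [Set.Finite.mem_toFinset] at hn
    have hn' : ¬ wordWt [a] < wordWt v + 1 := hn
    rw [wordWt_cons, wordWt_nil] at hn'
    simp [hφ a v (by omega)]

variable {k α : Type*} [CommRing k]

theorem var_mem_fil [Weighted α] (a : α) :
    (var a : Series k α) ∈ filR (Series k α) (Weighted.wt a) := by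
  intro w hw
  refine if_neg ?_
  rintro rfl
  simp at hw

theorem mul_var_append (h : Series k α) (a b : α) (v : List α) [Decidable (b = a)] :
    (h * var a : Series k α) (v ++ [b]) = if b = a then h v else 0 := by
  rw [mul_apply, Finset.sum_eq_single v.length]
  · simp [var]
  · intro i hi hne
    rw [Finset.mem_range] at hi
    simp only [List.length_append, List.length_singleton] at hi
    have : (var a : Series k α) ((v ++ [b]).drop i) = 0 := by
      refine if_neg fun h => ?_
      have := congrArg List.length h
      simp at this
      omega
    rw [this, mul_zero]
  · intro hn
    exact absurd (Finset.mem_range.2 (by simp)) hn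

theorem mul_var_nil (h : Series k α) (a : α) : (h * var a : Series k α) [] = 0 := by
  rw [mul_nil]
  simp [var]

theorem monomial_mul [DecidableEq α] (u : List α) (f : Series k α) (v : List α) :
    ((u.map (var (k := k))).prod * f) v = if u <+: v then f (v.drop u.length) else 0 := by
  induction u generalizing v with
  | nil => simp
  | cons a u ih =>
    rw [List.map_cons, List.prod_cons, mul_assoc]
    have hs : ∀ b, shift b (var a : Series k α) = if b = a then 1 else 0 := by
      intro b
      ext w
      by_cases hb : b = a
      · rw [if_pos hb]
        cases w <;> simp [shift, var, hb]
      · rw [if_neg hb]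
        simp [shift, var, hb]
    cases v with
    | nil => 
      rw [mul_nil]
      simp [var]
    | cons b v =>
      rw [mul_cons, hs]
      by_cases hb : b = a
      · subst hb
        simp [ih, var]
      · have hb' : ¬ a = b := fun h => hb h.symm
        simp [var, hb, hb']

theorem monomial_apply [DecidableEq α] (u v : List α) :
    (u.map (var (k := k))).prod v = if u = v then 1 else 0 := by
  have h := monomial_mul (k := k) u 1 v
  rw [mul_one] at h
  rw [h]
  by_cases hp : u <+: v
  · obtain ⟨t, rfl⟩ := hp
    rw [if_pos (List.prefix_append u t), List.drop_left]
    cases t with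
    | nil => simp
    | cons b t => simp
  · rw [if_neg hp, if_neg]
    rintro rfl
    exact hp (List.prefix_refl _)

/-- The words ending with `x_a` span the left ideal generated by `x_a`. -/
theorem mem_span_var (a : α) (f : Series k α) :
    f ∈ Ideal.span {(var a : Series k α)} ↔ f [] = 0 ∧ ∀ v b, b ≠ a → f (v ++ [b]) = 0 := by
  classical
  rw [Ideal.mem_span_singleton']
  constructor
  · rintro ⟨h, rfl⟩
    exact ⟨mul_var_nil h a, fun v b hb => by rw [mul_var_append, if_neg hb]⟩
  · rintro ⟨h1, h2⟩
    let h : Series k α := fun v => f (v ++ [a])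
    refine ⟨h, ?_⟩
    ext w
    rcases List.eq_nil_or_concat' w with rfl | ⟨v, b, rfl⟩
    · rw [mul_var_nil, h1]
    · rw [mul_var_append]
      split_ifs with hb
      · rw [hb]
      · rw [h2 v b hb]

end Series

section qWord

variable {G : Type*} [CommGroup G]

/-- `q` on words, where `p` is the index of the previous letter `x_p`: it replaces the
successive indices `g₁, g₂, …, g_r` of the letters different from `x₀` by
`g₁ p⁻¹, g₂ g₁⁻¹, …, g_r g_{r-1}⁻¹`. -/
def qWord (p : G) : List (XX G) → List (XX G)
  | [] => []
  | none :: w => none :: qWord p w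
  | some g :: w => some (g * p⁻¹) :: qWord g w

/-- The inverse of `qWord p`. -/
def qWordInv (p : G) : List (XX G) → List (XX G)
  | [] => []
  | none :: w => none :: qWordInv p w
  | some g :: w => some (g * p) :: qWordInv (g * p) w

theorem qWord_qWordInv (p : G) (w : List (XX G)) : qWord p (qWordInv p w) = w := by
  induction w generalizing p with
  | nil => rfl
  | cons a w ih => cases a <;> simp [qWord, qWordInv, ih]

theorem qWordInv_qWord (p : G) (w : List (XX G)) : qWordInv p (qWord p w) = w := by
  induction w generalizing p with
  | nil => rfl
  | cons a w ih => cases a <;> simp [qWord, qWordInv, ih]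

theorem qWord_append (p : G) (v : List (XX G)) (g : G) :
    ∃ h v', qWord p (v ++ [some g]) = v' ++ [some h] := by
  induction v generalizing p with
  | nil => exact ⟨g * p⁻¹, [], rfl⟩
  | cons a v ih =>
    cases a with
    | none => obtain ⟨h, v', e⟩ := ih p; exact ⟨h, none :: v', by simp [qWord, e]⟩
    | some a => obtain ⟨h, v', e⟩ := ih a; exact ⟨h, some (a * p⁻¹) :: v', by simp [qWord, e]⟩

theorem qWordInv_append (p : G) (v : List (XX G)) (g : G) :
    ∃ h v', qWordInv p (v ++ [some g]) = v' ++ [some h] := by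
  induction v generalizing p with
  | nil => exact ⟨g * p, [], rfl⟩
  | cons a v ih =>
    cases a with
    | none => obtain ⟨h, v', e⟩ := ih p; exact ⟨h, none :: v', by simp [qWordInv, e]⟩
    | some a =>
      obtain ⟨h, v', e⟩ := ih (a * p)
      exact ⟨h, some (a * p) :: v', by simp [qWordInv, e]⟩

end qWord

section Racinet

variable (k : Type*) [CommRing k] (G : Type*) [CommGroup G] [Fintype G]

/-- The algebra `k⟨⟨X⟩⟩`. -/
abbrev KX := Series k (XX G)

/-- The algebra `k⟨⟨Y⟩⟩`, with `y_{n,g}` of degree `n`. -/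
abbrev KY := Series k (YY G)

variable {k G}

theorem primitive_mem {α : Type*} [Weighted α] (a : α) :
    (Series.var a : Series k α) ⊗ₜ[k] (1 : Series k α) +
      (1 : Series k α) ⊗ₜ[k] (Series.var a : Series k α) ∈
        tensorFil k (Series k α) (Weighted.wt a) :=
  Submodule.add_mem _
    (Submodule.subset_span ⟨_, 0, _, _, add_zero _, Series.var_mem_fil a,
      FilteredRing.fil_zero _, rfl⟩)
    (Submodule.subset_span ⟨0, _, _, _, zero_add _, FilteredRing.fil_zero _,
      Series.var_mem_fil a, rfl⟩)

variable (k G) in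
/-- The coproduct of `k⟨⟨X⟩⟩` for which the letters are primitive. -/
noncomputable def coprodX : KX k G →ₐ[k] CTensorAlg k (KX k G) :=
  coprodHom (fun x => (Series.var x : KX k G) ⊗ₜ[k] (1 : KX k G) +
    (1 : KX k G) ⊗ₜ[k] (Series.var x : KX k G)) primitive_mem

variable (k G) in
/-- The set `𝒢(k⟨⟨X⟩⟩)` of (invertible) grouplike elements. -/
def grouplike : Set (KX k G)ˣ :=
  {Ψ | coprodX k G (Ψ : KX k G) = CTensorAlg.tmul (Ψ : KX k G) (Ψ : KX k G)}

/-- The automorphism `t_g`: `x₀ ↦ x₀`, `x_h ↦ x_{gh}`. -/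
noncomputable def tAut (g : G) : KX k G →ₐ[k] KX k G :=
  Series.substHom (fun x => Series.var (x.map (g * ·)))
    (fun x => Series.var_mem_fil (x.map (g * ·)))

/-- The images of the letters under `aut_Ψ`: `x₀ ↦ x₀`, `x_g ↦ t_g(Ψ⁻¹) x_g t_g(Ψ)`. -/
noncomputable def autXVal (Ψ : (KX k G)ˣ) : XX G → KX k G
  | none => Series.var none
  | some g => tAut g ((Ψ⁻¹ : (KX k G)ˣ) : KX k G) * Series.var (some g) * tAut g (Ψ : KX k G)

theorem autXVal_mem (Ψ : (KX k G)ˣ) (x : XX G) :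
    autXVal Ψ x ∈ filR (KX k G) (Weighted.wt x) := by
  cases x with
  | none => exact Series.var_mem_fil (none : XX G)
  | some g =>
    exact Ideal.mul_mem_right _ _ (Ideal.mul_mem_left _ _ (Series.var_mem_fil (some g : XX G)))

/-- The algebra automorphism `aut_Ψ` of `k⟨⟨X⟩⟩`. -/
noncomputable def autX (Ψ : (KX k G)ˣ) : KX k G →ₐ[k] KX k G :=
  Series.substHom (autXVal Ψ) (autXVal_mem Ψ)

/-- `S_Ψ = ℓ_Ψ ∘ aut_Ψ`. -/
noncomputable def SX (Ψ : (KX k G)ˣ) : KX k G →ₗ[k] KX k G :=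
  (LinearMap.mulLeft k (Ψ : KX k G)).comp (autX Ψ).toLinearMap

theorem SX_mem_fil (Ψ : (KX k G)ˣ) (n : ℕ) (f : KX k G)
    (hf : f ∈ filR (KX k G) n) : SX Ψ f ∈ filR (KX k G) n :=
  Ideal.mul_mem_left _ _ (Series.substLin_mem_fil (autXVal Ψ) hf)

variable (k G) in
/-- The left ideal `k⟨⟨X⟩⟩ x₀`. -/
abbrev idealX : Ideal (KX k G) := Ideal.span {Series.var none}

variable (k G) in
/-- The module `k⟨⟨X⟩⟩ / k⟨⟨X⟩⟩ x₀`. -/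
abbrev RX := KX k G ⧸ idealX k G

theorem autX_x0 (Ψ : (KX k G)ˣ) : autX Ψ (Series.var none) = Series.var none :=
  Series.substHom_var _ _ _

theorem SX_mem_ideal (Ψ : (KX k G)ˣ) (f : KX k G) (hf : f ∈ idealX k G) :
    SX Ψ f ∈ idealX k G := by
  obtain ⟨a, rfl⟩ := Ideal.mem_span_singleton'.1 hf
  refine Ideal.mem_span_singleton'.2 ⟨SX Ψ a, ?_⟩
  show (Ψ : KX k G) * autX Ψ a * _ = (Ψ : KX k G) * autX Ψ (a * _)
  rw [map_mul, autX_x0, mul_assoc]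

theorem wordWt_qWord (p : G) (w : List (XX G)) : wordWt (qWord p w) = wordWt w := by
  induction w generalizing p with
  | nil => rfl
  | cons a w ih => cases a <;> exact congrArg (1 + ·) (ih _)

theorem wordWt_qWordInv (p : G) (w : List (XX G)) : wordWt (qWordInv p w) = wordWt w := by
  rw [← wordWt_qWord p (qWordInv p w), qWord_qWordInv]

variable (k G) in
/-- The automorphism `q` of `k⟨⟨X⟩⟩`, `∑_w (f | w) w ↦ ∑_w (f | w) q(w)`. -/
def qX : KX k G ≃ₗ[k] KX k G where
  toFun f := fun w => f (qWordInv 1 w)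
  invFun f := fun w => f (qWord 1 w)
  map_add' _ _ := rfl
  map_smul' _ _ := rfl
  left_inv f := Series.ext fun w => congrArg f (qWordInv_qWord 1 w)
  right_inv f := Series.ext fun w => congrArg f (qWord_qWordInv 1 w)

theorem qX_mem_fil (n : ℕ) (f : KX k G) (hf : f ∈ filR (KX k G) n) :
    qX k G f ∈ filR (KX k G) n :=
  fun w hw => hf _ (by rwa [wordWt_qWordInv])

theorem qX_symm_mem_fil (n : ℕ) (f : KX k G) (hf : f ∈ filR (KX k G) n) :
    (qX k G).symm f ∈ filR (KX k G) n :=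
  fun w hw => hf _ (by rwa [wordWt_qWord])

theorem qX_mem_ideal (f : KX k G) (hf : f ∈ idealX k G) : qX k G f ∈ idealX k G := by
  rw [Series.mem_span_var] at hf ⊢
  refine ⟨hf.1, fun v b hb => ?_⟩
  obtain ⟨g, rfl⟩ := Option.ne_none_iff_exists'.1 hb
  obtain ⟨h, v', e⟩ := qWordInv_append 1 v g
  show f (qWordInv 1 _) = 0
  rw [e]
  exact hf.2 _ _ (by simp)

theorem qX_symm_mem_ideal (f : KX k G) (hf : f ∈ idealX k G) :
    (qX k G).symm f ∈ idealX k G := by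
  rw [Series.mem_span_var] at hf ⊢
  refine ⟨hf.1, fun v b hb => ?_⟩
  obtain ⟨g, rfl⟩ := Option.ne_none_iff_exists'.1 hb
  obtain ⟨h, v', e⟩ := qWord_append 1 v g
  show f (qWord 1 _) = 0
  rw [e]
  exact hf.2 _ _ (by simp)

variable (k G) in
/-- The automorphism of `k⟨⟨X⟩⟩ / k⟨⟨X⟩⟩ x₀` induced by `q`. -/
def qBar : RX k G →ₗ[k] RX k G := quotMap _ _ (qX k G).toLinearMap qX_mem_ideal

variable (k G) in
/-- The inverse of `qBar`. -/
def qBarInv : RX k G →ₗ[k] RX k G :=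
  quotMap _ _ (qX k G).symm.toLinearMap qX_symm_mem_ideal

/-- `S_Ψ^Y`, the automorphism of `k⟨⟨X⟩⟩ / k⟨⟨X⟩⟩ x₀` induced by `S_Ψ` via `qBar ∘ π_Y`. -/
noncomputable def SY (Ψ : (KX k G)ˣ) : RX k G →ₗ[k] RX k G :=
  (qBar k G).comp ((quotMap _ _ (SX Ψ) (SX_mem_ideal Ψ)).comp (qBarInv k G))

/-- The defining property of `S_Ψ^Y`. -/
theorem SY_qBar (Ψ : (KX k G)ˣ) (f : KX k G) :
    SY Ψ (qBar k G (Submodule.Quotient.mk f)) = qBar k G (Submodule.Quotient.mk (SX Ψ f)) := by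
  have h : (qX k G).symm (qX k G f) = f := (qX k G).symm_apply_apply f
  show qBar k G (Submodule.Quotient.mk (SX Ψ ((qX k G).symm (qX k G f)))) = _
  rw [h]

theorem SY_mem_fil (Ψ : (KX k G)ˣ) (n : ℕ) (r : RX k G)
    (hr : r ∈ filM k (RX k G) n) :
    SY Ψ r ∈ filM k (RX k G) n :=
  quotMap_mem_fil _ _ _ _ qX_mem_fil n _ (quotMap_mem_fil _ _ _ _ (SX_mem_fil Ψ) n _
    (quotMap_mem_fil _ _ _ _ qX_symm_mem_fil n r hr))

end Racinet

section Racinet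

variable {k : Type*} [CommRing k] {G : Type*} [CommGroup G] [Fintype G]

/-- For elements `z_{n,g}`, the element
`z_{n,g} ⊗ 1 + 1 ⊗ z_{n,g} + ∑_{0 < m < n, h ∈ G} z_{m,h} ⊗ z_{n-m,gh⁻¹}`. -/
noncomputable def harmonicVal {A : Type*} [Ring A] [Algebra k A] (z : ℕ+ → G → A) (n : ℕ+)
    (g : G) : A ⊗[k] A :=
  z n g ⊗ₜ[k] 1 + 1 ⊗ₜ[k] z n g +
    ∑ m ∈ Finset.Ico 1 n, ∑ h : G, z m h ⊗ₜ[k] z (n - m) (g * h⁻¹)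

theorem harmonicVal_mem {A : Type*} [Ring A] [Algebra k A] [FilteredRing A] (z : ℕ+ → G → A)
    (hz : ∀ (n : ℕ+) (g : G), z n g ∈ filR A n) (n : ℕ+) (g : G) : harmonicVal z n g ∈ tensorFil k A n := by
  refine Submodule.add_mem _ (Submodule.add_mem _ ?_ ?_) ?_
  · exact Submodule.subset_span ⟨n, 0, _, _, add_zero _, hz n g, FilteredRing.fil_zero _, rfl⟩
  · exact Submodule.subset_span ⟨0, n, _, _, zero_add _, FilteredRing.fil_zero _, hz n g, rfl⟩
  · refine Submodule.sum_mem _ fun m hm => Submodule.sum_mem _ fun h _ => ?_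
    refine Submodule.subset_span ⟨m, (n - m : ℕ+), _, _, ?_, hz _ _, hz _ _, rfl⟩
    rw [← PNat.add_coe, PNat.add_sub_of_lt (Finset.mem_Ico.1 hm).2]

variable (k G) in
/-- The harmonic coproduct of `k⟨⟨Y⟩⟩`, the continuous algebra morphism with
`y_{n,g} ↦ y_{n,g} ⊗ 1 + 1 ⊗ y_{n,g} + ∑_{0 < m < n, h ∈ G} y_{m,h} ⊗ y_{n-m,gh⁻¹}`. -/
noncomputable def deltaAlg : KY k G →ₐ[k] CTensorAlg k (KY k G) :=
  coprodHom (fun a => harmonicVal (fun (n : ℕ+) (g : G) => (Series.var (n, g) : KY k G)) a.1 a.2)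
    (fun a => harmonicVal_mem _ (fun (n : ℕ+) (g : G) => Series.var_mem_fil ((n, g) : YY G)) a.1 a.2)

theorem pow_mem_fil {A : Type*} [Ring A] [FilteredRing A] {a : A} (ha : a ∈ filR A 1) (n : ℕ) :
    a ^ n ∈ filR A n := by
  induction n with
  | zero => exact FilteredRing.fil_zero _
  | succ n ih => rw [pow_succ]; exact FilteredRing.fil_mul ih ha

variable (k G) in
/-- The inclusion `k⟨⟨Y⟩⟩ → k⟨⟨X⟩⟩`, `y_{n,g} ↦ x₀^{n-1} x_g`. -/
noncomputable def iotaY : KY k G →ₐ[k] KX k G :=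
  Series.substHom (fun a => Series.var none ^ ((a.1 : ℕ) - 1) * Series.var (some a.2))
    (fun a => by
      have h := FilteredRing.fil_mul
        (pow_mem_fil (Series.var_mem_fil (k := k) (none : XX G)) ((a.1 : ℕ) - 1))
        (Series.var_mem_fil (k := k) (some a.2 : XX G))
      have h2 : (a.1 : ℕ) - 1 + 1 = a.1 := Nat.sub_add_cancel a.1.pos
      exact (congrArg (fun n => _ ∈ filR (KX k G) n) h2).mp h)

variable (k G) in
/-- The restriction to `k⟨⟨Y⟩⟩` of the projection `k⟨⟨X⟩⟩ → k⟨⟨X⟩⟩ / k⟨⟨X⟩⟩ x₀`. -/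
noncomputable def piY : KY k G →ₗ[k] RX k G :=
  ((idealX k G).mkQ.restrictScalars k).comp (iotaY k G).toLinearMap

theorem piY_mem_fil (n : ℕ) (f : KY k G) (hf : f ∈ filR (KY k G) n) :
    piY k G f ∈ filM k (RX k G) n :=
  mk_mem_fil (k := k) (idealX k G) (Series.substLin_mem_fil _ hf)

/-- The word in `X` corresponding to a word in `Y`, with `y_{n,g}` written as `x₀^{n-1} x_g`. -/
def yWord {G : Type*} (u : List (YY G)) : List (XX G) :=
  u.flatMap fun a => List.replicate ((a.1 : ℕ) - 1) none ++ [some a.2]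

theorem yWord_cons {G : Type*} (a : YY G) (u : List (YY G)) :
    yWord (a :: u) = List.replicate ((a.1 : ℕ) - 1) none ++ some a.2 :: yWord u := by
  simp [yWord]

theorem yWord_injective {G : Type*} : Function.Injective (yWord (G := G)) := by
  have key : ∀ (m n : ℕ) (g h : G) (v w : List (XX G)),
      List.replicate m none ++ some g :: v = List.replicate n none ++ some h :: w →
        m = n ∧ g = h ∧ v = w := by
    intro m
    induction m with
    | zero =>
      intro n g h v w e
      cases n with
      | zero => simpa using e
      | succ n => simp [List.replicate_succ] at e
    | succ m ih =>
      intro n g h v w e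
      cases n with
      | zero => simp [List.replicate_succ] at e
      | succ n =>
        simp only [List.replicate_succ, List.cons_append, List.cons.injEq, true_and] at e
        obtain ⟨h1, h2⟩ := ih n g h v w e
        exact ⟨by rw [h1], h2⟩
  intro u
  induction u with
  | nil =>
    intro v e
    cases v with
    | nil => rfl
    | cons b v => rw [yWord_cons] at e; simp [yWord] at e
  | cons a u ih =>
    intro v e
    cases v with
    | nil => rw [yWord_cons] at e; simp [yWord] at e
    | cons b v =>
      rw [yWord_cons, yWord_cons] at e
      obtain ⟨h1, h2, h3⟩ := key _ _ _ _ _ _ e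
      have h4 : a.1 = b.1 := PNat.eq (by
        have := a.1.pos
        have := b.1.pos
        omega)
      rw [ih h3, Prod.ext h4 h2]

theorem wordWt_yWord (u : List (YY G)) : wordWt (yWord u) = wordWt u := by
  induction u with
  | nil => rfl
  | cons a u ih =>
    have hr : ∀ n, wordWt (List.replicate n (none : XX G)) = n := by
      intro n
      induction n with
      | zero => rfl
      | succ n ih =>
        rw [List.replicate_succ, wordWt_cons, ih]
        exact Nat.add_comm _ _
    rw [yWord_cons, wordWt_append, wordWt_cons, wordWt_cons, ih, hr]
    show (a.1 : ℕ) - 1 + (1 + wordWt u) = a.1 + wordWt u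
    have := a.1.pos
    omega

theorem iotaY_apply (f : KY k G) (u : List (YY G)) : iotaY k G f (yWord u) = f u := by
  classical
  have hprod : ∀ w : List (YY G), (w.map fun a : YY G =>
      (Series.var none : KX k G) ^ ((a.1 : ℕ) - 1) * Series.var (some a.2)).prod =
        ((yWord w).map (Series.var (k := k))).prod := by
    intro w
    induction w with
    | nil => rfl
    | cons a w ih =>
      rw [yWord_cons, List.map_cons, List.prod_cons, ih]
      simp [mul_assoc]
  show ∑ w ∈ (wordWt_finite (α := YY G) (wordWt (yWord u) + 1)).toFinset,
    f w * ((w.map fun a : YY G =>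
      (Series.var none : KX k G) ^ ((a.1 : ℕ) - 1) * Series.var (some a.2)).prod : KX k G) (yWord u) = f u
  rw [Finset.sum_eq_single u]
  · rw [hprod, Series.monomial_apply, if_pos rfl, mul_one]
  · intro w _ hw
    rw [hprod, Series.monomial_apply, if_neg fun h => hw (yWord_injective h), mul_zero]
  · intro hn
    exfalso
    apply hn
    rw [Set.Finite.mem_toFinset]
    show wordWt u < wordWt (yWord u) + 1
    rw [wordWt_yWord]
    omega

/-- The inverse of the bijection `piY`: the class of `f` is sent to the series in which
the coefficient of a word in `Y` is the coefficient in `f` of the corresponding word in `X`. -/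
noncomputable def secY : RX k G →ₗ[k] KY k G :=
  (((idealX k G).restrictScalars k).liftQ
    { toFun := fun f => (fun u => f (yWord u) : KY k G)
      map_add' := fun _ _ => rfl
      map_smul' := fun _ _ => rfl }
    (by
      intro f hf
      have hf' : f [] = 0 ∧ ∀ v b, b ≠ none → f (v ++ [b]) = 0 :=
        (Series.mem_span_var (none : XX G) f).1 hf
      refine Series.ext fun u => ?_
      show f (yWord u) = 0
      rcases List.eq_nil_or_concat' u with rfl | ⟨u, a, rfl⟩
      · exact hf'.1
      · have h : yWord (u ++ [a]) =
            (yWord u ++ List.replicate ((a.1 : ℕ) - 1) none) ++ [some a.2] := by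
          simp [yWord]
        rw [h]
        exact hf'.2 _ _ (by simp))).comp
    (Submodule.Quotient.restrictScalarsEquiv k (idealX k G)).symm.toLinearMap

theorem secY_piY (f : KY k G) : secY (piY k G f) = f :=
  Series.ext fun u => iotaY_apply f u

variable (k G) in
/-- The harmonic coproduct of `k⟨⟨X⟩⟩ / k⟨⟨X⟩⟩ x₀`, which corresponds to `deltaAlg` under the
bijection `piY`. -/
noncomputable def deltaMod : RX k G →ₗ[k] CTensorMod k (RX k G) :=
  (CTensorAlg.map (piY k G) piY_mem_fil).comp ((deltaAlg k G).toLinearMap.comp secY)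

/-- The defining property of `deltaMod`. -/
theorem deltaMod_piY (f : KY k G) :
    deltaMod k G (piY k G f) = CTensorAlg.map (piY k G) piY_mem_fil (deltaAlg k G f) := by
  show CTensorAlg.map (piY k G) piY_mem_fil (deltaAlg k G (secY (piY k G f))) = _
  rw [secY_piY]

/-- `Γ_Ψ(x) = exp (∑_{n ≥ 2} ((-1)^{n-1} / n) (Ψ | x₀^{n-1} x₁) xⁿ)`. -/
noncomputable def gammaSeries [Algebra ℚ k] (Ψ : KX k G) : PowerSeries k :=
  (PowerSeries.exp k).subst (PowerSeries.mk fun n =>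
    if 2 ≤ n then
      algebraMap ℚ k ((-1) ^ (n - 1) / n) * Ψ (List.replicate (n - 1) none ++ [some 1])
    else 0)

/-- The inverse `Γ_Ψ⁻¹` (the constant term of `Γ_Ψ` is `1`). -/
noncomputable def gammaInv [Algebra ℚ k] (Ψ : KX k G) : PowerSeries k :=
  PowerSeries.invOfUnit (gammaSeries Ψ) 1

/-- A power series in one variable as a series in a one letter alphabet. -/
noncomputable def toSeries (F : PowerSeries k) : Series k Unit :=
  fun w => PowerSeries.coeff w.length F

/-- `F(x₁) ∈ k⟨⟨X⟩⟩` for `F ∈ k[[x]]`. -/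
noncomputable def evalX1 (F : PowerSeries k) : KX k G :=
  Series.substHom (fun _ : Unit => (Series.var (some 1) : KX k G))
    (fun _ => Series.var_mem_fil (some 1 : XX G)) (toSeries F)

/-- `^Γ S_Ψ^Y = ℓ_{Γ_Ψ⁻¹(x₁)} ∘ S_Ψ^Y`. -/
noncomputable def gammaSY [Algebra ℚ k] (Ψ : (KX k G)ˣ) : RX k G →ₗ[k] RX k G :=
  (lmul k (idealX k G) (evalX1 (gammaInv (Ψ : KX k G)))).comp (SY Ψ)

theorem gammaSY_mem_fil [Algebra ℚ k] (Ψ : (KX k G)ˣ) (n : ℕ) (r : RX k G)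
    (hr : r ∈ filM k (RX k G) n) : gammaSY Ψ r ∈ filM k (RX k G) n :=
  lmul_mem_fil _ _ n _ (SY_mem_fil Ψ n r hr)

/-- The stabilizer in `𝒢(k⟨⟨X⟩⟩)` of a map `D` from `k⟨⟨X⟩⟩ / k⟨⟨X⟩⟩ x₀` to its completed tensor
square, for the action `Ψ · D = (^Γ S_Ψ^Y)^{⊗ 2} ∘ D ∘ (^Γ S_Ψ^Y)⁻¹`. -/
def stabMod [Algebra ℚ k] (D : RX k G →ₗ[k] CTensorMod k (RX k G)) : Set (KX k G)ˣ :=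
  {Ψ | Ψ ∈ grouplike k G ∧
    ∀ r, CTensorMod.map (gammaSY Ψ) (gammaSY_mem_fil Ψ) (D r) = D (gammaSY Ψ r)}

end Racinet

/-! ## The crossed product formalism -/

section Crossed

/-- The generators `e₀`, `e₁` and `g ∈ G`. -/
inductive VGen (G : Type*)
  | e0 : VGen G
  | e1 : VGen G
  | grp : G → VGen G

/-- The degrees of the generators: `e₀`, `e₁` have degree `1` and `g` has degree `0`. -/
def VGen.deg {G : Type*} : VGen G → ℕ
  | e0 => 1
  | e1 => 1
  | grp _ => 0

variable (k : Type*) [CommRing k] (G : Type*) [CommGroup G]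

/-- The relations `g × h = gh`, `1 = 1_G`, `g × e₀ = e₀ × g`. -/
inductive VRel : FreeAlgebra k (VGen G) → FreeAlgebra k (VGen G) → Prop
  | mul (g h : G) : VRel (FreeAlgebra.ι k (VGen.grp g) * FreeAlgebra.ι k (VGen.grp h))
      (FreeAlgebra.ι k (VGen.grp (g * h)))
  | one : VRel 1 (FreeAlgebra.ι k (VGen.grp 1))
  | comm (g : G) : VRel (FreeAlgebra.ι k (VGen.grp g) * FreeAlgebra.ι k VGen.e0)
      (FreeAlgebra.ι k VGen.e0 * FreeAlgebra.ι k (VGen.grp g))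

/-- The algebra generated by `e₀`, `e₁` and `g ∈ G` with the above relations. It is graded. -/
def VG : Type _ := RingQuot (VRel k G)

instance : Ring (VG k G) := inferInstanceAs (Ring (RingQuot (VRel k G)))
instance : Algebra k (VG k G) := inferInstanceAs (Algebra k (RingQuot (VRel k G)))

/-- The projection of the free algebra onto `VG`. -/
def VG.mk : FreeAlgebra k (VGen G) →ₐ[k] VG k G := RingQuot.mkAlgHom k (VRel k G)

variable {k G} in
theorem VG.mk_rel {x y : FreeAlgebra k (VGen G)} (h : VRel k G x y) : VG.mk k G x = VG.mk k G y :=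
  RingQuot.mkAlgHom_rel k h

theorem VG.mk_surjective : Function.Surjective (VG.mk k G) :=
  RingQuot.mkAlgHom_surjective k (VRel k G)

variable {G}

/-- The generators of `VG`. -/
def VG.gen (a : VGen G) : VG k G := VG.mk k G (FreeAlgebra.ι k a)

theorem VG.gen_eq (a : VGen G) : VG.gen k a = VG.mk k G (FreeAlgebra.ι k a) := rfl

/-- The degree of a word in the generators. -/
def VG.wdeg (w : List (VGen G)) : ℕ := (w.map VGen.deg).sum

variable (G)

/-- The elements of degree `≥ n`: the span of the words in the generators of degree `≥ n`. -/
def VG.filSub (n : ℕ) : Submodule k (VG k G) :=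
  Submodule.span k {x | ∃ w : List (VGen G), n ≤ VG.wdeg w ∧ (w.map (VG.gen k)).prod = x}

variable {k G}

theorem VG.filSub_mul {m n : ℕ} {a b : VG k G} (ha : a ∈ VG.filSub k G m)
    (hb : b ∈ VG.filSub k G n) : a * b ∈ VG.filSub k G (m + n) := by
  have h := Submodule.mul_mem_mul ha hb
  rw [VG.filSub, VG.filSub, Submodule.span_mul_span] at h
  refine Submodule.span_mono ?_ h
  rintro _ ⟨_, ⟨v, hv, rfl⟩, _, ⟨w, hw, rfl⟩, rfl⟩
  refine ⟨v ++ w, ?_, by simp⟩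
  have : VG.wdeg (v ++ w) = VG.wdeg v + VG.wdeg w := by simp [VG.wdeg]
  omega

theorem VG.gen_mem (a : VGen G) : VG.gen k a ∈ VG.filSub k G a.deg :=
  Submodule.subset_span ⟨[a], by simp [VG.wdeg], by simp⟩

theorem VG.filSub_anti {m n : ℕ} {a : VG k G} (h : m ≤ n) (ha : a ∈ VG.filSub k G n) :
    a ∈ VG.filSub k G m := by
  refine Submodule.span_mono ?_ ha
  rintro _ ⟨w, hw, rfl⟩
  exact ⟨w, h.trans hw, rfl⟩

theorem VG.one_mem : (1 : VG k G) ∈ VG.filSub k G 0 :=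
  Submodule.subset_span ⟨[], by simp, rfl⟩

theorem VG.filSub_zero (a : VG k G) : a ∈ VG.filSub k G 0 := by
  obtain ⟨x, rfl⟩ := VG.mk_surjective k G a
  induction x using FreeAlgebra.induction with
  | grade0 c =>
    have h : VG.mk k G (algebraMap k _ c) = c • (1 : VG k G) :=
      (AlgHom.commutes _ c).trans (Algebra.algebraMap_eq_smul_one c)
    exact h.symm ▸ Submodule.smul_mem _ c VG.one_mem
  | grade1 x =>
    rw [← VG.gen_eq]
    exact VG.filSub_anti (Nat.zero_le _) (VG.gen_mem (k := k) x)
  | mul a b ha hb => rw [map_mul]; exact VG.filSub_mul (m := 0) (n := 0) ha hb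
  | add a b ha hb => rw [map_add]; exact Submodule.add_mem _ ha hb

instance : FilteredRing (VG k G) where
  fil n :=
    { carrier := VG.filSub k G n
      zero_mem' := Submodule.zero_mem _
      add_mem' := fun ha hb => Submodule.add_mem _ ha hb
      smul_mem' := fun c a ha => by
        have h := VG.filSub_mul (VG.filSub_zero c) ha
        rwa [zero_add] at h }
  fil_zero := VG.filSub_zero
  fil_mul := VG.filSub_mul
  fil_anti := VG.filSub_anti

variable (k G) in
/-- The algebra `V̂_G`, the completion of `VG` for the degree. -/
def VHat : Type _ := limAlg (modFil k (VG k G))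

noncomputable instance : Ring (VHat k G) := inferInstanceAs (Ring (limAlg (modFil k (VG k G))))
noncomputable instance : Algebra k (VHat k G) :=
  inferInstanceAs (Algebra k (limAlg (modFil k (VG k G))))

variable (k G) in
/-- The canonical morphism `VG → V̂_G`. -/
noncomputable def VHat.of : VG k G →ₐ[k] VHat k G := toLimAlg (modFil k (VG k G))

/-- The elements of degree `≥ n` of `V̂_G`. -/
noncomputable instance : FilteredRing (VHat k G) where
  fil n :=
    { carrier := {t | t.1 n = 0}
      zero_mem' := rfl
      add_mem' := fun {a b} ha hb => by
        show a.1 n + b.1 n = 0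
        rw [show a.1 n = 0 from ha, show b.1 n = 0 from hb, add_zero]
      smul_mem' := fun c a ha => by
        show c.1 n * a.1 n = 0
        rw [show a.1 n = 0 from ha, mul_zero] }
  fil_zero a := by
    obtain ⟨x, hx⟩ := a.2 0
    show a.1 0 = 0
    rw [hx 0 le_rfl, Series.modFil_eq_zero]
    exact FilteredRing.fil_zero x
  fil_mul := fun {m n a b} ha hb => by
    obtain ⟨x, hx⟩ := a.2 (m + n)
    obtain ⟨y, hy⟩ := b.2 (m + n)
    have hx' : x ∈ filR (VG k G) m :=
      Series.modFil_eq_zero (k := k).1 ((hx m (by omega)).symm.trans ha)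
    have hy' : y ∈ filR (VG k G) n :=
      Series.modFil_eq_zero (k := k).1 ((hy n (by omega)).symm.trans hb)
    show a.1 (m + n) * b.1 (m + n) = 0
    rw [hx _ le_rfl, hy _ le_rfl, ← map_mul, Series.modFil_eq_zero]
    exact FilteredRing.fil_mul hx' hy'
  fil_anti := fun {m n a} h ha => by
    obtain ⟨x, hx⟩ := a.2 n
    show a.1 m = 0
    rw [hx m h, Series.modFil_eq_zero]
    exact FilteredRing.fil_anti h
      (Series.modFil_eq_zero (k := k).1 ((hx n le_rfl).symm.trans ha))

/-- The generators of `V̂_G`. -/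
noncomputable def VHat.gen (k : Type*) [CommRing k] {G : Type*} [CommGroup G] (a : VGen G) :
    VHat k G := VHat.of k G (VG.gen k a)

variable (k G) in
/-- The element `e₀` of `V̂_G`. -/
noncomputable def e0 : VHat k G := VHat.gen k VGen.e0

variable (k G) in
/-- The element `e₁` of `V̂_G`. -/
noncomputable def e1 : VHat k G := VHat.gen k VGen.e1

variable (k) in
/-- The element `g` of `V̂_G`. -/
noncomputable def gr (g : G) : VHat k G := VHat.gen k (VGen.grp g)

theorem VHat.gen_mem (a : VGen G) : VHat.gen k a ∈ filR (VHat k G) a.deg :=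
  (Series.modFil_eq_zero (k := k)).2 (VG.gen_mem a)

theorem gr_mul (g h : G) : gr k g * gr k h = gr k (g * h) := by
  have h1 : VG.gen k (VGen.grp g) * VG.gen k (VGen.grp h) = VG.gen k (VGen.grp (g * h)) :=
    (map_mul _ _ _).symm.trans (VG.mk_rel (VRel.mul g h))
  exact (map_mul _ _ _).symm.trans (congrArg _ h1)

theorem gr_one : gr k (1 : G) = 1 := by
  have h1 : (1 : VG k G) = VG.gen k (VGen.grp 1) :=
    (map_one _).symm.trans (VG.mk_rel VRel.one)
  exact (congrArg _ h1.symm).trans (map_one _)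

theorem gr_e0 (g : G) : gr k g * e0 k G = e0 k G * gr k g := by
  have h1 : VG.gen k (VGen.grp g) * VG.gen k VGen.e0 = VG.gen k VGen.e0 * VG.gen k (VGen.grp g) :=
    (map_mul _ _ _).symm.trans ((VG.mk_rel (VRel.comm g)).trans (map_mul _ _ _))
  exact (map_mul _ _ _).symm.trans ((congrArg _ h1).trans (map_mul _ _ _))

/-- The morphism `VG → V̂_G` defined by the images of the generators. -/
noncomputable def liftVG (φ : VGen G → VHat k G)
    (hrel : ∀ x y, VRel k G x y → FreeAlgebra.lift k φ x = FreeAlgebra.lift k φ y) :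
    VG k G →ₐ[k] VHat k G :=
  RingQuot.liftAlgHom k ⟨FreeAlgebra.lift k φ, hrel⟩

theorem liftVG_gen (φ : VGen G → VHat k G)
    (hrel : ∀ x y, VRel k G x y → FreeAlgebra.lift k φ x = FreeAlgebra.lift k φ y)
    (a : VGen G) : liftVG φ hrel (VG.gen k a) = φ a := by
  have h : liftVG φ hrel (VG.gen k a) = FreeAlgebra.lift k φ (FreeAlgebra.ι k a) :=
    RingQuot.liftAlgHom_mkAlgHom_apply _ _ _ _
  rw [h, FreeAlgebra.lift_ι_apply]

theorem liftVG_mem (φ : VGen G → VHat k G)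
    (hrel : ∀ x y, VRel k G x y → FreeAlgebra.lift k φ x = FreeAlgebra.lift k φ y)
    (hdeg : ∀ a, φ a ∈ filR (VHat k G) a.deg) (n : ℕ) (x : VG k G)
    (hx : x ∈ filR (VG k G) n) : liftVG φ hrel x ∈ filR (VHat k G) n := by
  refine Submodule.span_induction
    (p := fun x _ => liftVG φ hrel x ∈ filR (VHat k G) n) ?_ ?_ ?_ ?_ hx
  · rintro _ ⟨w, hw, rfl⟩
    refine FilteredRing.fil_anti hw ?_
    clear hw hx
    induction w with
    | nil => exact FilteredRing.fil_zero _
    | cons a w ih =>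
      rw [List.map_cons, List.prod_cons, map_mul, liftVG_gen]
      have : VG.wdeg (a :: w) = a.deg + VG.wdeg w := by simp [VG.wdeg]
      rw [this]
      exact FilteredRing.fil_mul (hdeg a) ih
  · rw [map_zero]; exact Submodule.zero_mem _
  · intro x y _ _ h1 h2
    rw [map_add]
    exact Submodule.add_mem _ h1 h2
  · intro c x _ h
    rw [map_smul, Algebra.smul_def]
    exact Ideal.mul_mem_left _ _ h

/-- The evaluation `V̂_G → VG / Fⁿ`. -/
noncomputable def VHat.ev (k : Type*) [CommRing k] (G : Type*) [CommGroup G] (n : ℕ) :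
    VHat k G →ₐ[k] VG k G ⧸ filR (VG k G) n :=
  (Pi.evalAlgHom k _ n).comp (limAlg (modFil k (VG k G))).val

/-- The continuous extension to `V̂_G` of an algebra morphism `VG → V̂_G` compatible with the
filtrations. -/
noncomputable def extVG (Φ : VG k G →ₐ[k] VHat k G)
    (hΦ : ∀ n, ∀ x ∈ filR (VG k G) n, Φ x ∈ filR (VHat k G) n) : VHat k G →ₐ[k] VHat k G :=
  (AlgHom.pi (fun n => (Ideal.Quotient.liftₐ (filR (VG k G) n) ((VHat.ev k G n).comp Φ)
    (hΦ n)).comp (VHat.ev k G n))).codRestrict (limAlg (modFil k (VG k G))) (by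
      intro t n
      obtain ⟨x, hx⟩ := t.2 n
      obtain ⟨y, hy⟩ := (Φ x).2 n
      refine ⟨y, fun m hm => ?_⟩
      rw [← hy m hm]
      show Ideal.Quotient.liftₐ (filR (VG k G) m) ((VHat.ev k G m).comp Φ) (hΦ m) (t.1 m) = _
      rw [hx m hm]
      rfl)

theorem extVG_toLim (Φ : VG k G →ₐ[k] VHat k G)
    (hΦ : ∀ n, ∀ x ∈ filR (VG k G) n, Φ x ∈ filR (VHat k G) n) (x : VG k G) :
    extVG Φ hΦ (VHat.of k G x) = Φ x := rfl

theorem extVG_mem (Φ : VG k G →ₐ[k] VHat k G)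
    (hΦ : ∀ n, ∀ x ∈ filR (VG k G) n, Φ x ∈ filR (VHat k G) n) (n : ℕ) (t : VHat k G)
    (ht : t ∈ filR (VHat k G) n) : extVG Φ hΦ t ∈ filR (VHat k G) n := by
  show Ideal.Quotient.liftₐ (filR (VG k G) n) ((VHat.ev k G n).comp Φ) (hΦ n) (t.1 n) = 0
  rw [show t.1 n = 0 from ht, map_zero]

end Crossed

section Crossed

variable {k : Type*} [CommRing k] {G : Type*} [CommGroup G] [Fintype G]

/-- The images of the letters: `x₀ ↦ e₀`, `x_g ↦ -g e₁ g⁻¹`, in `VG`. -/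
def betaVal : XX G → VG k G
  | none => VG.gen k VGen.e0
  | some g => -(VG.gen k (VGen.grp g) * VG.gen k VGen.e1 * VG.gen k (VGen.grp g⁻¹))

theorem betaVal_mem (x : XX G) : betaVal (k := k) x ∈ filR (VG k G) (Weighted.wt x) := by
  cases x with
  | none => exact VG.gen_mem (k := k) (VGen.e0 : VGen G)
  | some g =>
    exact Ideal.neg_mem_iff _ |>.2 (Ideal.mul_mem_right _ _ (Ideal.mul_mem_left _ _
      (VG.gen_mem (k := k) (VGen.e1 : VGen G))))

variable (k G) in
/-- The continuous algebra morphism `k⟨⟨X⟩⟩ → V̂_G` with `x₀ ↦ e₀` and `x_g ↦ -g e₁ g⁻¹`, i.e.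
the restriction of the isomorphism `β : k⟨⟨X⟩⟩ ⋊ G → V̂_G` to `k⟨⟨X⟩⟩`. -/
noncomputable def beta : KX k G →ₐ[k] VHat k G :=
  Series.evalLim (modFil k (VG k G)) betaVal
    fun n => ⟨n, Series.modFil_prod_eq_zero betaVal betaVal_mem n⟩

/-- The images of the generators: `e₀ ↦ e₀`, `g ↦ g`, `e₁ ↦ β(Ψ⁻¹) e₁ β(Ψ)`. -/
noncomputable def autVVal (Ψ : (KX k G)ˣ) : VGen G → VHat k G
  | VGen.e0 => e0 k G
  | VGen.grp g => gr k g
  | VGen.e1 => beta k G ((Ψ⁻¹ : (KX k G)ˣ) : KX k G) * e1 k G * beta k G (Ψ : KX k G)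

theorem autVVal_rel (Ψ : (KX k G)ˣ) (x y : FreeAlgebra k (VGen G)) (h : VRel k G x y) :
    FreeAlgebra.lift k (autVVal Ψ) x = FreeAlgebra.lift k (autVVal Ψ) y := by
  cases h with
  | mul g h => simpa [autVVal] using gr_mul g h
  | one => simpa [autVVal] using gr_one.symm
  | comm g => simpa [autVVal] using gr_e0 g

theorem autVVal_mem (Ψ : (KX k G)ˣ) (a : VGen G) :
    autVVal Ψ a ∈ filR (VHat k G) a.deg := by
  cases a with
  | e0 => exact VHat.gen_mem _
  | grp g => exact VHat.gen_mem (VGen.grp g)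
  | e1 => exact Ideal.mul_mem_right _ _ (Ideal.mul_mem_left _ _ (VHat.gen_mem VGen.e1))

/-- The algebra automorphism `aut_Ψ^{V,(0)}` of `V̂_G`. -/
noncomputable def autV0 (Ψ : (KX k G)ˣ) : VHat k G →ₐ[k] VHat k G :=
  extVG (liftVG (autVVal Ψ) (autVVal_rel Ψ))
    (liftVG_mem (autVVal Ψ) (autVVal_rel Ψ) (autVVal_mem Ψ))

theorem autV0_gen (Ψ : (KX k G)ˣ) (a : VGen G) : autV0 Ψ (VHat.gen k a) = autVVal Ψ a :=
  liftVG_gen _ _ a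

/-- `aut_Ψ^{V,(10)} = ℓ_{β(Ψ)} ∘ aut_Ψ^{V,(0)}`. -/
noncomputable def autV10 (Ψ : (KX k G)ˣ) : VHat k G →ₗ[k] VHat k G :=
  (LinearMap.mulLeft k (beta k G (Ψ : KX k G))).comp (autV0 Ψ).toLinearMap

theorem autV10_mem_fil (Ψ : (KX k G)ˣ) (n : ℕ) (t : VHat k G) (ht : t ∈ filR (VHat k G) n) :
    autV10 Ψ t ∈ filR (VHat k G) n :=
  Ideal.mul_mem_left _ _ (extVG_mem _ _ n t ht)

variable (k G) in
/-- The left ideal `V̂_G e₀ + ∑_{g ≠ 1} V̂_G (g - 1)`. -/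
noncomputable abbrev idealM : Ideal (VHat k G) :=
  Ideal.span ({e0 k G} ∪ {x | ∃ g : G, g ≠ 1 ∧ gr k g - 1 = x})

variable (k G) in
/-- The module `M̂_G`. -/
abbrev MHat := VHat k G ⧸ idealM k G

theorem autV10_mem_ideal (Ψ : (KX k G)ˣ) (t : VHat k G) (ht : t ∈ idealM k G) :
    autV10 Ψ t ∈ idealM k G := by
  refine Submodule.span_induction (p := fun t _ => autV10 Ψ t ∈ idealM k G) ?_ ?_ ?_ ?_ ht
  · rintro x hx
    refine Ideal.mul_mem_left _ _ ?_
    show autV0 Ψ x ∈ _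
    have h : autV0 Ψ x = x := by
      rcases hx with rfl | ⟨g, _, rfl⟩
      · exact autV0_gen Ψ VGen.e0
      · rw [map_sub, map_one, gr, autV0_gen]
        rfl
    rw [h]
    exact Ideal.subset_span hx
  · rw [map_zero]; exact Submodule.zero_mem _
  · intro x y _ _ h1 h2
    rw [map_add]
    exact Submodule.add_mem _ h1 h2
  · intro c x _ h
    have e : autV10 Ψ (c * x) =
        beta k G (Ψ : KX k G) * autV0 Ψ c * beta k G ((Ψ⁻¹ : (KX k G)ˣ) : KX k G) *
          autV10 Ψ x := by
      show beta k G (Ψ : KX k G) * autV0 Ψ (c * x) = _ * (beta k G (Ψ : KX k G) * autV0 Ψ x)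
      have h1 : beta k G ((Ψ⁻¹ : (KX k G)ˣ) : KX k G) * beta k G (Ψ : KX k G) = 1 := by
        rw [← map_mul, Units.inv_mul, map_one]
      rw [map_mul, mul_assoc (_ * _), ← mul_assoc (beta k G ((Ψ⁻¹ : (KX k G)ˣ) : KX k G)), h1,
        one_mul, mul_assoc]
    rw [smul_eq_mul, e]
    exact Ideal.mul_mem_left _ _ h

/-- `aut_Ψ^{M,(10)}`, the automorphism of `M̂_G` induced by `aut_Ψ^{V,(10)}`. -/
noncomputable def autM10 (Ψ : (KX k G)ˣ) : MHat k G →ₗ[k] MHat k G :=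
  quotMap _ _ (autV10 Ψ) (autV10_mem_ideal Ψ)

theorem neg_e1_mem : -VG.gen k (VGen.e1 : VGen G) ∈ filR (VG k G) 1 :=
  (Ideal.neg_mem_iff _).2 (VG.gen_mem (k := k) (VGen.e1 : VGen G))

variable (G) in
/-- `F(-e₁) ∈ V̂_G` for `F ∈ k[[x]]`. -/
noncomputable def evalNegE1 (F : PowerSeries k) : VHat k G := show limAlg (modFil k (VG k G)) from
  Series.evalLim (modFil k (VG k G)) (fun _ : Unit => -VG.gen k VGen.e1)
    (fun n => ⟨n, Series.modFil_prod_eq_zero (α := Unit) (fun _ => -VG.gen k (VGen.e1 : VGen G))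
      (fun _ => neg_e1_mem) n⟩) (toSeries F)

/-- `^Γ aut_Ψ^{M,(10)} = ℓ_{Γ_Ψ⁻¹(-e₁)} ∘ aut_Ψ^{M,(10)}`. -/
noncomputable def gammaAutM [Algebra ℚ k] (Ψ : (KX k G)ˣ) : MHat k G →ₗ[k] MHat k G :=
  (lmul k (idealM k G) (evalNegE1 G (gammaInv (Ψ : KX k G)))).comp (autM10 Ψ)

theorem gammaAutM_mem_fil [Algebra ℚ k] (Ψ : (KX k G)ˣ) (n : ℕ) (m : MHat k G)
    (hm : m ∈ filM k (MHat k G) n) : gammaAutM Ψ m ∈ filM k (MHat k G) n :=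
  lmul_mem_fil _ _ n _ (quotMap_mem_fil _ _ _ _ (autV10_mem_fil Ψ) n m hm)

variable (k G) in
/-- The subalgebra `Ŵ_G = k ⊕ V̂_G e₁` of `V̂_G`. -/
noncomputable def WHat : Subalgebra k (VHat k G) where
  carrier := {w | ∃ (c : k) (v : VHat k G), w = algebraMap k _ c + v * e1 k G}
  add_mem' := by
    rintro _ _ ⟨c, v, rfl⟩ ⟨d, u, rfl⟩
    exact ⟨c + d, v + u, by rw [map_add, add_mul]; abel⟩
  mul_mem' := by
    rintro _ _ ⟨c, v, rfl⟩ ⟨d, u, rfl⟩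
    refine ⟨c * d, (algebraMap k _ c + v * e1 k G) * u + algebraMap k _ d * v, ?_⟩
    rw [mul_add, ← Algebra.commutes d (_ + _), mul_add, map_mul, Algebra.commutes c, add_mul _ _ (e1 k G), mul_assoc _ u,
      mul_assoc _ v, ← Algebra.commutes c]
    rw [← Algebra.commutes d (algebraMap k (VHat k G) c)]
    abel
  algebraMap_mem' c := ⟨c, 0, by rw [zero_mul, add_zero]⟩

/-- The filtration of `Ŵ_G` by the degree. -/
noncomputable instance : FilteredRing (WHat k G) where
  fil n := (filR (VHat k G) n).comap (WHat k G).val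
  fil_zero a := FilteredRing.fil_zero (a : VHat k G)
  fil_mul := fun {m n a b} ha hb => by
    show (a : VHat k G) * b ∈ filR (VHat k G) (m + n)
    exact FilteredRing.fil_mul (A := VHat k G) ha hb
  fil_anti := fun {m n a} h ha => by
    show (a : VHat k G) ∈ filR (VHat k G) m
    exact FilteredRing.fil_anti (A := VHat k G) h ha

/-- The element `z_{n,g} = -e₀^{n-1} g e₁` of `Ŵ_G`. -/
noncomputable def zW (k : Type*) [CommRing k] {G : Type*} [CommGroup G] [Fintype G] (n : ℕ+)
    (g : G) : WHat k G :=
  ⟨-(e0 k G ^ ((n : ℕ) - 1) * gr k g * e1 k G), 0, -(e0 k G ^ ((n : ℕ) - 1) * gr k g), by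
    rw [map_zero, zero_add, neg_mul]⟩

variable (k G) in
/-- The map `Ŵ_G → M̂_G`, `w ↦ w · 1_M`. -/
noncomputable def toM : WHat k G →ₗ[k] MHat k G :=
  ((idealM k G).mkQ.restrictScalars k).comp (WHat k G).val.toLinearMap

theorem toM_mem_fil (n : ℕ) (w : WHat k G) (hw : w ∈ filR (WHat k G) n) :
    toM k G w ∈ filM k (MHat k G) n :=
  mk_mem_fil (k := k) (idealM k G) hw

/-- The property defining the coproduct `Δ̂^W_G`: it is a continuous algebra morphism with
`z_{n,g} ↦ z_{n,g} ⊗ 1 + 1 ⊗ z_{n,g} + ∑_{0 < m < n, h ∈ G} z_{m,h} ⊗ z_{n-m,gh⁻¹}`. -/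
def IsDeltaW (D : WHat k G →ₐ[k] CTensorAlg k (WHat k G)) : Prop :=
  (∀ n, ∃ m, ∀ w ∈ filR (WHat k G) m, (D w).1 n = 0) ∧
    ∀ n g, D (zW k n g) = toLimAlg (T := WHat k G ⊗[k] WHat k G) (tensorModAlg k (WHat k G))
      (harmonicVal (zW k) n g)

/-- The property defining the coproduct `Δ̂^M_G`: it is a continuous linear map with
`Δ̂^M_G(w · 1_M) = Δ̂^W_G(w) · 1_M^{⊗ 2}`. -/
def IsDeltaM (DW : WHat k G →ₐ[k] CTensorAlg k (WHat k G))
    (DM : MHat k G →ₗ[k] CTensorMod k (MHat k G)) : Prop :=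
  (∀ n, ∃ m, ∀ x ∈ filM k (MHat k G) m, (DM x).1 n = 0) ∧
    ∀ w, DM (toM k G w) = CTensorAlg.map (toM k G) toM_mem_fil (DW w)

/-- The stabilizer in `𝒢(k⟨⟨X⟩⟩)` of a map `D` from `M̂_G` to its completed tensor square, for the
action `Ψ · D = (^Γ aut_Ψ^{M,(10)})^{⊗ 2} ∘ D ∘ (^Γ aut_Ψ^{M,(10)})⁻¹`. -/
def stabM [Algebra ℚ k] (D : MHat k G →ₗ[k] CTensorMod k (MHat k G)) : Set (KX k G)ˣ :=
  {Ψ | Ψ ∈ grouplike k G ∧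
    ∀ m, CTensorMod.map (gammaAutM Ψ) (gammaAutM_mem_fil Ψ) (D m) = D (gammaAutM Ψ m)}

end Crossed

end DoubleShuffle

/-! The algebra `V̂_G` is the crossed product `k⟨⟨X⟩⟩ ⋊ G` in other generators. Put `x₀ = e₀` and
`x_g = -g e₁ g⁻¹`; conjugation by `g` then acts on `β(k⟨⟨X⟩⟩)` as `t_g` (`beta_tAut`), and every
element is `∑_g β(F_g) g` for a unique family `F`. Existence of this form is `assemble_coords`. Its
uniqueness rests on an action of `VG` on families by the crossed product multiplication: applied to
the unit family, it reads off the coordinates.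

Passing to `M̂_G` kills right multiples of `e₀` and lets each `g` on the far right become `1`. So `t
↦ ∑_g F_g` identifies `M̂_G` with `k⟨⟨X⟩⟩ / k⟨⟨X⟩⟩ x₀`, with inverse `f ↦ β(f) · 1_M`. In a product
`z_{n₁,g₁} z_{n₂,g₂} ⋯ · 1_M`, pushing all group elements to the right gives `β(x₀^{n₁-1} x_{g₁}
x₀^{n₂-1} x_{g₁g₂} ⋯) · 1_M`. The indices are partial products, which is what `q⁻¹` makes of the
word `y_{n₁,g₁} y_{n₂,g₂} ⋯`. Hence the right identification is `kappa`, the previous one composed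
with the inverse of `qBar`: it takes `π_Y(f)` to `θ(f) · 1_M`, where `θ` sends `y_{n,g}` to
`z_{n,g}` (`gr_thetaV_mono_sub_mem`, `kappa_piY`).

Since `w ↦ w · 1_M` is injective on `Ŵ_G` (`toM_injective`), `θ` is an isomorphism of `k⟨⟨Y⟩⟩` with
`Ŵ_G`, and `w ↦ w · 1_M` is bijective. This yields existence and uniqueness of both coproducts, and
shows that `Δ̂^M_G` is the transport of `Δ̂^mod_⋆` along `kappa`.

The operators correspond as well. The automorphism `autV0 Ψ` extends `autX Ψ` through `β`
(`autV0_beta`); the twist by `q` in the definition of `S_Ψ^Y` is the one that `kappa` undoes; and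
left multiplication by `Γ_Ψ⁻¹(x₁)` commutes with `q` because `x₁` has trivial index, while `β(x₁) =
-e₁`. So `kappa` conjugates `gammaSY Ψ` into `gammaAutM Ψ` (`kappa_gammaSY`), and the two stabilizer
conditions are the same condition read through `kappa`. -/

namespace DoubleShuffle

set_option linter.unusedSectionVars false

/-! ### Monomials and continuity arguments for noncommutative series -/

namespace Series

variable {k α : Type*} [CommRing k]

variable (k) in
/-- The monomial attached to a word. -/
noncomputable def mono (w : List α) : Series k α := (w.map (var (k := k))).prod

@[simp] theorem mono_nil : mono k ([] : List α) = 1 := rfl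

theorem mono_cons (a : α) (w : List α) : mono k (a :: w) = var a * mono k w := by
  simp [mono]

theorem mono_append (u w : List α) : mono k (u ++ w) = mono k u * mono k w := by
  simp [mono]

theorem mono_replicate (n : ℕ) (a : α) : mono k (List.replicate n a) = var a ^ n := by
  simp [mono]

theorem mono_apply [DecidableEq α] (u v : List α) : mono k u v = if u = v then 1 else 0 :=
  monomial_apply u v

theorem sub_sum_mono_mem [Weighted α] (f : Series k α) (n : ℕ) :
    f - ∑ w ∈ (wordWt_finite (α := α) n).toFinset, f w • mono k w ∈ filR (Series k α) n := by
  classical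
  intro v hv
  rw [sub_apply, sum_apply, sub_eq_zero, Finset.sum_eq_single v]
  · simp [mono_apply]
  · intro w _ hw
    simp [mono_apply, hw]
  · intro h
    rw [Set.Finite.mem_toFinset] at h
    exact absurd hv h

/-- Two linear maps which agree on the monomials and on the series of large degree are equal. -/
theorem linearMap_eq_of_mono [Weighted α] {Q : Type*} [AddCommGroup Q] [Module k Q]
    {L L' : Series k α →ₗ[k] Q} (N : ℕ) (h : ∀ f ∈ filR (Series k α) N, L f = L' f)
    (hm : ∀ w, L (mono k w) = L' (mono k w)) : L = L' := by
  refine LinearMap.ext fun f => ?_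
  have h1 := h _ (sub_sum_mono_mem f N)
  rw [map_sub, map_sub, map_sum, map_sum] at h1
  simp only [map_smul, hm] at h1
  exact sub_left_injective h1

/-- Two algebra morphisms which agree on the letters and kill the series of large degree are
equal. -/
theorem algHom_eq_of_var [Weighted α] {Q : Type*} [Ring Q] [Algebra k Q]
    {L L' : Series k α →ₐ[k] Q} (N : ℕ) (h : ∀ f ∈ filR (Series k α) N, L f = 0)
    (h' : ∀ f ∈ filR (Series k α) N, L' f = 0) (hv : ∀ a, L (var a) = L' (var a)) : L = L' := by
  have : L.toLinearMap = L'.toLinearMap := by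
    refine linearMap_eq_of_mono N (fun f hf => (h f hf).trans (h' f hf).symm) fun w => ?_
    show L (mono k w) = L' (mono k w)
    rw [mono, map_list_prod, map_list_prod, List.map_map, List.map_map]
    congr 2
    funext a
    exact hv a
  exact AlgHom.ext fun f => LinearMap.congr_fun this f

theorem eq_of_sub_mem_fil [Weighted α] {f g : Series k α}
    (h : ∀ n, f - g ∈ filR (Series k α) n) : f = g :=
  eq_of_modFil fun n => by rw [← sub_eq_zero, ← map_sub, modFil_eq_zero]; exact h n

theorem algHom_series_ext [Weighted α] {β : Type*} [Weighted β]
    {L L' : Series k α →ₐ[k] Series k β}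
    (h : ∀ n, ∀ f ∈ filR (Series k α) n, L f ∈ filR (Series k β) n)
    (h' : ∀ n, ∀ f ∈ filR (Series k α) n, L' f ∈ filR (Series k β) n)
    (hv : ∀ a, L (var a) = L' (var a)) : L = L' := by
  refine AlgHom.ext fun f => eq_of_modFil fun n => ?_
  have : (modFil k (Series k β) n).comp L = (modFil k (Series k β) n).comp L' :=
    algHom_eq_of_var n (fun f hf => (modFil_eq_zero (k := k)).2 (h n f hf))
      (fun f hf => (modFil_eq_zero (k := k)).2 (h' n f hf))
      fun a => congrArg (modFil k (Series k β) n) (hv a)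
  exact AlgHom.congr_fun this f

theorem substHom_mem_fil [Weighted α] {β : Type*} [Weighted β] (φ : α → Series k β)
    (hφ : ∀ a, φ a ∈ filR (Series k β) (Weighted.wt a)) (n : ℕ) (f : Series k α)
    (hf : f ∈ filR (Series k α) n) : substHom φ hφ f ∈ filR (Series k β) n :=
  substLin_mem_fil (k := k) φ hf

theorem evalHom_var {Q : Type*} [Ring Q] [Algebra k Q] (φ : α → Q)
    (h : {w : List α | (w.map φ).prod ≠ 0}.Finite) (a : α) : evalHom φ h (var a : Series k α) = φ a := by
  classical
  -- The word `[a]` is inserted because it is missing from the support when `φ a = 0`.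
  rw [evalHom_eq_sum φ h _ (insert [a] h.toFinset), Finset.sum_eq_single [a]]
  · simp [var]
  · intro w _ hw
    rw [show (var a : Series k α) w = 0 from if_neg hw, zero_smul]
  · intro hn
    exact absurd (Finset.mem_insert_self _ _) hn
  · intro w hw
    by_contra hn
    exact hw (Finset.mem_insert_of_mem ((Set.Finite.mem_toFinset h).2 hn))

theorem evalHom_eq_zero [Weighted α] {Q : Type*} [Ring Q] [Algebra k Q] (φ : α → Q)
    (h : {w : List α | (w.map φ).prod ≠ 0}.Finite) {N : ℕ}
    (hN : ∀ w : List α, N ≤ wordWt w → (w.map φ).prod = 0) {f : Series k α}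
    (hf : f ∈ filR (Series k α) N) : evalHom φ h f = 0 := by
  rw [evalHom_eq_sum φ h _ (wordWt_finite (α := α) N).toFinset]
  · refine Finset.sum_eq_zero fun w hw => ?_
    rw [Set.Finite.mem_toFinset] at hw
    rw [hf w hw, zero_smul]
  · intro w hw
    rw [Set.Finite.mem_toFinset] at hw
    exact hN w (not_lt.1 hw)

theorem evalLim_var [Weighted α] {T : Type*} {Q : ℕ → Type*} [Ring T] [Algebra k T]
    [∀ n, Ring (Q n)] [∀ n, Algebra k (Q n)] (p : ∀ n, T →ₐ[k] Q n) (φ : α → T)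
    (h : ∀ n, ∃ N, ∀ w : List α, N ≤ wordWt w → (w.map fun a => p n (φ a)).prod = 0) (a : α) :
    evalLim p φ h (var a : Series k α) = toLimAlg p (φ a) :=
  Subtype.ext (funext fun _ => evalHom_var _ _ a)

theorem evalLim_eq_zero [Weighted α] {T : Type*} {Q : ℕ → Type*} [Ring T] [Algebra k T]
    [∀ n, Ring (Q n)] [∀ n, Algebra k (Q n)] (p : ∀ n, T →ₐ[k] Q n) (φ : α → T)
    (h : ∀ n, ∃ N, ∀ w : List α, N ≤ wordWt w → (w.map fun a => p n (φ a)).prod = 0) {n N : ℕ}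
    (hN : ∀ w : List α, N ≤ wordWt w → (w.map fun a => p n (φ a)).prod = 0)
    {f : Series k α} (hf : f ∈ filR (Series k α) N) : (evalLim p φ h f).1 n = 0 :=
  evalHom_eq_zero _ _ hN hf

/-- A series in which only the words ending with `a` occur is a left multiple of `a`. -/
theorem eq_mul_var (a : α) (f : Series k α) (h1 : f [] = 0)
    (h2 : ∀ v b, b ≠ a → f (v ++ [b]) = 0) : ∃ h, h * var a = f :=
  Ideal.mem_span_singleton'.1 ((mem_span_var a f).2 ⟨h1, h2⟩)

end Series

/-! ### The action of `G` on `k⟨⟨X⟩⟩` -/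

section tAut

variable {k : Type*} [CommRing k] {G : Type*} [CommGroup G] [Fintype G]

theorem tAut_var (g : G) (x : XX G) :
    tAut g (Series.var x : KX k G) = Series.var (x.map (g * ·)) :=
  Series.substHom_var _ _ _

theorem tAut_mem_fil (g : G) (n : ℕ) (f : KX k G) (hf : f ∈ filR (KX k G) n) :
    tAut g f ∈ filR (KX k G) n :=
  Series.substHom_mem_fil _ _ n f hf

theorem tAut_one (f : KX k G) : tAut 1 f = f := by
  refine AlgHom.congr_fun (Series.algHom_series_ext (L := tAut (k := k) (1 : G))
    (L' := AlgHom.id k _) (tAut_mem_fil 1) (fun n f hf => hf) fun x => ?_) f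
  rw [tAut_var]
  cases x <;> simp

theorem tAut_mul (g h : G) (f : KX k G) : tAut (g * h) f = tAut g (tAut h f) := by
  refine AlgHom.congr_fun (Series.algHom_series_ext (L := tAut (k := k) (g * h))
    (L' := (tAut g).comp (tAut h)) (tAut_mem_fil _)
    (fun n f hf => tAut_mem_fil _ n _ (tAut_mem_fil _ n f hf)) fun x => ?_) f
  rw [AlgHom.comp_apply, tAut_var, tAut_var, tAut_var]
  cases x <;> simp [mul_assoc]

end tAut

/-! ### Functoriality of completed tensor squares -/

section completedTensor

variable {k : Type*} [CommRing k]

/-- Each level of an element of the completed square is represented by an honest tensor. This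
reduces identities between maps `f ⊗̂ f` to functoriality of the ordinary tensor product. -/
theorem CTensorAlg.map_apply_eq {A M : Type*} [Ring A] [Algebra k A] [FilteredRing A]
    [AddCommGroup M] [Module k M] [FilteredModule k M] (f : A →ₗ[k] M)
    (hf : ∀ n, ∀ x ∈ filR A n, f x ∈ filM k M n) (t : CTensorAlg k A) (n : ℕ) (x : A ⊗[k] A)
    (hx : t.1 n = tensorModAlg k A n x) :
    (CTensorAlg.map f hf t).1 n = tensorModMod k M n (TensorProduct.map f f x) := by
  show TensorProduct.map (modMap f hf n) (modMap f hf n) (t.1 n) = _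
  rw [hx]
  show (TensorProduct.map (modMap f hf n) (modMap f hf n))
    ((TensorProduct.map (modFil k A n).toLinearMap (modFil k A n).toLinearMap) x) = _
  simp only [tensorModMod]
  rw [← LinearMap.comp_apply, ← LinearMap.comp_apply, ← TensorProduct.map_comp,
    ← TensorProduct.map_comp]
  rfl

theorem CTensorAlg.map_eq_zero {A M : Type*} [Ring A] [Algebra k A] [FilteredRing A]
    [AddCommGroup M] [Module k M] [FilteredModule k M] (f : A →ₗ[k] M)
    (hf : ∀ n, ∀ x ∈ filR A n, f x ∈ filM k M n) (t : CTensorAlg k A) (n : ℕ) (ht : t.1 n = 0) :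
    (CTensorAlg.map f hf t).1 n = 0 := by
  rw [CTensorAlg.map_apply_eq f hf t n 0 (by rw [ht, map_zero]), map_zero, map_zero]

theorem CTensorMod.map_apply_eq {M N : Type*} [AddCommGroup M] [Module k M]
    [FilteredModule k M] [AddCommGroup N] [Module k N] [FilteredModule k N] (f : M →ₗ[k] N)
    (hf : ∀ n, ∀ x ∈ filM k M n, f x ∈ filM k N n) (t : CTensorMod k M) (n : ℕ) (x : M ⊗[k] M)
    (hx : t.1 n = tensorModMod k M n x) :
    (CTensorMod.map f hf t).1 n = tensorModMod k N n (TensorProduct.map f f x) := by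
  show TensorProduct.map (Submodule.mapQ _ _ f (hf n)) (Submodule.mapQ _ _ f (hf n)) (t.1 n) = _
  rw [hx]
  simp only [tensorModMod]
  rw [← LinearMap.comp_apply, ← LinearMap.comp_apply, ← TensorProduct.map_comp,
    ← TensorProduct.map_comp]
  rfl

variable {M N P : Type*} [AddCommGroup M] [Module k M] [FilteredModule k M]
  [AddCommGroup N] [Module k N] [FilteredModule k N]
  [AddCommGroup P] [Module k P] [FilteredModule k P]

theorem CTensorMod.map_map (f : M →ₗ[k] N) (hf : ∀ n, ∀ x ∈ filM k M n, f x ∈ filM k N n)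
    (g : N →ₗ[k] P) (hg : ∀ n, ∀ x ∈ filM k N n, g x ∈ filM k P n)
    (l : M →ₗ[k] P) (hl : ∀ n, ∀ x ∈ filM k M n, l x ∈ filM k P n) (h : ∀ x, g (f x) = l x)
    (t : CTensorMod k M) : CTensorMod.map g hg (CTensorMod.map f hf t) = CTensorMod.map l hl t := by
  obtain rfl : g.comp f = l := LinearMap.ext h
  refine Subtype.ext (funext fun n => ?_)
  obtain ⟨x, hx⟩ := t.2 n
  have hx := hx n le_rfl
  rw [CTensorMod.map_apply_eq g hg _ n _ (CTensorMod.map_apply_eq f hf t n x hx),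
    CTensorMod.map_apply_eq (g.comp f) hl t n x hx, TensorProduct.map_comp, LinearMap.comp_apply]

theorem CTensorMod.map_algMap {A : Type*} [Ring A] [Algebra k A] [FilteredRing A]
    (f : A →ₗ[k] N) (hf : ∀ n, ∀ x ∈ filR A n, f x ∈ filM k N n)
    (g : N →ₗ[k] P) (hg : ∀ n, ∀ x ∈ filM k N n, g x ∈ filM k P n)
    (l : A →ₗ[k] P) (hl : ∀ n, ∀ x ∈ filR A n, l x ∈ filM k P n) (h : ∀ x, g (f x) = l x)
    (t : CTensorAlg k A) : CTensorMod.map g hg (CTensorAlg.map f hf t) = CTensorAlg.map l hl t := by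
  obtain rfl : g.comp f = l := LinearMap.ext h
  refine Subtype.ext (funext fun n => ?_)
  obtain ⟨x, hx⟩ := t.2 n
  have hx := hx n le_rfl
  rw [CTensorMod.map_apply_eq g hg _ n _ (CTensorAlg.map_apply_eq f hf t n x hx),
    CTensorAlg.map_apply_eq (g.comp f) hl t n x hx, TensorProduct.map_comp, LinearMap.comp_apply]

theorem CTensorMod.map_id (t : CTensorMod k M) :
    CTensorMod.map LinearMap.id (fun _ _ h => h) t = t := by
  refine Subtype.ext (funext fun n => ?_)
  obtain ⟨x, hx⟩ := t.2 n
  have hx := hx n le_rfl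
  rw [CTensorMod.map_apply_eq _ _ t n x hx, hx, TensorProduct.map_id, LinearMap.id_apply]

/-- By functoriality `g ⊗̂ g` is a left inverse. It serves to cancel the completed square of `kappa`
when the stabilizers are compared. -/
theorem CTensorMod.map_injective (f : M →ₗ[k] N)
    (hf : ∀ n, ∀ x ∈ filM k M n, f x ∈ filM k N n) (g : N →ₗ[k] M)
    (hg : ∀ n, ∀ x ∈ filM k N n, g x ∈ filM k M n) (h : ∀ x, g (f x) = x) :
    Function.Injective (CTensorMod.map f hf) :=
  Function.LeftInverse.injective (g := CTensorMod.map g hg) fun t =>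
    (CTensorMod.map_map f hf g hg LinearMap.id (fun _ _ h => h) h t).trans (CTensorMod.map_id t)

section coprodHom

variable {α : Type*} [Weighted α] {A B : Type*} [Ring A] [Algebra k A] [FilteredRing A]
  [Ring B] [Algebra k B] [FilteredRing B]

/-- If `i + j ≥ 2n` then `i ≥ n` or `j ≥ n`, so a tensor of total degree `2n` dies at level `n`.
This is the origin of every `2 * n` in the continuity statements below. -/
theorem coprodHom_eq_zero (φ : α → A ⊗[k] A) (hφ : ∀ a, φ a ∈ tensorFil k A (Weighted.wt a))
    (n : ℕ) (f : Series k α) (hf : f ∈ filR (Series k α) (2 * n)) :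
    (coprodHom φ hφ f).1 n = 0 := by
  refine Series.evalLim_eq_zero (tensorModAlg k A) φ _ (N := 2 * n) (fun w hw => ?_) hf
  have h : (w.map fun a => tensorModAlg k A n (φ a)).prod = tensorModAlg k A n (w.map φ).prod := by
    rw [map_list_prod, List.map_map]
    rfl
  rw [h]
  exact tensorModAlg_eq_zero hw (tensorFil_prod φ hφ w)

theorem coprodHom_var (φ : α → A ⊗[k] A) (hφ : ∀ a, φ a ∈ tensorFil k A (Weighted.wt a)) (a : α) :
    coprodHom φ hφ (Series.var a) = toLimAlg (T := A ⊗[k] A) (tensorModAlg k A) (φ a) :=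
  Series.evalLim_var _ _ _ a

theorem coprodHom_mono (φ : α → A ⊗[k] A) (hφ : ∀ a, φ a ∈ tensorFil k A (Weighted.wt a))
    (w : List α) : coprodHom φ hφ (Series.mono k w) =
      toLimAlg (T := A ⊗[k] A) (tensorModAlg k A) (w.map φ).prod := by
  rw [Series.mono, map_list_prod, map_list_prod, List.map_map, List.map_map]
  congr 2
  funext a
  exact coprodHom_var φ hφ a

/-- Two maps of the form `f^{⊗ 2} ∘ coprodHom φ` are equal if they agree on monomials. -/
theorem map_coprodHom_eq (φ : α → A ⊗[k] A) (hφ : ∀ a, φ a ∈ tensorFil k A (Weighted.wt a))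
    (ψ : α → B ⊗[k] B) (hψ : ∀ a, ψ a ∈ tensorFil k B (Weighted.wt a))
    (f : A →ₗ[k] M) (hf : ∀ n, ∀ x ∈ filR A n, f x ∈ filM k M n)
    (g : B →ₗ[k] M) (hg : ∀ n, ∀ x ∈ filR B n, g x ∈ filM k M n)
    (h : ∀ w : List α,
      TensorProduct.map f f (w.map φ).prod = TensorProduct.map g g (w.map ψ).prod)
    (s : Series k α) :
    CTensorAlg.map f hf (coprodHom φ hφ s) = CTensorAlg.map g hg (coprodHom ψ hψ s) := by
  refine Subtype.ext (funext fun n => ?_)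
  let pr : CTensorMod k M →ₗ[k] (M ⧸ filM k M n) ⊗[k] (M ⧸ filM k M n) :=
    (LinearMap.proj n).comp (Submodule.subtype _)
  let L := pr.comp ((CTensorAlg.map f hf).comp (coprodHom φ hφ).toLinearMap)
  let L' := pr.comp ((CTensorAlg.map g hg).comp (coprodHom ψ hψ).toLinearMap)
  have hL : L = L' := by
    refine Series.linearMap_eq_of_mono (2 * n) (fun s hs => ?_) fun w => ?_
    · have h1 : L s = 0 := CTensorAlg.map_eq_zero f hf _ n (coprodHom_eq_zero φ hφ n s hs)
      have h2 : L' s = 0 := CTensorAlg.map_eq_zero g hg _ n (coprodHom_eq_zero ψ hψ n s hs)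
      rw [h1, h2]
    · show (CTensorAlg.map f hf (coprodHom φ hφ (Series.mono k w))).1 n =
        (CTensorAlg.map g hg (coprodHom ψ hψ (Series.mono k w))).1 n
      rw [coprodHom_mono, coprodHom_mono, CTensorAlg.map_apply_eq f hf _ n (w.map φ).prod rfl,
        CTensorAlg.map_apply_eq g hg _ n (w.map ψ).prod rfl, h]
  exact LinearMap.congr_fun hL s

/-- The harmonic formula is natural in the algebra, so a morphism sending `y_{n,g}` to `z_{n,g}`
carries one coproduct formula to the other. -/
theorem harmonicVal_map {G : Type*} [CommGroup G] [Fintype G] (θ : A →ₐ[k] B) (z : ℕ+ → G → A)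
    (n : ℕ+) (g : G) : Algebra.TensorProduct.map θ θ (harmonicVal z n g) =
      harmonicVal (fun n g => θ (z n g)) n g := by
  simp [harmonicVal]

end coprodHom

end completedTensor

/-! ### Density and separation in `V̂_G`; the group elements -/

section VHatBasics

variable {k : Type*} [CommRing k] {G : Type*} [CommGroup G]

theorem VG.induction {p : VG k G → Prop} (hc : ∀ c, p (algebraMap k _ c))
    (hg : ∀ a, p (VG.gen k a)) (hm : ∀ x y, p x → p y → p (x * y))
    (ha : ∀ x y, p x → p y → p (x + y)) (x : VG k G) : p x := by
  obtain ⟨x, rfl⟩ := VG.mk_surjective k G x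
  induction x using FreeAlgebra.induction with
  | grade0 c =>
    have h : VG.mk k G (algebraMap k _ c) = algebraMap k _ c := AlgHom.commutes _ c
    exact h.symm ▸ hc c
  | grade1 x => exact hg x
  | mul a b ha hb => rw [map_mul]; exact hm _ _ ha hb
  | add a b h1 h2 => rw [map_add]; exact ha _ _ h1 h2

theorem VHat.eq_of_sub_mem_fil {s t : VHat k G} (h : ∀ n, s - t ∈ filR (VHat k G) n) : s = t :=
  Subtype.ext (funext fun n => sub_eq_zero.1 (show s.1 n - t.1 n = 0 from h n))

theorem VHat.of_mem_fil {n : ℕ} {x : VG k G} :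
    VHat.of k G x ∈ filR (VHat k G) n ↔ x ∈ filR (VG k G) n :=
  Series.modFil_eq_zero (k := k)

theorem VHat.exists_of (t : VHat k G) (n : ℕ) :
    ∃ x : VG k G, t - VHat.of k G x ∈ filR (VHat k G) n := by
  obtain ⟨x, hx⟩ := t.2 n
  exact ⟨x, sub_eq_zero.2 (hx n le_rfl)⟩

/-- Two filtered linear maps from `V̂_G` to series which agree on `VG` are equal. -/
theorem VHat.linearMap_ext {α : Type*} [Weighted α] {L L' : VHat k G →ₗ[k] Series k α}
    (h : ∀ n, ∀ t ∈ filR (VHat k G) n, L t ∈ filR (Series k α) n)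
    (h' : ∀ n, ∀ t ∈ filR (VHat k G) n, L' t ∈ filR (Series k α) n)
    (hof : ∀ x, L (VHat.of k G x) = L' (VHat.of k G x)) (t : VHat k G) : L t = L' t := by
  refine Series.eq_of_sub_mem_fil fun n => ?_
  obtain ⟨x, hx⟩ := VHat.exists_of t n
  have h1 := Submodule.sub_mem _ (h n _ hx) (h' n _ hx)
  rwa [map_sub, map_sub, hof, sub_sub_sub_cancel_right] at h1

theorem gr_mul_inv (g : G) : gr k g * gr k g⁻¹ = 1 := by
  rw [gr_mul, mul_inv_cancel, gr_one]

theorem gr_inv_mul (g : G) : gr k g⁻¹ * gr k g = 1 := by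
  rw [gr_mul, inv_mul_cancel, gr_one]

theorem gr_e0_pow (g : G) (n : ℕ) : gr k g * e0 k G ^ n = e0 k G ^ n * gr k g :=
  (show Commute (gr k g) (e0 k G) from gr_e0 g).pow_right n

end VHatBasics

variable {k : Type*} [CommRing k] {G : Type*} [CommGroup G] [Fintype G]

/-! ### The morphism `β` and the crossed product relation -/

section beta

theorem beta_var (x : XX G) : beta k G (Series.var x) = VHat.of k G (betaVal x) :=
  Series.evalLim_var _ _ _ x

theorem beta_x0 : beta k G (Series.var none) = e0 k G := beta_var none

theorem beta_xg (g : G) :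
    beta k G (Series.var (some g)) = -(gr k g * e1 k G * gr k g⁻¹) := by
  rw [beta_var, betaVal, map_neg, map_mul, map_mul]
  rfl

theorem beta_mem_fil (n : ℕ) (f : KX k G) (hf : f ∈ filR (KX k G) n) :
    beta k G f ∈ filR (VHat k G) n :=
  Series.evalLim_eq_zero _ _ _ (Series.modFil_prod_eq_zero betaVal betaVal_mem n) hf

/-- A linear map from series to `V̂_G` is determined by its values on monomials if it is
filtered. -/
theorem linearMap_VHat_ext {α : Type*} [Weighted α] {L L' : Series k α →ₗ[k] VHat k G}
    (h : ∀ n, ∀ f ∈ filR (Series k α) n, L f ∈ filR (VHat k G) n)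
    (h' : ∀ n, ∀ f ∈ filR (Series k α) n, L' f ∈ filR (VHat k G) n)
    (hm : ∀ w, L (Series.mono k w) = L' (Series.mono k w)) (f : Series k α) : L f = L' f := by
  refine VHat.eq_of_sub_mem_fil fun n => ?_
  have h1 := Submodule.sub_mem _ (h n _ (Series.sub_sum_mono_mem f n))
    (h' n _ (Series.sub_sum_mono_mem f n))
  rw [map_sub, map_sub, map_sum, map_sum] at h1
  simp only [map_smul, hm] at h1
  rwa [sub_sub_sub_cancel_right] at h1

theorem algHom_VHat_ext {α : Type*} [Weighted α] {L L' : Series k α →ₐ[k] VHat k G}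
    (h : ∀ n, ∀ f ∈ filR (Series k α) n, L f ∈ filR (VHat k G) n)
    (h' : ∀ n, ∀ f ∈ filR (Series k α) n, L' f ∈ filR (VHat k G) n)
    (hv : ∀ a, L (Series.var a) = L' (Series.var a)) (f : Series k α) : L f = L' f := by
  refine linearMap_VHat_ext (L := L.toLinearMap) (L' := L'.toLinearMap) h h' (fun w => ?_) f
  show L (Series.mono k w) = L' (Series.mono k w)
  rw [Series.mono, map_list_prod, map_list_prod, List.map_map, List.map_map]
  congr 2
  funext a
  exact hv a

theorem beta_tAut_var (g : G) (x : XX G) :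
    beta k G (Series.var (x.map (g * ·))) * gr k g = gr k g * beta k G (Series.var x) := by
  cases x with
  | none => rw [Option.map_none, beta_x0, gr_e0]
  | some h =>
    rw [Option.map_some, beta_xg, beta_xg, neg_mul, mul_neg, mul_inv_rev, mul_assoc _ (gr k _),
      gr_mul, inv_mul_cancel_right, ← gr_mul, mul_assoc, mul_assoc, mul_assoc]

/-- This is `g β(f) g⁻¹ = β(t_g f)`, the defining relation of the crossed product. Without the
inverse, each letter of a monomial can be moved past `g` in turn, and density does the rest. -/
theorem beta_tAut (g : G) (f : KX k G) :
    beta k G (tAut g f) * gr k g = gr k g * beta k G f := by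
  refine linearMap_VHat_ext
    (L := (LinearMap.mulRight k (gr k g)).comp ((beta k G).comp (tAut g)).toLinearMap)
    (L' := (LinearMap.mulLeft k (gr k g)).comp (beta k G).toLinearMap)
    (fun n f hf => Ideal.mul_mem_right _ _ (beta_mem_fil n _ (tAut_mem_fil g n f hf)))
    (fun n f hf => Ideal.mul_mem_left _ _ (beta_mem_fil n f hf)) (fun w => ?_) f
  show beta k G (tAut g (Series.mono k w)) * gr k g = gr k g * beta k G (Series.mono k w)
  induction w with
  | nil => simp
  | cons a w ih =>
    rw [Series.mono_cons, map_mul, map_mul, mul_assoc, ih, tAut_var, ← mul_assoc, beta_tAut_var,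
      map_mul, mul_assoc]

end beta

/-! ### Coordinates: `V̂_G` as the crossed product `k⟨⟨X⟩⟩ ⋊ G` -/

section coords

variable (k G) in
/-- The space of families of series indexed by `G`; the family `F` stands for the element
`∑ F_g g` of `k⟨⟨X⟩⟩ ⋊ G`. -/
abbrev Fam := G → KX k G

/-- Left multiplication by the generators on `k⟨⟨X⟩⟩ ⋊ G`. -/
noncomputable def leftOp : VGen G → Module.End k (Fam k G)
  | VGen.e0 => LinearMap.pi fun g =>
      (LinearMap.mulLeft k (Series.var none)).comp (LinearMap.proj g)
  | VGen.e1 => LinearMap.pi fun g =>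
      (LinearMap.mulLeft k (-Series.var (some 1))).comp (LinearMap.proj g)
  -- Since `h · (F_u u) = t_h(F_u) hu`, the coordinate at `g` comes from `u = h⁻¹g`.
  | VGen.grp h => LinearMap.pi fun g => (tAut h).toLinearMap.comp (LinearMap.proj (h⁻¹ * g))

theorem leftOp_e0 (F : Fam k G) (g : G) : leftOp VGen.e0 F g = Series.var none * F g := rfl

theorem leftOp_e1 (F : Fam k G) (g : G) :
    leftOp VGen.e1 F g = -Series.var (some 1) * F g := rfl

theorem leftOp_grp (h : G) (F : Fam k G) (g : G) :
    leftOp (VGen.grp h) F g = tAut h (F (h⁻¹ * g)) := rfl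

/-- Right multiplication by the generators on `k⟨⟨X⟩⟩ ⋊ G`. -/
noncomputable def rightOp : VGen G → Module.End k (Fam k G)
  | VGen.e0 => LinearMap.pi fun g =>
      (LinearMap.mulRight k (Series.var none)).comp (LinearMap.proj g)
  -- Here `e₁ = -x₁`, and moving `g` past it turns `x₁` into `t_g(x₁) = x_g`.
  | VGen.e1 => LinearMap.pi fun g =>
      (LinearMap.mulRight k (-Series.var (some g))).comp (LinearMap.proj g)
  | VGen.grp h => LinearMap.pi fun g => LinearMap.proj (g * h⁻¹)

theorem rightOp_e0 (F : Fam k G) (g : G) : rightOp VGen.e0 F g = F g * Series.var none := rfl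

theorem rightOp_e1 (F : Fam k G) (g : G) :
    rightOp VGen.e1 F g = F g * -Series.var (some g) := rfl

theorem rightOp_grp (h : G) (F : Fam k G) (g : G) :
    rightOp (VGen.grp h) F g = F (g * h⁻¹) := rfl

/-- The group relations hold because `t` is an action of `G`, and the commutation relation because
`t_g` fixes `x₀`. Hence the operators descend to `VG`. -/
theorem leftOp_rel (x y : FreeAlgebra k (VGen G)) (h : VRel k G x y) :
    FreeAlgebra.lift k (leftOp (k := k)) x = FreeAlgebra.lift k (leftOp (k := k)) y := by
  cases h with
  | mul g h =>
    rw [map_mul, FreeAlgebra.lift_ι_apply, FreeAlgebra.lift_ι_apply, FreeAlgebra.lift_ι_apply]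
    refine LinearMap.ext fun F => funext fun u => ?_
    rw [Module.End.mul_apply, leftOp_grp, leftOp_grp, leftOp_grp, tAut_mul, mul_inv_rev, mul_assoc]
  | one =>
    rw [map_one, FreeAlgebra.lift_ι_apply]
    refine LinearMap.ext fun F => funext fun u => ?_
    rw [leftOp_grp, tAut_one, inv_one, one_mul, Module.End.one_apply]
  | comm g =>
    rw [map_mul, map_mul, FreeAlgebra.lift_ι_apply, FreeAlgebra.lift_ι_apply]
    refine LinearMap.ext fun F => funext fun u => ?_
    rw [Module.End.mul_apply, Module.End.mul_apply, leftOp_grp, leftOp_e0, leftOp_e0, leftOp_grp,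
      map_mul, tAut_var, Option.map_none]

variable (k G) in
/-- The left multiplication action of `VG` on `k⟨⟨X⟩⟩ ⋊ G`. -/
noncomputable def leftAct : VG k G →ₐ[k] Module.End k (Fam k G) :=
  RingQuot.liftAlgHom k ⟨FreeAlgebra.lift k leftOp, leftOp_rel⟩

theorem leftAct_gen (a : VGen G) : leftAct k G (VG.gen k a) = leftOp a := by
  have h : leftAct k G (VG.gen k a) = FreeAlgebra.lift k leftOp (FreeAlgebra.ι k a) :=
    RingQuot.liftAlgHom_mkAlgHom_apply _ _ _ _
  rw [h, FreeAlgebra.lift_ι_apply]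

theorem leftOp_mem_fil (a : VGen G) (n : ℕ) (F : Fam k G) (hF : ∀ g, F g ∈ filR (KX k G) n)
    (g : G) : leftOp a F g ∈ filR (KX k G) (a.deg + n) := by
  cases a with
  | e0 => exact FilteredRing.fil_mul (Series.var_mem_fil (none : XX G)) (hF g)
  | e1 =>
    exact FilteredRing.fil_mul ((Ideal.neg_mem_iff _).2 (Series.var_mem_fil (some 1 : XX G))) (hF g)
  | grp h =>
    rw [leftOp_grp, show (VGen.grp h).deg + n = n from zero_add n]
    exact tAut_mem_fil h n _ (hF _)

theorem leftAct_mem_fil (n : ℕ) (x : VG k G) (hx : x ∈ filR (VG k G) n) (F : Fam k G) (g : G) :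
    leftAct k G x F g ∈ filR (KX k G) n := by
  refine Submodule.span_induction
    (p := fun x _ => leftAct k G x F g ∈ filR (KX k G) n) ?_ ?_ ?_ ?_ hx
  · rintro _ ⟨w, hw, rfl⟩
    refine FilteredRing.fil_anti hw ?_
    clear hw hx
    induction w generalizing g with
    | nil => exact FilteredRing.fil_zero _
    | cons a w ih =>
      rw [List.map_cons, List.prod_cons, map_mul, leftAct_gen, Module.End.mul_apply,
        show VG.wdeg (a :: w) = a.deg + VG.wdeg w by simp [VG.wdeg]]
      exact leftOp_mem_fil a _ _ ih g
  · rw [map_zero]; exact Submodule.zero_mem _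
  · intro x y _ _ h1 h2
    rw [map_add]
    exact Submodule.add_mem _ h1 h2
  · intro c x _ h
    rw [map_smul]
    show c • leftAct k G x F g ∈ _
    rw [Algebra.smul_def]
    exact Ideal.mul_mem_left _ _ h

/-- Associativity of the crossed product on generators. The telling case is `grp h` on the left and
`e1` on the right: `t_h` turns the letter `x_{h⁻¹g}` into `x_g`, as the change of index requires. -/
theorem leftOp_rightOp (a b : VGen G) (F : Fam k G) :
    leftOp a (rightOp b F) = rightOp b (leftOp a F) := by
  funext g
  cases a <;> cases b <;>
    simp only [leftOp_e0, leftOp_e1, leftOp_grp, rightOp_e0, rightOp_e1, rightOp_grp, mul_assoc,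
      map_mul, map_neg, tAut_var, Option.map_none, Option.map_some, mul_inv_cancel_left]

theorem leftAct_rightOp (b : VGen G) (x : VG k G) :
    ∀ F : Fam k G, leftAct k G x (rightOp b F) = rightOp b (leftAct k G x F) := by
  induction x using VG.induction with
  | hc c => intro F; rw [AlgHom.commutes]; simp [Module.algebraMap_end_apply]
  | hg a => intro F; rw [leftAct_gen, leftOp_rightOp]
  | hm x y hx hy =>
    intro F; rw [map_mul, Module.End.mul_apply, Module.End.mul_apply, hy, hx]
  | ha x y hx hy =>
    intro F; rw [map_add, LinearMap.add_apply, LinearMap.add_apply, hx, hy, map_add]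

variable (k G) in
/-- The unit of `k⟨⟨X⟩⟩ ⋊ G`. -/
noncomputable def famOne : Fam k G := by
  classical exact Pi.single 1 1

theorem famOne_one : famOne k G 1 = 1 := by simp [famOne]

theorem famOne_ne {g : G} (h : g ≠ 1) : famOne k G g = 0 := by simp [famOne, h]

theorem leftOp_famOne (a : VGen G) : leftOp a (famOne k G) = rightOp a (famOne k G) := by
  funext g
  cases a with
  | e0 =>
    rw [leftOp_e0, rightOp_e0]
    by_cases h : g = 1
    · rw [h, famOne_one, one_mul, mul_one]
    · rw [famOne_ne h, zero_mul, mul_zero]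
  | e1 =>
    rw [leftOp_e1, rightOp_e1]
    by_cases h : g = 1
    · rw [h, famOne_one, one_mul, mul_one]
    · rw [famOne_ne h, zero_mul, mul_zero]
  | grp u =>
    rw [leftOp_grp, rightOp_grp, mul_comm u⁻¹]
    by_cases h : g * u⁻¹ = 1
    · rw [h, famOne_one, map_one]
    · rw [famOne_ne h, map_zero]

/-- An element of `VG` approximating an element of `V̂_G` modulo degree `n`. -/
noncomputable def VHat.approx (t : VHat k G) (n : ℕ) : VG k G := (VHat.exists_of t n).choose

theorem VHat.approx_spec (t : VHat k G) (n : ℕ) :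
    t - VHat.of k G (t.approx n) ∈ filR (VHat k G) n := (VHat.exists_of t n).choose_spec

/-- The action does not lower degrees, so a coefficient at `w` sees `x` only modulo degree greater
than that of `w`. This makes the coordinates of a completed element independent of the chosen
approximations. -/
theorem leftAct_approx (t : VHat k G) {n : ℕ} {x : VG k G}
    (h : t - VHat.of k G x ∈ filR (VHat k G) n) (F : Fam k G) (g : G) {w : List (XX G)}
    (hw : wordWt w < n) :
    leftAct k G (t.approx (wordWt w + 1)) F g w = leftAct k G x F g w := by
  have h1 := Submodule.sub_mem _ (FilteredRing.fil_anti (show wordWt w + 1 ≤ n from hw) h)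
    (t.approx_spec (wordWt w + 1))
  rw [sub_sub_sub_cancel_left, ← map_sub, VHat.of_mem_fil] at h1
  have h2 := leftAct_mem_fil _ _ h1 F g w (Nat.lt_succ_self _)
  rw [map_sub] at h2
  exact sub_eq_zero.1 h2

/-- The family of the coordinates of an element of `V̂_G`. -/
noncomputable def coordsFun (t : VHat k G) : Fam k G :=
  fun g w => leftAct k G (t.approx (wordWt w + 1)) (famOne k G) g w

theorem coordsFun_apply (t : VHat k G) {n : ℕ} {x : VG k G}
    (h : t - VHat.of k G x ∈ filR (VHat k G) n) (g : G) {w : List (XX G)} (hw : wordWt w < n) :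
    coordsFun t g w = leftAct k G x (famOne k G) g w :=
  leftAct_approx t h (famOne k G) g hw

theorem coordsFun_add (s t : VHat k G) : coordsFun (s + t) = coordsFun s + coordsFun t := by
  funext g
  refine Series.ext fun w => ?_
  have hs := s.approx_spec (wordWt w + 1)
  have ht := t.approx_spec (wordWt w + 1)
  have h1 := Submodule.add_mem _ hs ht
  rw [sub_add_sub_comm, ← map_add] at h1
  have hw := Nat.lt_succ_self (wordWt w)
  rw [coordsFun_apply _ h1 g hw, Pi.add_apply, Series.add_apply, coordsFun_apply _ hs g hw,
    coordsFun_apply _ ht g hw, map_add, LinearMap.add_apply, Pi.add_apply, Series.add_apply]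

theorem coordsFun_smul (c : k) (t : VHat k G) : coordsFun (c • t) = c • coordsFun t := by
  funext g
  refine Series.ext fun w => ?_
  have ht := t.approx_spec (wordWt w + 1)
  have h1 : c • t - VHat.of k G (c • t.approx (wordWt w + 1)) ∈
      filR (VHat k G) (wordWt w + 1) := by
    rw [map_smul, ← smul_sub, Algebra.smul_def]
    exact Ideal.mul_mem_left _ _ ht
  have hw := Nat.lt_succ_self (wordWt w)
  rw [coordsFun_apply _ h1 g hw, Pi.smul_apply, Series.smul_apply, coordsFun_apply _ ht g hw,
    map_smul, LinearMap.smul_apply, Pi.smul_apply, Series.smul_apply]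

variable (k G) in
/-- The coordinates of the elements of `V̂_G` in the decomposition `V̂_G = ⊕_g β(k⟨⟨X⟩⟩) g`. -/
noncomputable def coords : VHat k G →ₗ[k] Fam k G where
  toFun := coordsFun
  map_add' := coordsFun_add
  map_smul' := coordsFun_smul

theorem coords_of (x : VG k G) : coords k G (VHat.of k G x) = leftAct k G x (famOne k G) := by
  funext g
  ext w
  exact coordsFun_apply _ (n := wordWt w + 1) (by rw [sub_self]; exact Submodule.zero_mem _) g
    (Nat.lt_succ_self _)

theorem coords_mem_fil (n : ℕ) (t : VHat k G) (ht : t ∈ filR (VHat k G) n) (g : G) :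
    coords k G t g ∈ filR (KX k G) n := by
  intro w hw
  have h1 : t - VHat.of k G 0 ∈ filR (VHat k G) n := by rwa [map_zero, sub_zero]
  refine (coordsFun_apply t h1 g hw).trans ?_
  rw [map_zero, LinearMap.zero_apply, Pi.zero_apply, Series.zero_apply]

theorem rightOp_mem_fil (a : VGen G) (n : ℕ) (F : Fam k G) (hF : ∀ g, F g ∈ filR (KX k G) n)
    (g : G) : rightOp a F g ∈ filR (KX k G) n := by
  cases a with
  | e0 => exact Ideal.mul_mem_right _ _ (hF g)
  | e1 => exact Ideal.mul_mem_right _ _ (hF g)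
  | grp h => exact hF _

/-- On `VG`: `(x a) · 1 = x · (1 · a) = (x · 1) · a`, since left and right operators commute and
agree on the unit family; then density. -/
theorem coords_mul_gen (t : VHat k G) (a : VGen G) :
    coords k G (t * VHat.gen k a) = rightOp a (coords k G t) := by
  funext g
  refine VHat.linearMap_ext
    (L := (LinearMap.proj g).comp ((coords k G).comp (LinearMap.mulRight k (VHat.gen k a))))
    (L' := (LinearMap.proj g).comp ((rightOp a).comp (coords k G)))
    (fun n t ht => coords_mem_fil n _ (Ideal.mul_mem_right _ _ ht) g)
    (fun n t ht => rightOp_mem_fil a n _ (coords_mem_fil n t ht) g) (fun x => ?_) t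
  show coords k G (VHat.of k G x * VHat.of k G (VG.gen k a)) g =
    rightOp a (coords k G (VHat.of k G x)) g
  rw [← map_mul, coords_of, coords_of, map_mul, Module.End.mul_apply, leftAct_gen, leftOp_famOne,
    leftAct_rightOp]

/-- For `x_h` the action is `t_h`, multiplication by `x₁` and `t_h⁻¹` composed; the two shifts of
the index cancel, and what remains is multiplication by `t_h(x₁) = x_h`. So `β` of a series acts
without mixing the coordinates. -/
theorem leftAct_betaVal (x : XX G) (F : Fam k G) (g : G) :
    leftAct k G (betaVal x) F g = Series.var x * F g := by
  cases x with
  | none => rw [betaVal, leftAct_gen, leftOp_e0]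
  | some h =>
    rw [betaVal, map_neg, map_mul, map_mul, leftAct_gen, leftAct_gen, leftAct_gen]
    show -(tAut h (-Series.var (some 1) * tAut h⁻¹ (F (h⁻¹⁻¹ * (h⁻¹ * g))))) = _
    rw [map_mul, ← tAut_mul, mul_inv_cancel, tAut_one, inv_inv, mul_inv_cancel_left, map_neg,
      tAut_var, Option.map_some, mul_one, neg_mul, neg_neg]

theorem leftAct_prod_betaVal (w : List (XX G)) (F : Fam k G) (g : G) :
    leftAct k G (w.map betaVal).prod F g = Series.mono k w * F g := by
  induction w with
  | nil => simp
  | cons a w ih =>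
    rw [List.map_cons, List.prod_cons, map_mul, Module.End.mul_apply, leftAct_betaVal, ih,
      Series.mono_cons, mul_assoc]

theorem beta_mono (w : List (XX G)) :
    beta k G (Series.mono k w) = VHat.of k G (w.map betaVal).prod := by
  rw [Series.mono, map_list_prod, map_list_prod, List.map_map, List.map_map]
  congr 2
  funext a
  exact beta_var a

/-- The element `β(f)` has the single nonzero coordinate `f`, at `g = 1`. In particular `β` is
injective. -/
theorem coords_beta (f : KX k G) (g : G) : coords k G (beta k G f) g = f * famOne k G g := by
  refine Series.eq_of_sub_mem_fil fun n => ?_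
  have h1 := Series.sub_sum_mono_mem f n
  have h2 := coords_mem_fil n _ (beta_mem_fil n _ h1) g
  have h3 := Ideal.mul_mem_right (famOne k G g) _ h1
  have h4 := Submodule.sub_mem _ h2 h3
  rw [map_sub, map_sub, Pi.sub_apply, sub_mul, map_sum, map_sum, Finset.sum_apply,
    Finset.sum_mul] at h4
  simp only [map_smul, beta_mono, coords_of, Pi.smul_apply, leftAct_prod_betaVal,
    smul_mul_assoc] at h4
  rwa [sub_sub_sub_cancel_right] at h4

variable (k G) in
/-- The map `F ↦ ∑_g β(F_g) g`. -/
noncomputable def assemble : Fam k G →ₗ[k] VHat k G :=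
  ∑ g : G, (LinearMap.mulRight k (gr k g)).comp ((beta k G).toLinearMap.comp (LinearMap.proj g))

theorem assemble_apply (F : Fam k G) :
    assemble k G F = ∑ g : G, beta k G (F g) * gr k g := by
  rw [assemble, LinearMap.sum_apply]
  rfl

theorem assemble_mem_fil (n : ℕ) (F : Fam k G) (hF : ∀ g, F g ∈ filR (KX k G) n) :
    assemble k G F ∈ filR (VHat k G) n := by
  rw [assemble_apply]
  exact Submodule.sum_mem _ fun g _ => Ideal.mul_mem_right _ _ (beta_mem_fil n _ (hF g))

theorem assemble_famOne : assemble k G (famOne k G) = 1 := by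
  rw [assemble_apply, Finset.sum_eq_single 1]
  · rw [famOne_one, map_one, gr_one, one_mul]
  · intro g _ hg
    rw [famOne_ne hg, map_zero, zero_mul]
  · intro h
    exact absurd (Finset.mem_univ _) h

theorem assemble_leftOp (a : VGen G) (F : Fam k G) :
    assemble k G (leftOp a F) = VHat.gen k a * assemble k G F := by
  rw [assemble_apply, assemble_apply, Finset.mul_sum]
  cases a with
  | e0 =>
    refine Finset.sum_congr rfl fun g _ => ?_
    rw [leftOp_e0, map_mul, beta_x0, mul_assoc]
    rfl
  | e1 =>
    refine Finset.sum_congr rfl fun g _ => ?_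
    rw [leftOp_e1, map_mul, map_neg, beta_xg, neg_neg, inv_one, gr_one, one_mul, mul_one, mul_assoc]
    rfl
  | grp h =>
    -- Left multiplication by `h` permutes the summands: the term at `g` is sent to the term at
    -- `hg`.
    refine (Fintype.sum_equiv (Equiv.mulLeft h) _ _ fun g => ?_).symm
    rw [Equiv.coe_mulLeft, leftOp_grp, inv_mul_cancel_left, ← gr_mul, ← mul_assoc, ← mul_assoc,
      beta_tAut]
    rfl

theorem assemble_leftAct (x : VG k G) :
    ∀ F : Fam k G, assemble k G (leftAct k G x F) = VHat.of k G x * assemble k G F := by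
  induction x using VG.induction with
  | hc c =>
    intro F
    rw [AlgHom.commutes, AlgHom.commutes, Module.algebraMap_end_apply, map_smul, Algebra.smul_def]
  | hg a => intro F; rw [leftAct_gen, assemble_leftOp]; rfl
  | hm x y hx hy => intro F; rw [map_mul, map_mul, Module.End.mul_apply, hx, hy, mul_assoc]
  | ha x y hx hy => intro F; rw [map_add, map_add, LinearMap.add_apply, map_add, hx, hy, add_mul]

/-- `assemble` is equivariant for left multiplication and takes the unit family to `1`, so the
composite is the identity on `VG`, hence everywhere by density. -/
theorem assemble_coords (t : VHat k G) : assemble k G (coords k G t) = t := by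
  refine VHat.eq_of_sub_mem_fil fun n => ?_
  obtain ⟨x, hx⟩ := VHat.exists_of t n
  have h1 := assemble_mem_fil n _ (coords_mem_fil n _ hx)
  rw [map_sub, map_sub, coords_of, assemble_leftAct, assemble_famOne, mul_one] at h1
  have h2 := Submodule.sub_mem _ h1 hx
  rwa [sub_sub_sub_cancel_right] at h2

end coords

/-! ### The isomorphism of `k⟨⟨X⟩⟩ / k⟨⟨X⟩⟩ x₀` with `M̂_G` -/

section moduleIso

variable (k G) in
/-- The sum of the coordinates of an element of `V̂_G`. -/
noncomputable def sumCoords : VHat k G →ₗ[k] KX k G :=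
  ∑ g : G, (LinearMap.proj g).comp (coords k G)

theorem sumCoords_apply (t : VHat k G) : sumCoords k G t = ∑ g : G, coords k G t g := by
  rw [sumCoords, LinearMap.sum_apply]
  rfl

theorem sumCoords_mem_fil (n : ℕ) (t : VHat k G) (ht : t ∈ filR (VHat k G) n) :
    sumCoords k G t ∈ filR (KX k G) n := by
  rw [sumCoords_apply]
  exact Submodule.sum_mem _ fun g _ => coords_mem_fil n t ht g

theorem sumCoords_mul_e0 (t : VHat k G) :
    sumCoords k G (t * e0 k G) = sumCoords k G t * Series.var none := by
  rw [sumCoords_apply, sumCoords_apply, Finset.sum_mul]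
  refine Finset.sum_congr rfl fun g _ => ?_
  rw [e0, coords_mul_gen, rightOp_e0]

/-- Right multiplication by `h` only permutes the coordinates, so their sum is blind to it. This is
why the sum is the right map out of `M̂_G`. -/
theorem sumCoords_mul_gr (t : VHat k G) (h : G) :
    sumCoords k G (t * gr k h) = sumCoords k G t := by
  rw [sumCoords_apply, sumCoords_apply]
  refine Fintype.sum_equiv (Equiv.mulRight h⁻¹) _ _ fun g => ?_
  rw [gr, coords_mul_gen, rightOp_grp, Equiv.coe_mulRight]

theorem sumCoords_beta (f : KX k G) : sumCoords k G (beta k G f) = f := by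
  rw [sumCoords_apply, Finset.sum_eq_single 1]
  · rw [coords_beta, famOne_one, mul_one]
  · intro g _ hg
    rw [coords_beta, famOne_ne hg, mul_zero]
  · intro h
    exact absurd (Finset.mem_univ _) h

theorem sumCoords_mem_ideal (t : VHat k G) (ht : t ∈ idealM k G) :
    sumCoords k G t ∈ idealX k G := by
  -- All left multiples are treated at once, so that the induction passes through scalar
  -- multiplication in the span without any formula for `sumCoords` under left multiplication.
  have key : ∀ c : VHat k G, sumCoords k G (c * t) ∈ idealX k G := by
    refine Submodule.span_induction
      (p := fun x _ => ∀ c : VHat k G, sumCoords k G (c * x) ∈ idealX k G) ?_ ?_ ?_ ?_ ht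
    · rintro x (rfl | ⟨g, _, rfl⟩) c
      · rw [sumCoords_mul_e0]
        exact Ideal.mul_mem_left _ _ (Ideal.subset_span rfl)
      · rw [mul_sub, map_sub, sumCoords_mul_gr, mul_one, sub_self]
        exact Submodule.zero_mem _
    · intro c
      rw [mul_zero, map_zero]
      exact Submodule.zero_mem _
    · intro x y _ _ hx hy c
      rw [mul_add, map_add]
      exact Submodule.add_mem _ (hx c) (hy c)
    · intro a x _ hx c
      rw [smul_eq_mul, ← mul_assoc]
      exact hx _
  simpa using key 1

theorem beta_mem_ideal (f : KX k G) (hf : f ∈ idealX k G) : beta k G f ∈ idealM k G := by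
  obtain ⟨a, rfl⟩ := Ideal.mem_span_singleton'.1 hf
  rw [map_mul, beta_x0]
  exact Ideal.mul_mem_left _ _ (Ideal.subset_span (Or.inl rfl))

theorem mul_gr_sub_mem (t : VHat k G) (g : G) : t * gr k g - t ∈ idealM k G := by
  by_cases hg : g = 1
  · rw [hg, gr_one, mul_one, sub_self]
    exact Submodule.zero_mem _
  · rw [← mul_sub_one]
    exact Ideal.mul_mem_left _ _ (Ideal.subset_span (Or.inr ⟨g, hg, rfl⟩))

/-- Write `t = ∑ β(F_g) g`; modulo the left ideal each `g` on the right becomes `1`, leaving `∑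
β(F_g)`. -/
theorem beta_sumCoords_sub_mem (t : VHat k G) :
    beta k G (sumCoords k G t) - t ∈ idealM k G := by
  have h : t - beta k G (sumCoords k G t) ∈ idealM k G := by
    nth_rewrite 1 [← assemble_coords t]
    rw [assemble_apply, sumCoords_apply, map_sum, ← Finset.sum_sub_distrib]
    exact Submodule.sum_mem _ fun g _ => mul_gr_sub_mem _ g
  rw [← neg_sub]
  exact Submodule.neg_mem _ h

theorem qBarInv_qBar (r : RX k G) : qBarInv k G (qBar k G r) = r := by
  obtain ⟨f, rfl⟩ := Submodule.Quotient.mk_surjective _ r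
  exact congrArg _ ((qX k G).symm_apply_apply f)

theorem qBar_qBarInv (r : RX k G) : qBar k G (qBarInv k G r) = r := by
  obtain ⟨f, rfl⟩ := Submodule.Quotient.mk_surjective _ r
  exact congrArg _ ((qX k G).apply_symm_apply f)

variable (k G) in
/-- The isomorphism `k⟨⟨X⟩⟩ / k⟨⟨X⟩⟩ x₀ → M̂_G` which takes `qBar (class of f)` to
`β(f) · 1_M`. -/
noncomputable def kappa : RX k G ≃ₗ[k] MHat k G :=
  LinearEquiv.ofLinearMap
    ((quotMap (idealX k G) (idealM k G) (beta k G).toLinearMap beta_mem_ideal).comp (qBarInv k G))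
    ((qBar k G).comp (quotMap (idealM k G) (idealX k G) (sumCoords k G) sumCoords_mem_ideal))
    (by
      refine LinearMap.ext fun m => ?_
      obtain ⟨t, rfl⟩ := Submodule.Quotient.mk_surjective _ m
      rw [LinearMap.comp_apply, LinearMap.comp_apply, LinearMap.comp_apply, qBarInv_qBar]
      exact (Submodule.Quotient.eq _).2 (beta_sumCoords_sub_mem t))
    (by
      refine LinearMap.ext fun r => ?_
      obtain ⟨r, rfl⟩ : ∃ s, qBar k G s = r := ⟨_, qBar_qBarInv r⟩
      rw [LinearMap.comp_apply, LinearMap.comp_apply, LinearMap.comp_apply, qBarInv_qBar]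
      obtain ⟨f, rfl⟩ := Submodule.Quotient.mk_surjective _ r
      exact congrArg (fun x => qBar k G (Submodule.Quotient.mk x)) (sumCoords_beta f))

theorem kappa_apply (r : RX k G) : kappa k G r =
    quotMap (idealX k G) (idealM k G) (beta k G).toLinearMap beta_mem_ideal (qBarInv k G r) := rfl

theorem kappa_mk (f : KX k G) : kappa k G (Submodule.Quotient.mk f) =
    Submodule.Quotient.mk (beta k G ((qX k G).symm f)) := rfl

theorem kappa_qBar_mk (f : KX k G) : kappa k G (qBar k G (Submodule.Quotient.mk f)) =
    Submodule.Quotient.mk (beta k G f) := by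
  rw [kappa_apply, qBarInv_qBar]
  rfl

theorem kappa_mem_fil (n : ℕ) (r : RX k G) (hr : r ∈ filM k (RX k G) n) :
    kappa k G r ∈ filM k (MHat k G) n :=
  quotMap_mem_fil _ _ _ _ beta_mem_fil n _ (quotMap_mem_fil _ _ _ _ qX_symm_mem_fil n r hr)

theorem kappa_symm_mem_fil (n : ℕ) (m : MHat k G) (hm : m ∈ filM k (MHat k G) n) :
    (kappa k G).symm m ∈ filM k (RX k G) n :=
  quotMap_mem_fil _ _ _ _ qX_mem_fil n _ (quotMap_mem_fil _ _ _ _ sumCoords_mem_fil n m hm)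

end moduleIso

/-! ### Compatibility of the two actions -/

section actions

theorem autV0_gr (Ψ : (KX k G)ˣ) (g : G) : autV0 Ψ (gr k g) = gr k g := autV0_gen Ψ (VGen.grp g)

/-- Both sides are continuous morphisms, so letters suffice. For `x_g`, the value is `-g β(Ψ⁻¹) e₁
β(Ψ) g⁻¹`; moving `g` and `g⁻¹` inwards by `beta_tAut` turns `Ψ` into `t_g(Ψ)` on both sides of `g
e₁ g⁻¹`. -/
theorem autV0_beta (Ψ : (KX k G)ˣ) (f : KX k G) :
    autV0 Ψ (beta k G f) = beta k G (autX Ψ f) := by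
  refine algHom_VHat_ext (L := (autV0 Ψ).comp (beta k G)) (L' := (beta k G).comp (autX Ψ))
    (fun n f hf => extVG_mem _ _ n _ (beta_mem_fil n f hf))
    (fun n f hf => beta_mem_fil n _ (Series.substLin_mem_fil (autXVal Ψ) hf)) (fun x => ?_) f
  rw [AlgHom.comp_apply, AlgHom.comp_apply, autX, Series.substHom_var]
  cases x with
  | none =>
    rw [autXVal, beta_x0]
    exact autV0_gen Ψ VGen.e0
  | some g =>
    have h1 := beta_tAut g (Ψ : KX k G)
    have h2 := beta_tAut g ((Ψ⁻¹ : (KX k G)ˣ) : KX k G)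
    have h3 : beta k G (tAut g (Ψ : KX k G)) = gr k g * beta k G (Ψ : KX k G) * gr k g⁻¹ := by
      rw [← h1, mul_assoc, gr_mul_inv, mul_one]
    rw [autXVal, beta_xg, map_mul, map_mul, beta_xg, map_neg, map_mul, map_mul, autV0_gr,
      autV0_gr, e1, autV0_gen, autVVal, h3]
    simp only [mul_neg, neg_mul, ← mul_assoc, neg_inj]
    rw [h2, mul_assoc _ (gr k g⁻¹) (gr k g), gr_inv_mul, mul_one]
    rfl

theorem autV10_beta (Ψ : (KX k G)ˣ) (f : KX k G) :
    autV10 Ψ (beta k G f) = beta k G (SX Ψ f) := by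
  show beta k G (Ψ : KX k G) * autV0 Ψ (beta k G f) = beta k G ((Ψ : KX k G) * autX Ψ f)
  rw [map_mul, autV0_beta]

/-- On `qBar` of the class of `f`, both sides are the class of `β(S_Ψ f)`: the twist in `S_Ψ^Y` and
the one in `kappa` cancel. -/
theorem kappa_SY (Ψ : (KX k G)ˣ) (r : RX k G) : kappa k G (SY Ψ r) = autM10 Ψ (kappa k G r) := by
  obtain ⟨r, rfl⟩ : ∃ s, qBar k G s = r := ⟨_, qBar_qBarInv r⟩
  obtain ⟨f, rfl⟩ := Submodule.Quotient.mk_surjective _ r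
  rw [SY_qBar, kappa_qBar_mk, kappa_qBar_mk, ← autV10_beta]
  rfl

theorem evalX1_var : Series.substHom (fun _ : Unit => (Series.var (some 1) : KX k G))
    (fun _ => Series.var_mem_fil (some 1 : XX G)) (Series.var ()) = Series.var (some 1) :=
  Series.substHom_var _ _ _

variable (k G) in
/-- The morphism `F ↦ F(-e₁)`. -/
noncomputable def evalNegE1Hom : Series k Unit →ₐ[k] VHat k G :=
  Series.evalLim (modFil k (VG k G)) (fun _ : Unit => -VG.gen k VGen.e1)
    (fun n => ⟨n, Series.modFil_prod_eq_zero (α := Unit) (fun _ => -VG.gen k (VGen.e1 : VGen G))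
      (fun _ => neg_e1_mem) n⟩)

theorem evalNegE1Hom_mem_fil (n : ℕ) (f : Series k Unit) (hf : f ∈ filR (Series k Unit) n) :
    evalNegE1Hom k G f ∈ filR (VHat k G) n :=
  Series.evalLim_eq_zero (modFil k (VG k G)) _ _ (Series.modFil_prod_eq_zero (α := Unit)
    (fun _ => -VG.gen k (VGen.e1 : VGen G)) (fun _ => neg_e1_mem) n) hf

theorem evalNegE1Hom_var (x : Unit) : evalNegE1Hom k G (Series.var x) = -e1 k G := by
  have h : evalNegE1Hom k G (Series.var x) = VHat.of k G (-VG.gen k VGen.e1) :=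
    Series.evalLim_var _ _ _ x
  rw [h, map_neg]
  rfl

theorem beta_evalX1 (F : PowerSeries k) : beta k G (evalX1 F) = evalNegE1 G F := by
  refine algHom_VHat_ext
    (L := (beta k G).comp (Series.substHom (fun _ : Unit => (Series.var (some 1) : KX k G))
      (fun _ => Series.var_mem_fil (some 1 : XX G))))
    (L' := evalNegE1Hom k G)
    (fun n f hf => beta_mem_fil n _ (Series.substLin_mem_fil (k := k) _ hf))
    evalNegE1Hom_mem_fil (fun x => ?_) (toSeries F)
  rw [AlgHom.comp_apply, evalX1_var, beta_xg, inv_one, gr_one, one_mul, mul_one, evalNegE1Hom_var]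

/-- A leading `x₁` is fixed by `q` and leaves the running index at `1`, so the rest of the word is
transformed as if it stood alone. A leading `x_g` with `g ≠ 1` would shift the next index. -/
theorem qX_symm_x1_mul (f : KX k G) :
    (qX k G).symm (Series.var (some 1) * f) = Series.var (some 1) * (qX k G).symm f := by
  classical
  refine Series.ext fun w => ?_
  have h : ∀ (f : KX k G) (v : List (XX G)), (Series.var (some 1) * f : KX k G) v =
      if [some 1] <+: v then f (v.drop 1) else 0 := fun f v => by
    have := Series.monomial_mul [some 1] f v
    rwa [List.map_singleton, List.prod_singleton] at this
  show (Series.var (some 1) * f : KX k G) (qWord 1 w) = _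
  rw [h, h]
  cases w with
  | nil => rfl
  | cons a w =>
    cases a with
    | none => simp [qWord]
    | some g =>
      by_cases hg : g = 1
      · subst hg
        simp only [qWord, List.drop_succ_cons, List.drop_zero, inv_one, mul_one,
          List.cons_prefix_cons, List.nil_prefix, and_self, if_true]
        rfl
      · have hg' : ¬ 1 = g := fun h => hg h.symm
        simp [qWord, hg']

/-- Both sides are linear and filtered in the one-variable series, so it is enough to pull out
factors `x₁` one at a time. -/
theorem qX_symm_evalX1_mul (F : PowerSeries k) (f : KX k G) :
    (qX k G).symm (evalX1 F * f) = evalX1 F * (qX k G).symm f := by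
  refine Series.eq_of_sub_mem_fil fun n => ?_
  let ev := Series.substHom (fun _ : Unit => (Series.var (some 1) : KX k G))
      (fun _ => Series.var_mem_fil (some 1 : XX G))
  let L : Series k Unit →ₗ[k] KX k G := (qX k G).symm.toLinearMap.comp
    ((LinearMap.mulRight k f).comp ev.toLinearMap)
  let L' : Series k Unit →ₗ[k] KX k G :=
    (LinearMap.mulRight k ((qX k G).symm f)).comp ev.toLinearMap
  have hev : ∀ h ∈ filR (Series k Unit) n, ev h ∈ filR (KX k G) n :=
    fun h hh => Series.substLin_mem_fil (k := k) _ hh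
  have h : (modFil k (KX k G) n).toLinearMap.comp L = (modFil k (KX k G) n).toLinearMap.comp L' := by
    refine Series.linearMap_eq_of_mono n (fun h hh => ?_) fun w => ?_
    · have h1 : modFil k (KX k G) n (L h) = 0 := Series.modFil_eq_zero.2
        (qX_symm_mem_fil n _ (Ideal.mul_mem_right _ _ (hev h hh)))
      have h2 : modFil k (KX k G) n (L' h) = 0 := Series.modFil_eq_zero.2
        (Ideal.mul_mem_right _ _ (hev h hh))
      exact h1.trans h2.symm
    · refine congrArg (modFil k (KX k G) n) ?_
      show (qX k G).symm (ev (Series.mono k w) * f) = ev (Series.mono k w) * (qX k G).symm f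
      induction w with
      | nil => rw [Series.mono_nil, map_one, one_mul, one_mul]
      | cons a w ih =>
        rw [Series.mono_cons, map_mul ev, show ev (Series.var a) = Series.var (some 1) from evalX1_var,
          mul_assoc, qX_symm_x1_mul, ih, mul_assoc]
  have h1 := LinearMap.congr_fun h (toSeries F)
  exact Series.modFil_eq_zero.1 (show modFil k (KX k G) n (L (toSeries F) - L' (toSeries F)) = 0 by
    rw [map_sub, sub_eq_zero]; exact h1)

theorem kappa_lmul (F : PowerSeries k) (r : RX k G) :
    kappa k G (lmul k (idealX k G) (evalX1 F) r) =
      lmul k (idealM k G) (evalNegE1 G F) (kappa k G r) := by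
  obtain ⟨f, rfl⟩ := Submodule.Quotient.mk_surjective _ r
  show kappa k G (Submodule.Quotient.mk (evalX1 F * f)) =
    Submodule.Quotient.mk (evalNegE1 G F * beta k G ((qX k G).symm f))
  rw [kappa_mk, qX_symm_evalX1_mul, map_mul, beta_evalX1]

/-- Equivariance of `kappa` for the `Γ`-twisted actions, which is all that the comparison of
stabilizers needs to know about the operators. -/
theorem kappa_gammaSY [Algebra ℚ k] (Ψ : (KX k G)ˣ) (r : RX k G) :
    kappa k G (gammaSY Ψ r) = gammaAutM Ψ (kappa k G r) := by
  rw [gammaSY, gammaAutM, LinearMap.comp_apply, LinearMap.comp_apply, kappa_lmul, kappa_SY]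

end actions

/-! ### The subalgebra `Ŵ_G` in coordinates -/

section WHat

theorem coords_one : coords k G 1 = famOne k G := by
  rw [← map_one (VHat.of k G), coords_of, map_one, Module.End.one_apply]

/-- Right multiplication by `e₁` appends `-x_g` to the coordinate at `g`. So in `Ŵ_G` the last
letter of a nonempty word tells which coordinate it belongs to. -/
theorem coords_add_mul_e1 (c : k) (v : VHat k G) (g : G) :
    coords k G (algebraMap k _ c + v * e1 k G) g =
      c • famOne k G g - coords k G v g * Series.var (some g) := by
  rw [map_add, Algebra.algebraMap_eq_smul_one, map_smul, coords_one, e1, coords_mul_gen,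
    Pi.add_apply, rightOp_e1, mul_neg, Pi.smul_apply, sub_eq_add_neg]

theorem famOne_append (g : G) (v : List (XX G)) (b : XX G) : famOne k G g (v ++ [b]) = 0 := by
  by_cases h : g = 1
  · rw [h, famOne_one]
    cases v <;> rfl
  · rw [famOne_ne h]
    rfl

theorem famOne_nil_ne {g : G} (h : g ≠ 1) : famOne k G g [] = 0 := by
  rw [famOne_ne h]
  rfl

theorem famOne_nil_one : famOne k G 1 [] = 1 := by
  rw [famOne_one]
  rfl

theorem coords_W_nil (c : k) (v : VHat k G) (g : G) :
    coords k G (algebraMap k _ c + v * e1 k G) g [] = c * famOne k G g [] := by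
  rw [coords_add_mul_e1, Series.sub_apply, Series.mul_var_nil, sub_zero, Series.smul_apply]

theorem coords_W_append (c : k) (v : VHat k G) (g : G) (u : List (XX G)) (b : XX G)
    [Decidable (b = some g)] :
    coords k G (algebraMap k _ c + v * e1 k G) g (u ++ [b]) =
      -if b = some g then coords k G v g u else 0 := by
  rw [coords_add_mul_e1, Series.sub_apply, Series.mul_var_append, Series.smul_apply,
    famOne_append, mul_zero, zero_sub]

/-- Description of `Ŵ_G` by the vanishing of certain coefficients. -/
theorem mem_WHat_iff (t : VHat k G) : t ∈ WHat k G ↔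
    (∀ g, g ≠ 1 → coords k G t g [] = 0) ∧
      ∀ g v b, b ≠ some g → coords k G t g (v ++ [b]) = 0 := by
  classical
  constructor
  · rintro ⟨c, v, rfl⟩
    exact ⟨fun g hg => by rw [coords_W_nil, famOne_nil_ne hg, mul_zero],
      fun g u b hb => by rw [coords_W_append, if_neg hb, neg_zero]⟩
  · rintro ⟨h1, h2⟩
    have h3 : ∀ g, ∃ h : KX k G,
        h * Series.var (some g) = coords k G t g - coords k G t 1 [] • famOne k G g := by
      intro g
      refine Series.eq_mul_var _ _ ?_ fun v b hb => ?_
      · rw [Series.sub_apply, Series.smul_apply]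
        by_cases hg : g = 1
        · rw [hg, famOne_nil_one, mul_one, sub_self]
        · rw [h1 g hg, famOne_nil_ne hg, mul_zero, sub_self]
      · rw [Series.sub_apply, Series.smul_apply, h2 g v b hb, famOne_append, mul_zero, sub_self]
    choose h hh using h3
    -- The sign comes from `β(x_g) g = -g e₁`: the part `∑ β(h_g x_g) g` equals `-(∑ β(h_g) g) e₁`.
    refine ⟨coords k G t 1 [], -∑ g : G, beta k G (h g) * gr k g, ?_⟩
    have h4 : coords k G t = coords k G t 1 [] • famOne k G +
        fun g => h g * Series.var (some g) := by
      funext g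
      rw [Pi.add_apply, Pi.smul_apply, hh, add_sub_cancel]
    generalize coords k G t 1 [] = c at h4
    rw [← assemble_coords t, h4, map_add, map_smul, assemble_famOne,
      Algebra.algebraMap_eq_smul_one, assemble_apply, neg_mul, Finset.sum_mul,
      ← Finset.sum_neg_distrib]
    congr 1
    refine Finset.sum_congr rfl fun g _ => ?_
    rw [map_mul, beta_xg, mul_neg, neg_mul, ← mul_assoc, ← mul_assoc, mul_assoc _ _ (gr k g),
      gr_inv_mul, mul_one]

/-- `Ŵ_G` is closed: each condition in `mem_WHat_iff` concerns a single coefficient, and an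
approximation to high enough degree has the same one. -/
theorem mem_WHat_of_approx (t : VHat k G)
    (h : ∀ n, ∃ w ∈ WHat k G, t - w ∈ filR (VHat k G) n) : t ∈ WHat k G := by
  have key : ∀ (g : G) (v : List (XX G)), ∃ w ∈ WHat k G, coords k G t g v = coords k G w g v := by
    intro g v
    obtain ⟨w, hw, h1⟩ := h (wordWt v + 1)
    refine ⟨w, hw, ?_⟩
    have h2 := coords_mem_fil _ _ h1 g v (Nat.lt_succ_self _)
    rw [map_sub] at h2
    exact sub_eq_zero.1 h2
  rw [mem_WHat_iff]
  constructor
  · intro g hg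
    obtain ⟨w, hw, e⟩ := key g []
    rw [e]
    exact ((mem_WHat_iff w).1 hw).1 g hg
  · intro g v b hb
    obtain ⟨w, hw, e⟩ := key g (v ++ [b])
    rw [e]
    exact ((mem_WHat_iff w).1 hw).2 g v b hb

/-- If `w · 1_M = 0`, the sum of the coordinates of `w` involves only words ending with `x₀`. But
nonempty words in the coordinate at `g` end with `x_g`, so nothing can cancel between coordinates
and each of them vanishes. -/
theorem toM_injective : Function.Injective (toM k G) := by
  classical
  rw [injective_iff_map_eq_zero]
  rintro ⟨_, c, v, rfl⟩ hw
  have h1 : algebraMap k _ c + v * e1 k G ∈ idealM k G := (Submodule.Quotient.mk_eq_zero _).1 hw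
  have h2 := (Series.mem_span_var (none : XX G) _).1 (sumCoords_mem_ideal _ h1)
  rw [sumCoords_apply] at h2
  have hc : c = 0 := by
    have h3 := h2.1
    rw [Series.sum_apply, Finset.sum_eq_single 1] at h3
    · rwa [coords_W_nil, famOne_nil_one, mul_one] at h3
    · intro g _ hg
      rw [coords_W_nil, famOne_nil_ne hg, mul_zero]
    · intro h
      exact absurd (Finset.mem_univ _) h
  have hv : coords k G v = 0 := by
    funext g
    refine Series.ext fun u => ?_
    -- At the word `u x_g` only the coordinate at `g` contributes to the sum.
    have h3 := h2.2 u (some g) (by simp)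
    rw [Series.sum_apply, Finset.sum_eq_single g] at h3
    · rw [coords_W_append, if_pos rfl, neg_eq_zero] at h3
      exact h3
    · intro g' _ hg
      rw [coords_W_append, if_neg (fun h => hg (Option.some_injective _ h).symm), neg_zero]
    · intro h
      exact absurd (Finset.mem_univ _) h
  have hv' : v = 0 := by rw [← assemble_coords v, hv, map_zero]
  refine Subtype.ext ?_
  show algebraMap k _ c + v * e1 k G = 0
  rw [hc, hv', map_zero, zero_mul, add_zero]

end WHat

/-! ### The isomorphism of `k⟨⟨Y⟩⟩` with `Ŵ_G` -/

section theta

theorem exists_yWord (v : List (XX G)) (g : G) : ∃ u : List (YY G), v ++ [some g] = yWord u := by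
  -- The number `m` counts the letters `x₀` already read and not yet closed by some `x_h`; closing
  -- them gives `y_{m+1,h}`.
  have key : ∀ (v : List (XX G)) (m : ℕ), ∃ u : List (YY G),
      List.replicate m none ++ (v ++ [some g]) = yWord u := by
    intro v
    induction v with
    | nil => exact fun m => ⟨[(m.succPNat, g)], by simp [yWord]⟩
    | cons a v ih =>
      intro m
      cases a with
      | none =>
        obtain ⟨u, hu⟩ := ih (m + 1)
        exact ⟨u, by rw [← hu, List.replicate_succ']; simp⟩
      | some h =>
        obtain ⟨u, hu⟩ := ih 0
        refine ⟨(m.succPNat, h) :: u, ?_⟩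
        rw [yWord_cons, ← hu]
        simp
  exact key v 0

/-- The two representatives agree on the empty word and on all words not ending with `x₀`, since
those are the words in `Y`. Their difference is therefore a left multiple of `x₀`. -/
theorem piY_secY (r : RX k G) : piY k G (secY r) = r := by
  obtain ⟨f, rfl⟩ := Submodule.Quotient.mk_surjective _ r
  refine (Submodule.Quotient.eq _).2 ((Series.mem_span_var (none : XX G) _).2 ?_)
  have h : ∀ u : List (YY G), (iotaY k G (secY (Submodule.Quotient.mk f)) - f : KX k G) (yWord u) = 0 :=
    fun u => by
      rw [Series.sub_apply, iotaY_apply, sub_eq_zero]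
      rfl
  refine ⟨h [], fun v b hb => ?_⟩
  obtain ⟨g, rfl⟩ := Option.ne_none_iff_exists'.1 hb
  obtain ⟨u, hu⟩ := exists_yWord v g
  rw [hu]
  exact h u

theorem secY_mem_fil (n : ℕ) (r : RX k G) (hr : r ∈ filM k (RX k G) n) :
    secY r ∈ filR (KY k G) n := by
  obtain ⟨f, hf, rfl⟩ := hr
  intro u hu
  exact hf (yWord u) (by rwa [wordWt_yWord])

/-- The element `-e₀^{n-1} g e₁` of `VG`. -/
noncomputable def zVG (a : YY G) : VG k G :=
  -(VG.gen k VGen.e0 ^ ((a.1 : ℕ) - 1) * VG.gen k (VGen.grp a.2) * VG.gen k VGen.e1)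

theorem zVG_mem (a : YY G) : zVG (k := k) a ∈ filR (VG k G) (Weighted.wt a) := by
  have h := FilteredRing.fil_mul (Ideal.mul_mem_right (VG.gen k (VGen.grp a.2)) _
    (pow_mem_fil (VG.gen_mem (k := k) (VGen.e0 : VGen G)) ((a.1 : ℕ) - 1)))
    (VG.gen_mem (k := k) (VGen.e1 : VGen G))
  have h2 : (a.1 : ℕ) - 1 + (VGen.e1 : VGen G).deg = Weighted.wt a := Nat.sub_add_cancel a.1.pos
  rw [h2] at h
  exact (Ideal.neg_mem_iff _).2 h

theorem of_zVG (a : YY G) : VHat.of k G (zVG a) = zW k a.1 a.2 := by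
  rw [zVG, map_neg, map_mul, map_mul, map_pow]
  rfl

variable (k G) in
/-- The continuous algebra morphism `k⟨⟨Y⟩⟩ → V̂_G` with `y_{n,g} ↦ z_{n,g}`. -/
noncomputable def thetaV : KY k G →ₐ[k] VHat k G :=
  Series.evalLim (modFil k (VG k G)) zVG fun n => ⟨n, Series.modFil_prod_eq_zero zVG zVG_mem n⟩

theorem thetaV_var (a : YY G) : thetaV k G (Series.var a) = zW k a.1 a.2 := by
  have h : thetaV k G (Series.var a) = VHat.of k G (zVG a) := Series.evalLim_var _ _ _ a
  rw [h, of_zVG]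

theorem thetaV_mem_fil (n : ℕ) (f : KY k G) (hf : f ∈ filR (KY k G) n) :
    thetaV k G f ∈ filR (VHat k G) n :=
  Series.evalLim_eq_zero (modFil k (VG k G)) zVG _
    (Series.modFil_prod_eq_zero zVG zVG_mem n) hf

theorem thetaV_mono_mem (u : List (YY G)) : thetaV k G (Series.mono k u) ∈ WHat k G := by
  induction u with
  | nil => rw [Series.mono_nil, map_one]; exact one_mem _
  | cons a u ih =>
    rw [Series.mono_cons, map_mul, thetaV_var]
    exact mul_mem (zW k a.1 a.2).2 ih

/-- Polynomials in the `z_{n,g}` lie in `Ŵ_G`, and `Ŵ_G` is closed. -/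
theorem thetaV_mem (f : KY k G) : thetaV k G f ∈ WHat k G := by
  refine mem_WHat_of_approx _ fun n => ?_
  have h1 := thetaV_mem_fil n _ (Series.sub_sum_mono_mem f n)
  rw [map_sub] at h1
  refine ⟨_, ?_, h1⟩
  rw [map_sum]
  refine sum_mem fun w _ => ?_
  rw [map_smul]
  exact Subalgebra.smul_mem _ (thetaV_mono_mem w) _

variable (k G) in
/-- The morphism `k⟨⟨Y⟩⟩ → Ŵ_G` with `y_{n,g} ↦ z_{n,g}`. -/
noncomputable def theta : KY k G →ₐ[k] WHat k G := (thetaV k G).codRestrict (WHat k G) thetaV_mem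

theorem theta_var (a : YY G) : theta k G (Series.var a) = zW k a.1 a.2 :=
  Subtype.ext (thetaV_var a)

theorem theta_mem_fil (n : ℕ) (f : KY k G) (hf : f ∈ filR (KY k G) n) :
    theta k G f ∈ filR (WHat k G) n :=
  thetaV_mem_fil n f hf

theorem iotaY_mono (u : List (YY G)) : iotaY k G (Series.mono k u) = Series.mono k (yWord u) := by
  induction u with
  | nil => exact map_one _
  | cons a u ih =>
    rw [Series.mono_cons, map_mul, ih, yWord_cons, Series.mono_append, Series.mono_cons,
      Series.mono_replicate, ← mul_assoc]
    exact congrArg (· * _) (Series.substHom_var _ _ a)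

theorem qX_symm_mono (w : List (XX G)) :
    (qX k G).symm (Series.mono k w) = Series.mono k (qWordInv 1 w) := by
  classical
  refine Series.ext fun v => ?_
  show Series.mono k w (qWord 1 v) = _
  rw [Series.mono_apply, Series.mono_apply]
  refine if_congr ⟨?_, ?_⟩ rfl rfl
  · rintro rfl
    exact qWordInv_qWord 1 v
  · rintro rfl
    exact (qWord_qWordInv 1 w).symm

theorem qWordInv_replicate_append (p : G) (m : ℕ) (w : List (XX G)) :
    qWordInv p (List.replicate m none ++ w) = List.replicate m none ++ qWordInv p w := by
  induction m with
  | zero => rfl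
  | succ m ih => rw [List.replicate_succ, List.cons_append, qWordInv, ih]; rfl

/-- The computation that explains `q`. One has `p z_{n,g} = e₀^{n-1} (-(gp) e₁ (gp)⁻¹) gp`, that is,
`β(x₀^{n-1} x_{gp})` followed by the new group element `gp`. The group element travelling to the
right is the running index of `qWordInv`, and the last one is absorbed by `1_M`. -/
theorem gr_thetaV_mono_sub_mem (u : List (YY G)) : ∀ p : G,
    gr k p * thetaV k G (Series.mono k u) - beta k G (Series.mono k (qWordInv p (yWord u))) ∈
      idealM k G := by
  induction u with
  | nil =>
    intro p
    rw [Series.mono_nil, map_one, mul_one]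
    show gr k p - beta k G 1 ∈ _
    rw [map_one]
    simpa using mul_gr_sub_mem (1 : VHat k G) p
  | cons a u ih =>
    intro p
    rw [Series.mono_cons, map_mul, thetaV_var, yWord_cons, qWordInv_replicate_append, qWordInv,
      Series.mono_append, Series.mono_replicate, Series.mono_cons, map_mul, map_mul, map_pow,
      beta_x0, beta_xg]
    -- The factor is `β(x₀^{n-1} x_{gp})`; left multiplication by it preserves the left ideal.
    have h := Ideal.mul_mem_left _ (e0 k G ^ ((a.1 : ℕ) - 1) *
      -(gr k (a.2 * p) * e1 k G * gr k (a.2 * p)⁻¹)) (ih (a.2 * p))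
    have e : gr k p * ((zW k a.1 a.2 : VHat k G) * thetaV k G (Series.mono k u)) =
        e0 k G ^ ((a.1 : ℕ) - 1) * -(gr k (a.2 * p) * e1 k G * gr k (a.2 * p)⁻¹) *
          (gr k (a.2 * p) * thetaV k G (Series.mono k u)) := by
      show gr k p * (-(e0 k G ^ ((a.1 : ℕ) - 1) * gr k a.2 * e1 k G) * _) = _
      -- Commutativity of `G` enters: the product produces `pg` where `qWordInv` has `gp`.
      rw [mul_comm a.2 p]
      simp only [mul_neg, neg_mul, neg_inj]
      rw [mul_assoc _ _ (gr k (p * a.2) * _), mul_assoc _ (gr k (p * a.2)⁻¹),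
        ← mul_assoc (gr k (p * a.2)⁻¹), gr_inv_mul, one_mul, ← gr_mul]
      simp only [← mul_assoc]
      rw [gr_e0_pow]
    rw [mul_sub, ← e, mul_assoc (e0 k G ^ _)] at h
    exact h

theorem piY_apply (f : KY k G) : piY k G f = Submodule.Quotient.mk (iotaY k G f) := rfl

theorem toM_theta (f : KY k G) : toM k G (theta k G f) = Submodule.Quotient.mk (thetaV k G f) := rfl

theorem kappa_piY_mono (u : List (YY G)) :
    kappa k G (piY k G (Series.mono k u)) = toM k G (theta k G (Series.mono k u)) := by
  rw [piY_apply, toM_theta, kappa_mk, iotaY_mono, qX_symm_mono]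
  refine ((Submodule.Quotient.eq _).2 ?_).symm
  have h := gr_thetaV_mono_sub_mem (k := k) u 1
  rwa [gr_one, one_mul] at h

variable (k G) in
/-- The map `Ŵ_G → k⟨⟨Y⟩⟩`, the inverse of `theta`. -/
noncomputable def thetaInv : WHat k G →ₗ[k] KY k G :=
  secY.comp ((kappa k G).symm.toLinearMap.comp (toM k G))

theorem thetaInv_apply (w : WHat k G) :
    thetaInv k G w = secY ((kappa k G).symm (toM k G w)) := rfl

theorem thetaInv_mem_fil (n : ℕ) (w : WHat k G) (hw : w ∈ filR (WHat k G) n) :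
    thetaInv k G w ∈ filR (KY k G) n :=
  secY_mem_fil n _ (kappa_symm_mem_fil n _ (toM_mem_fil n w hw))

theorem thetaInv_theta (f : KY k G) : thetaInv k G (theta k G f) = f := by
  have key : ∀ u : List (YY G),
      thetaInv k G (theta k G (Series.mono k u)) = Series.mono k u := by
    intro u
    rw [thetaInv_apply, ← kappa_piY_mono, LinearEquiv.symm_apply_apply, secY_piY]
  refine Series.eq_of_sub_mem_fil fun n => ?_
  have h1 := Series.sub_sum_mono_mem f n
  have h2 := Submodule.sub_mem _ (thetaInv_mem_fil n _ (theta_mem_fil n _ h1)) h1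
  rw [map_sub, map_sub, map_sum, map_sum] at h2
  simp only [map_smul, key] at h2
  rwa [sub_sub_sub_cancel_right] at h2

/-- The case of monomials is extended by density inside `k⟨⟨Y⟩⟩`, in `thetaInv_theta`, where a
series is determined by its truncations. The identity is then carried to `M̂_G`, so no separation
property of that quotient is needed. -/
theorem kappa_piY (f : KY k G) : kappa k G (piY k G f) = toM k G (theta k G f) := by
  have h : piY k G (thetaInv k G (theta k G f)) = (kappa k G).symm (toM k G (theta k G f)) := by
    rw [thetaInv_apply, piY_secY]
  rw [thetaInv_theta] at h
  rw [h, LinearEquiv.apply_symm_apply]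

/-- After `w ↦ w · 1_M`, which is injective, this is the bijectivity of `kappa` and of `piY`. -/
theorem theta_thetaInv (w : WHat k G) : theta k G (thetaInv k G w) = w := by
  refine toM_injective ?_
  rw [← kappa_piY, thetaInv_apply, piY_secY, LinearEquiv.apply_symm_apply]

theorem toM_surjective (m : MHat k G) : ∃ w, toM k G w = m :=
  ⟨theta k G (secY ((kappa k G).symm m)), by
    rw [← kappa_piY, piY_secY, LinearEquiv.apply_symm_apply]⟩

variable (k G) in
/-- The isomorphism `k⟨⟨Y⟩⟩ ≃ Ŵ_G`, `y_{n,g} ↦ z_{n,g}`. -/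
noncomputable def thetaEquiv : KY k G ≃ₐ[k] WHat k G :=
  AlgEquiv.ofBijective (theta k G)
    ⟨Function.LeftInverse.injective thetaInv_theta,
      Function.RightInverse.surjective theta_thetaInv⟩

theorem thetaEquiv_symm_theta (f : KY k G) : (thetaEquiv k G).symm (theta k G f) = f :=
  (thetaEquiv k G).symm_apply_apply f

theorem thetaEquiv_symm_mem_fil (n : ℕ) (w : WHat k G) (hw : w ∈ filR (WHat k G) n) :
    (thetaEquiv k G).symm w ∈ filR (KY k G) n := by
  obtain ⟨f, rfl⟩ : ∃ f, theta k G f = w := ⟨_, theta_thetaInv w⟩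
  rw [thetaEquiv_symm_theta]
  simpa only [thetaInv_theta] using thetaInv_mem_fil n _ hw

end theta

/-! ### The coproducts and their stabilizers -/

section coproducts

theorem zW_mem_fil (n : ℕ+) (g : G) : zW k n g ∈ filR (WHat k G) n := by
  rw [← theta_var (n, g)]
  exact theta_mem_fil _ _ (Series.var_mem_fil ((n, g) : YY G))

theorem harmonicVal_zW_mem (a : YY G) :
    harmonicVal (zW k) a.1 a.2 ∈ tensorFil k (WHat k G) (Weighted.wt a) :=
  harmonicVal_mem _ zW_mem_fil a.1 a.2

variable (k G) in
/-- The composite of `theta` with the coproduct of `Ŵ_G`. -/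
noncomputable def deltaTheta : KY k G →ₐ[k] CTensorAlg k (WHat k G) :=
  coprodHom (fun a => harmonicVal (zW k) a.1 a.2) harmonicVal_zW_mem

theorem deltaTheta_eq_zero (n : ℕ) (f : KY k G) (hf : f ∈ filR (KY k G) (2 * n)) :
    (deltaTheta k G f).1 n = 0 :=
  coprodHom_eq_zero (fun a : YY G => harmonicVal (zW k) a.1 a.2) harmonicVal_zW_mem n f hf

theorem deltaTheta_var (a : YY G) : deltaTheta k G (Series.var a) =
    toLimAlg (T := WHat k G ⊗[k] WHat k G) (tensorModAlg k (WHat k G))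
      (harmonicVal (zW k) a.1 a.2) :=
  coprodHom_var (fun a : YY G => harmonicVal (zW k) a.1 a.2) harmonicVal_zW_mem a

variable (k G) in
/-- The coproduct `Δ̂^W_G`. -/
noncomputable def deltaW : WHat k G →ₐ[k] CTensorAlg k (WHat k G) :=
  (deltaTheta k G).comp (thetaEquiv k G).symm.toAlgHom

theorem deltaW_theta (f : KY k G) : deltaW k G (theta k G f) = deltaTheta k G f :=
  congrArg (deltaTheta k G) (thetaEquiv_symm_theta f)

theorem isDeltaW_deltaW : IsDeltaW (deltaW k G) := by
  refine ⟨fun n => ⟨2 * n, fun w hw => ?_⟩, fun n g => ?_⟩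
  · exact deltaTheta_eq_zero n _ (thetaEquiv_symm_mem_fil _ w hw)
  · rw [← theta_var (n, g), deltaW_theta, deltaTheta_var]

/-- Through `theta`, these are continuous morphisms from series in the letters `y_{n,g}`. At each
level both kill high degrees, so their values on letters determine them. -/
theorem IsDeltaW.unique {D D' : WHat k G →ₐ[k] CTensorAlg k (WHat k G)} (h : IsDeltaW D)
    (h' : IsDeltaW D') : D' = D := by
  refine AlgHom.ext fun w => ?_
  obtain ⟨f, rfl⟩ : ∃ f, theta k G f = w := ⟨_, theta_thetaInv w⟩
  refine Subtype.ext (funext fun n => ?_)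
  obtain ⟨m, hm⟩ := h.1 n
  obtain ⟨m', hm'⟩ := h'.1 n
  let pr : CTensorAlg k (WHat k G) →ₐ[k]
      (WHat k G ⧸ filR (WHat k G) n) ⊗[k] (WHat k G ⧸ filR (WHat k G) n) :=
    (Pi.evalAlgHom k _ n).comp (Subalgebra.val _)
  have key : (pr.comp D').comp (theta k G) = (pr.comp D).comp (theta k G) := by
    refine Series.algHom_eq_of_var (max m m') (fun f hf => ?_) (fun f hf => ?_) fun a => ?_
    · exact hm' _ (theta_mem_fil _ _ (FilteredRing.fil_anti (le_max_right m m') hf))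
    · exact hm _ (theta_mem_fil _ _ (FilteredRing.fil_anti (le_max_left m m') hf))
    · show (D' (theta k G (Series.var a))).1 n = (D (theta k G (Series.var a))).1 n
      rw [theta_var, h.2, h'.2]
  exact AlgHom.congr_fun key f

variable (k G) in
/-- The coproduct `Δ̂^M_G`. -/
noncomputable def deltaM : MHat k G →ₗ[k] CTensorMod k (MHat k G) :=
  (CTensorMod.map (kappa k G).toLinearMap kappa_mem_fil).comp
    ((deltaMod k G).comp (kappa k G).symm.toLinearMap)

theorem deltaM_kappa (r : RX k G) : deltaM k G (kappa k G r) =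
    CTensorMod.map (kappa k G).toLinearMap kappa_mem_fil (deltaMod k G r) := by
  show CTensorMod.map _ _ (deltaMod k G ((kappa k G).symm (kappa k G r))) = _
  rw [LinearEquiv.symm_apply_apply]

/-- On monomials both coproducts are products of harmonic values, and `theta ⊗ theta` takes those of
the `y_{n,g}` to those of the `z_{n,g}`; continuity does the rest. -/
theorem map_toM_deltaTheta (f : KY k G) :
    CTensorAlg.map (toM k G) toM_mem_fil (deltaTheta k G f) =
      CTensorAlg.map ((toM k G).comp (theta k G).toLinearMap)
        (fun n f hf => toM_mem_fil n _ (theta_mem_fil n f hf)) (deltaAlg k G f) := by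
  refine map_coprodHom_eq _ _ _ _ _ _ _ _ (fun w => ?_) f
  have h : (w.map fun a : YY G => harmonicVal (zW k) a.1 a.2).prod =
      Algebra.TensorProduct.map (theta k G) (theta k G) (w.map fun a : YY G =>
        harmonicVal (fun (n : ℕ+) (g : G) => (Series.var (n, g) : KY k G)) a.1 a.2).prod := by
    rw [map_list_prod, List.map_map]
    congr 2
    funext a
    rw [Function.comp_apply, harmonicVal_map]
    simp only [theta_var]
  rw [h, TensorProduct.map_comp, LinearMap.comp_apply]
  rfl

/-- The identity `kappa_piY` is used twice: on the argument of the coproduct and, in its completed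
square, on the value. -/
theorem deltaM_toM_theta (f : KY k G) : deltaM k G (toM k G (theta k G f)) =
    CTensorAlg.map (toM k G) toM_mem_fil (deltaTheta k G f) := by
  rw [← kappa_piY, deltaM_kappa, deltaMod_piY, map_toM_deltaTheta]
  exact CTensorMod.map_algMap _ _ _ _ _ _ kappa_piY _

theorem isDeltaM_deltaM : IsDeltaM (deltaW k G) (deltaM k G) := by
  refine ⟨fun n => ⟨2 * n, fun x hx => ?_⟩, fun w => ?_⟩
  · have h1 := secY_mem_fil _ _ (kappa_symm_mem_fil _ x hx)
    obtain ⟨w, rfl⟩ := toM_surjective x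
    rw [← thetaInv_apply] at h1
    have h2 := deltaM_toM_theta (thetaInv k G w)
    rw [theta_thetaInv] at h2
    rw [h2]
    exact CTensorAlg.map_eq_zero _ _ _ n (deltaTheta_eq_zero n _ h1)
  · obtain ⟨f, rfl⟩ : ∃ f, theta k G f = w := ⟨_, theta_thetaInv w⟩
    rw [deltaM_toM_theta, deltaW_theta]

theorem IsDeltaM.unique {DW : WHat k G →ₐ[k] CTensorAlg k (WHat k G)}
    {D D' : MHat k G →ₗ[k] CTensorMod k (MHat k G)} (h : IsDeltaM DW D) (h' : IsDeltaM DW D') :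
    D' = D := by
  refine LinearMap.ext fun m => ?_
  obtain ⟨w, rfl⟩ := toM_surjective m
  rw [h.2, h'.2]

/-- Transport of structure: `kappa` carries one coproduct to the other and conjugates the operators,
and the grouplike condition is common to both sides. -/
theorem stabM_deltaM [Algebra ℚ k] : stabM (deltaM k G) = stabMod (deltaMod k G) := by
  have hinj : Function.Injective (CTensorMod.map (kappa k G).toLinearMap kappa_mem_fil) :=
    CTensorMod.map_injective _ _ (kappa k G).symm.toLinearMap kappa_symm_mem_fil
      (kappa k G).symm_apply_apply
  ext Ψ
  have key : ∀ r : RX k G,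
      CTensorMod.map (gammaAutM Ψ) (gammaAutM_mem_fil Ψ) (deltaM k G (kappa k G r)) =
          deltaM k G (gammaAutM Ψ (kappa k G r)) ↔
        CTensorMod.map (gammaSY Ψ) (gammaSY_mem_fil Ψ) (deltaMod k G r) =
          deltaMod k G (gammaSY Ψ r) := by
    intro r
    have hl : ∀ n, ∀ x ∈ filM k (RX k G) n,
        ((kappa k G).toLinearMap.comp (gammaSY Ψ)) x ∈ filM k (MHat k G) n :=
      fun n x hx => kappa_mem_fil n _ (gammaSY_mem_fil Ψ n x hx)
    -- Factoring `kappa ∘ gammaSY Ψ = gammaAutM Ψ ∘ kappa` both ways writes each side as the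
    -- completed square of `kappa` applied to the corresponding side of Racinet's condition; that
    -- square is then cancelled.
    rw [← kappa_gammaSY, deltaM_kappa, deltaM_kappa,
      CTensorMod.map_map _ kappa_mem_fil _ (gammaAutM_mem_fil Ψ) _ hl
        (fun x => (kappa_gammaSY Ψ x).symm),
      ← CTensorMod.map_map _ (gammaSY_mem_fil Ψ) _ kappa_mem_fil _ hl fun _ => rfl]
    exact hinj.eq_iff
  refine and_congr_right fun _ => ⟨fun h r => (key r).1 (h _), fun h m => ?_⟩
  obtain ⟨r, rfl⟩ := (kappa k G).surjective m
  exact (key r).2 (h r)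

end coproducts

end DoubleShuffle

theorem mainTheorem2 (k : Type*) [CommRing k] [Algebra ℚ k] (G : Type*) [CommGroup G]
    [Fintype G] :
    ∃ (DW : DoubleShuffle.WHat k G →ₐ[k] DoubleShuffle.CTensorAlg k (DoubleShuffle.WHat k G))
      (DM : DoubleShuffle.MHat k G →ₗ[k] DoubleShuffle.CTensorMod k (DoubleShuffle.MHat k G)),
      (DoubleShuffle.IsDeltaW DW ∧ ∀ D', DoubleShuffle.IsDeltaW D' → D' = DW) ∧
      (DoubleShuffle.IsDeltaM DW DM ∧ ∀ D', DoubleShuffle.IsDeltaM DW D' → D' = DM) ∧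
      DoubleShuffle.stabM DM = DoubleShuffle.stabMod (DoubleShuffle.deltaMod k G) :=
  ⟨DoubleShuffle.deltaW k G, DoubleShuffle.deltaM k G,
    ⟨DoubleShuffle.isDeltaW_deltaW, fun _ => DoubleShuffle.isDeltaW_deltaW.unique⟩,
    ⟨DoubleShuffle.isDeltaM_deltaM, fun _ => DoubleShuffle.isDeltaM_deltaM.unique⟩,
    DoubleShuffle.stabM_deltaM⟩
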